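/- An embedded planar $st$-graph is a finite acyclic digraph $G=(V,E)$ without parallel edges, with a single source $s$ and a single sink $t\neq s$, together with a fixed embedding in the plane such that $s$ and $t$ lie on the outer face. For $u\in V$ let $S(u)=(v_1,\dots,v_m)$ be the list of the heads of the outgoing edges of $u$ in clockwise order around $u$, starting after the incoming edges of $u$ (for $u=s$: starting after the angle of the outer face at $s$). An $st$-ordering is a bijection $\pi:V\to\{1,\dots,|V|\}$ with $\pi(s)=1$, $\pi(t)=|V|$ and $\pi(u)<\pi(v)$ for every edge $(u,v)$. It is bitonic if for every $u \neq t$ there is $1\le h\le m$ with $\pi(v_1)<\dots<\pi(v_h)>\dots>\pi(v_m)$. Splitting an edge $(u,v)$ means replacing it, within the embedding, by a path $(u,w),(w,v)$ through a new vertex $w$. Call $D\subseteq E$ a split set if splitting each edge of $D$ once yields an embedded planar $st$-graph that admits a bitonic $st$-ordering. Write $x\rightsquigarrow y$ if $G$ has a directed path from $x$ to $y$, and let $L(u,h)=|\{1\le i<h: v_{i+1}\rightsquigarrow v_i\}|$ and $R(u,h)=|\{1\le i<h: v_i\rightsquigarrow v_{i+1}\}|$. **Lemma.** Let $G=(V,E)$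 be an embedded planar $st$-graph. 1. $G$ has a split set; that is, it can be transformed into a planar $st$-graph that admits a bitonic $st$-ordering by splitting every edge at most once. 2. If $|V|\ge 3$, then the minimum cardinality of a split set is at most $|V|-3$. 3. A minimum split set is obtained by optimizing each successor list independently: for every $u\ne t$ let $h(u)\in\{1,\dots,m\}$, $m=|S(u)|$, be any index that minimizes $L(u,h)-R(u,h)$. Then the edges $(u,v_i)$ with $i<h(u)$ and $v_{i+1}\rightsquigarrow v_i$ together with the edges $(u,v_{i+1})$ with $h(u)\le i<m$ and $v_i\rightsquigarrow v_{i+1}$, over all $u$, form a split set of minimum cardinality, and this cardinality is $\sum_{u\neq t}\bigl(R(u,|S(u)|)+L(u,h(u))-R(u,h(u))\bigr)$. 4. A minimum split set can be found in linear time: there are a program for the random access machine (unit-cost register and array access, addition, truncated subtraction and comparison) and a constant $C$ such that, for every embedded planar $st$-graph $G$, given by the tails and heads of its edges, the clockwise successor of each edge end around its vertex, $s$, $t$, and the edge preceding the outer face clockwise at $s$, the program halts after at most $C|V|$ steps, with all stored numbers and array indices used for storing at most $C|V|$, and outputs the characteristic vector of a minimum split set of the form described in 3. -/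

import Mathlib

noncomputable section

/-! ### Embedded digraphs -/

/-- A digraph with vertex set `V` and edge set `E`, drawn on an oriented surface. The embedding is
given combinatorially. A *dart* is an edge together with one of its ends: `(e, true)` is the dart
that leaves `tail e` along `e`, and `(e, false)` is the dart that leaves `head e` against `e`.
The permutation `rot` sends a dart to the next dart clockwise around the same vertex. The outer
face is the face that lies, at the vertex `s`, between the dart of the edge `outer` and the
clockwise next one. The required properties are collected in `IsPlanarST`. -/
structure EmbeddedDigraph (V E : Type*) where
  tail : E → V
  head : E → V
  rot : Equiv.Perm (E × Bool)
  s : V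
  t : V
  outer : E

namespace EmbeddedDigraph

variable {V E : Type*}

/-- The vertex at which a dart starts. -/
def origin (G : EmbeddedDigraph V E) (d : E × Bool) : V :=
  if d.2 then G.tail d.1 else G.head d.1

/-- The two darts of an edge are exchanged. -/
def twin : Equiv.Perm (E × Bool) := Equiv.prodCongr (Equiv.refl E) Equiv.boolNot

/-- The boundary walk of a face with the face on the right: walk along the dart `d`, then take, at
the other end of `d`, the counterclockwise neighbour of the dart by which one arrived. The face of
`d` has at the origin of `d` the angle from `d` clockwise to `G.rot d`. -/
def faceNext (G : EmbeddedDigraph V E) : Equiv.Perm (E × Bool) := G.rot⁻¹ * twin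

/-- The number of faces, that is, of boundary walks. -/
def numFaces (G : EmbeddedDigraph V E) : ℕ :=
  Nat.card (Quotient (Equiv.Perm.SameCycle.setoid G.faceNext))

/-- There is an edge from `u` to `v`. -/
def Adj (G : EmbeddedDigraph V E) (u v : V) : Prop := ∃ e, G.tail e = u ∧ G.head e = v

/-- There is a directed path (with at least one edge) from `u` to `v`. -/
def Reach (G : EmbeddedDigraph V E) (u v : V) : Prop := Relation.TransGen G.Adj u v

/-- `G` is an embedded planar st-graph: an acyclic digraph without parallel edges, with the single
source `s` and the single sink `t`, with an embedding into the sphere such that `s` and `t` are on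
the outer face. Such a graph is connected (every vertex can be reached from the source), so Euler's
formula says that the embedding has genus zero. -/
structure IsPlanarST [Fintype V] [Fintype E] (G : EmbeddedDigraph V E) : Prop where
  simple : Function.Injective fun e => (G.tail e, G.head e)
  acyclic : ∀ v, ¬ G.Reach v v
  source : ∀ v, (∀ e, G.head e ≠ v) ↔ v = G.s
  sink : ∀ v, (∀ e, G.tail e ≠ v) ↔ v = G.t
  rotation : ∀ d d', G.rot.SameCycle d d' ↔ G.origin d = G.origin d'
  euler : Fintype.card V + G.numFaces = Fintype.card E + 2
  outer_source : G.tail G.outer = G.s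
  outer_sink : ∃ e, G.head e = G.t ∧ G.faceNext.SameCycle (G.outer, true) (e, false)

/-! ### Successor lists and bitonic st-orderings -/

open Classical in
/-- The number of darts at `u`. -/
def degree [Fintype E] (G : EmbeddedDigraph V E) (u : V) : ℕ :=
  (Finset.univ.filter fun d => G.origin d = u).card

open Classical in
/-- The dart at which the clockwise tour around `u` starts: some incoming edge of `u` if there is
one, and otherwise (that is, if `u` is the source) the first dart after the angle of the outer
face. In a planar st-graph the outgoing edges of a vertex are consecutive around it, so the list
`succList` below does not depend on the incoming edge that is chosen. -/
def startDart (G : EmbeddedDigraph V E) (u : V) : E × Bool :=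
  if h : ∃ e, G.head e = u then (h.choose, false) else G.rot (G.outer, true)

/-- The successor list `S(u)`, as the list of the outgoing edges `(u, v₁), …, (u, vₘ)` of `u` in
clockwise order. -/
def succList [Fintype E] (G : EmbeddedDigraph V E) (u : V) : List E :=
  (List.iterate G.rot (G.startDart u) (G.degree u)).filterMap
    fun d => if d.2 then some d.1 else none

/-- `π` numbers the vertices from `s` to `t` such that every edge goes from the smaller to the
larger number. -/
def IsSTOrdering [Fintype V] (G : EmbeddedDigraph V E) (π : V ≃ Fin (Fintype.card V)) : Prop :=
  (π G.s : ℕ) = 0 ∧ (π G.t : ℕ) + 1 = Fintype.card V ∧ ∀ e, π (G.tail e) < π (G.head e)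

end EmbeddedDigraph

/-- The sequence increases strictly up to the entry with index `h` and decreases strictly from this
entry on (indices start at zero; the empty sequence is bitonic). -/
def IsBitonic {α : Type*} [LT α] (a : List α) : Prop :=
  ∃ h : ℕ, (a.take (h + 1)).Pairwise (· < ·) ∧ (a.drop h).Pairwise (· > ·)

namespace EmbeddedDigraph

variable {V E : Type*}

/-- `π` is an st-ordering with respect to which every successor list is bitonic. -/
def IsBitonicSTOrdering [Fintype V] [Fintype E] (G : EmbeddedDigraph V E)
    (π : V ≃ Fin (Fintype.card V)) : Prop :=
  G.IsSTOrdering π ∧ ∀ u, IsBitonic ((G.succList u).map fun e => π (G.head e))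

/-! ### Splitting edges -/

open Classical in
/-- The darts after the edges of `D` have been split: each of the old darts at the old vertices
survives, and each dummy vertex has two darts. The edge `Sum.inl e` is `e` itself if `e ∉ D`, and
the half of `e` at its tail if `e ∈ D`; the edge `Sum.inr e` is the half of `e` at its head. -/
def splitDarts (D : Finset E) : (E ⊕ D) × Bool ≃ (E × Bool) ⊕ (D × Bool) where
  toFun
    | (.inl e, true) => .inl (e, true)
    | (.inl e, false) => if h : e ∈ D then .inr (⟨e, h⟩, false) else .inl (e, false)
    | (.inr d, true) => .inr (d, true)
    | (.inr d, false) => .inl (d.1, false)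
  invFun
    | .inl (e, true) => (.inl e, true)
    | .inl (e, false) => if h : e ∈ D then (.inr ⟨e, h⟩, false) else (.inl e, false)
    | .inr (d, true) => (.inr d, true)
    | .inr (d, false) => (.inl d.1, false)
  left_inv := by
    rintro ⟨e | d, _ | _⟩
    · by_cases h : e ∈ D <;> simp [h]
    · rfl
    · simp
    · rfl
  right_inv := by
    rintro (⟨e, _ | _⟩ | ⟨d, _ | _⟩)
    · by_cases h : e ∈ D <;> simp [h]
    · rfl
    · simp
    · rfl

open Classical in
/-- The embedded digraph obtained from `G` by replacing each edge `(u, v)` in `D` with a path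
`(u, w), (w, v)` through a new dummy vertex `w`, drawn along the old edge. -/
def split (G : EmbeddedDigraph V E) (D : Finset E) : EmbeddedDigraph (V ⊕ D) (E ⊕ D) where
  tail
    | .inl e => .inl (G.tail e)
    | .inr d => .inr d
  head
    | .inl e => if h : e ∈ D then .inr ⟨e, h⟩ else .inl (G.head e)
    | .inr d => .inl (G.head d.1)
  rot := ((splitDarts D).trans (Equiv.sumCongr G.rot twin)).trans (splitDarts D).symm
  s := .inl G.s
  t := .inl G.t
  outer := .inl G.outer

/-- Splitting once each edge of `D` gives an embedded planar st-graph that admits a bitonic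
st-ordering. -/
def IsSplitSet [Fintype V] [Fintype E] (G : EmbeddedDigraph V E) (D : Finset E) : Prop :=
  (G.split D).IsPlanarST ∧ ∃ π, (G.split D).IsBitonicSTOrdering π

/-- `D` is a smallest set of edges whose splitting gives an embedded planar st-graph that admits a
bitonic st-ordering. -/
def IsMinSplitSet [Fintype V] [Fintype E] (G : EmbeddedDigraph V E) (D : Finset E) : Prop :=
  G.IsSplitSet D ∧ ∀ D' : Finset E, G.IsSplitSet D' → D.card ≤ D'.card

/-! ### Peaks of successor lists

Positions in the list `S(u)` are counted from zero. -/

open Classical in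
/-- `L(u, h)`: the number of positions `i < h` of `S(u)` with a path from the successor at `i + 1`
to the successor at `i`. -/
def numBack [Fintype E] (G : EmbeddedDigraph V E) (u : V) (h : ℕ) : ℕ :=
  ((Finset.range h).filter fun i => ∃ e e', (G.succList u)[i]? = some e ∧
    (G.succList u)[i + 1]? = some e' ∧ G.Reach (G.head e') (G.head e)).card

open Classical in
/-- `R(u, h)`: the number of positions `i < h` of `S(u)` with a path from the successor at `i` to
the successor at `i + 1`. -/
def numForth [Fintype E] (G : EmbeddedDigraph V E) (u : V) (h : ℕ) : ℕ :=
  ((Finset.range h).filter fun i => ∃ e e', (G.succList u)[i]? = some e ∧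
    (G.succList u)[i + 1]? = some e' ∧ G.Reach (G.head e) (G.head e')).card

/-- `h` is a position of `S(u)` that minimizes `L(u, h) - R(u, h)`. If `S(u)` is empty (that is, if
`u` is the sink), there is nothing to choose, and the number `h` plays no role. -/
def IsBestPeak [Fintype E] (G : EmbeddedDigraph V E) (u : V) (h : ℕ) : Prop :=
  (G.succList u ≠ [] → h < (G.succList u).length) ∧ ∀ h' < (G.succList u).length,
    (G.numBack u h - G.numForth u h : ℤ) ≤ G.numBack u h' - G.numForth u h'

open Classical in
/-- The edges to split if the successor at position `h u` is to become the peak of `S(u)`, for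
each `u`: the edge `(u, vᵢ)` with `i < h u` if there is a path from `vᵢ₊₁` to `vᵢ`, and the edge
`(u, vᵢ₊₁)` with `h u ≤ i` if there is a path from `vᵢ` to `vᵢ₊₁`. -/
def peakSplitSet [Fintype E] (G : EmbeddedDigraph V E) (h : V → ℕ) : Finset E :=
  Finset.univ.filter fun e => ∃ i e',
    (i < h (G.tail e) ∧ (G.succList (G.tail e))[i]? = some e ∧
      (G.succList (G.tail e))[i + 1]? = some e' ∧ G.Reach (G.head e') (G.head e)) ∨
    (h (G.tail e) ≤ i ∧ (G.succList (G.tail e))[i]? = some e' ∧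
      (G.succList (G.tail e))[i + 1]? = some e ∧ G.Reach (G.head e') (G.head e))

end EmbeddedDigraph

/-! ### Random access machines

Programs over natural numbers with finitely many registers and finitely many arrays. An elementary
operation is an access to a register or an array cell, an addition, a truncated subtraction, or a
comparison. -/

namespace RAM

/-- The contents of the registers and of the arrays. -/
structure State where
  reg : ℕ → ℕ
  arr : ℕ → ℕ → ℕ

/-- Expressions; `read a i` is the entry of array `a` at the index `i`. -/
inductive Expr where
  | const (c : ℕ)
  | reg (x : ℕ)
  | read (a : ℕ) (i : Expr)
  | add (e₁ e₂ : Expr)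
  | sub (e₁ e₂ : Expr)
  | lt (e₁ e₂ : Expr)
  | eq (e₁ e₂ : Expr)

/-- The value of an expression; comparisons give one for true and zero for false. -/
def Expr.eval (σ : State) : Expr → ℕ
  | .const c => c
  | .reg x => σ.reg x
  | .read a i => σ.arr a (i.eval σ)
  | .add e₁ e₂ => e₁.eval σ + e₂.eval σ
  | .sub e₁ e₂ => e₁.eval σ - e₂.eval σ
  | .lt e₁ e₂ => if e₁.eval σ < e₂.eval σ then 1 else 0
  | .eq e₁ e₂ => if e₁.eval σ = e₂.eval σ then 1 else 0

/-- The number of elementary operations needed to evaluate an expression. -/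
def Expr.cost : Expr → ℕ
  | .const _ => 1
  | .reg _ => 1
  | .read _ i => i.cost + 1
  | .add e₁ e₂ => e₁.cost + e₂.cost + 1
  | .sub e₁ e₂ => e₁.cost + e₂.cost + 1
  | .lt e₁ e₂ => e₁.cost + e₂.cost + 1
  | .eq e₁ e₂ => e₁.cost + e₂.cost + 1

/-- Programs. -/
inductive Prog where
  | nop
  | assign (x : ℕ) (e : Expr)
  | write (a : ℕ) (i e : Expr)
  | seq (p q : Prog)
  | cond (e : Expr) (p q : Prog)
  | loop (e : Expr) (p : Prog)

/-- `Exec W p σ k σ'`: the program `p`, started in the state `σ`, halts after `k` steps in the state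
`σ'`, and all numbers and indices that it stores are at most `W` (so that memory cells are words of
about `log₂ W` bits). `loop e p` repeats `p` as long as `e` is not zero. -/
inductive Exec (W : ℕ) : Prog → State → ℕ → State → Prop
  | nop (σ : State) : Exec W .nop σ 1 σ
  | assign (σ : State) (x : ℕ) (e : Expr) : e.eval σ ≤ W →
      Exec W (.assign x e) σ (e.cost + 1) ⟨Function.update σ.reg x (e.eval σ), σ.arr⟩
  | write (σ : State) (a : ℕ) (i e : Expr) : i.eval σ ≤ W → e.eval σ ≤ W →
      Exec W (.write a i e) σ (i.cost + e.cost + 1)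
        ⟨σ.reg, Function.update σ.arr a (Function.update (σ.arr a) (i.eval σ) (e.eval σ))⟩
  | seq (σ σ₁ σ₂ : State) (p q : Prog) (k₁ k₂ : ℕ) : Exec W p σ k₁ σ₁ → Exec W q σ₁ k₂ σ₂ →
      Exec W (.seq p q) σ (k₁ + k₂) σ₂
  | cond_true (σ σ₁ : State) (e : Expr) (p q : Prog) (k : ℕ) : e.eval σ ≠ 0 → Exec W p σ k σ₁ →
      Exec W (.cond e p q) σ (e.cost + 1 + k) σ₁
  | cond_false (σ σ₁ : State) (e : Expr) (p q : Prog) (k : ℕ) : e.eval σ = 0 → Exec W q σ k σ₁ →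
      Exec W (.cond e p q) σ (e.cost + 1 + k) σ₁
  | loop_done (σ : State) (e : Expr) (p : Prog) : e.eval σ = 0 →
      Exec W (.loop e p) σ (e.cost + 1) σ
  | loop_step (σ σ₁ σ₂ : State) (e : Expr) (p : Prog) (k₁ k₂ : ℕ) : e.eval σ ≠ 0 →
      Exec W p σ k₁ σ₁ → Exec W (.loop e p) σ₁ k₂ σ₂ →
      Exec W (.loop e p) σ (e.cost + 1 + k₁ + k₂) σ₂

/-- The number of a dart: `2 e` for `(e, true)` and `2 e + 1` for `(e, false)`. -/
def dartCode {m : ℕ} (d : Fin m × Bool) : ℕ := 2 * d.1 + if d.2 then 0 else 1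

/-- The state that holds the embedded digraph `G` with vertices `0, …, n - 1` and edges
`0, …, m - 1`: registers `0, …, 4` hold `n`, `m`, `s`, `t` and the edge `outer`, arrays `0` and `1`
hold the tails and the heads of the edges, array `2` holds the clockwise next dart of each dart,
and everything else is zero. -/
def inputState {n m : ℕ} (G : EmbeddedDigraph (Fin n) (Fin m)) : State where
  reg
    | 0 => n
    | 1 => m
    | 2 => G.s
    | 3 => G.t
    | 4 => G.outer
    | _ => 0
  arr
    | 0 => fun i => if h : i < m then G.tail ⟨i, h⟩ else 0
    | 1 => fun i => if h : i < m then G.head ⟨i, h⟩ else 0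
    | 2 => fun i => if h : i / 2 < m then dartCode (G.rot (⟨i / 2, h⟩, i % 2 == 0)) else 0
    | _ => fun _ => 0

/-- The state presents the set `D` of edges as its output: array `3` is the characteristic vector
of `D`. -/
def IsOutput {m : ℕ} (σ : State) (D : Finset (Fin m)) : Prop :=
  ∀ e : Fin m, σ.arr 3 e = if e ∈ D then 1 else 0

end RAM

end

/-! ### Permutations, numberings and flows -/

/-! The heart of the proof is a statement about acyclicity (`augmented_acyclic`): new edges between
the heads of consecutive outgoing edges of a vertex, drawn in the faces between them, create no
directed cycle as long as no new edge leaves the sink of its face and none is drawn in the outer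
face. A cycle would carry a nonnegative flow. Rerouting the flow on each new edge through the common
tail gives a circulation of the planar graph, hence a potential on the faces, which never decreases
when an edge is crossed from right to left. The dual graph has no directed cycle away from the outer
face (`dual_acyclic`), so both extremes of the potential are attained at the outer face. The
potential is therefore constant and the flow vanishes.

Topology enters only through Euler's formula, in two ways. As a count of angles (`unique_angles`) it
shows that every face has one source and one sink and that outgoing edges are consecutive. As a
count of dimensions (`exists_preimage_of_orthogonal`) it turns circulations into potentials, without
any appeal to the plane.

A path between consecutive successors therefore exists exactly when its end is the sink of the face
between them (`reach_next_iff`, `reach_prev_iff`). For any choice of peaks, splitting the offending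
edges moves their ends to dummy vertices, which are not sinks. All edges directed towards the peaks
can then be added acyclically, and a linear extension is a bitonic st-ordering
(`isSplitSet_peakSplitSet`). Conversely, the peaks of any bitonic ordering force the corresponding
edges to be split (`exists_peakSplitSet_subset`). The size of these sets is a sum over the vertices,
so minimization is independent at each vertex.

The bound `|V| - 3` comes from comparing the first and the last successor as peaks, together with
`|E| ≤ 3|V| - 6`. The algorithm is linear because the two reachability criteria are local tests on
the rotation. -/

namespace Equiv.Perm

variable {α : Type*}

/-- Otherwise `p` would fail on the whole orbit of `a`. Applied to rotations and face walks, this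
finds places where the darts change direction. -/
theorem SameCycle.exists_transition [Finite α] {f : Perm α} {p : α → Prop} {a b : α}
    (h : f.SameCycle a b) (ha : ¬ p a) (hb : p b) : ∃ c, f.SameCycle a c ∧ ¬ p c ∧ p (f c) := by
  obtain ⟨k, hk⟩ := h.exists_nat_pow_eq
  by_contra! hc
  have : ∀ j : ℕ, ¬ p ((f ^ j) a) := by
    intro j
    induction j with
    | zero => simpa using ha
    | succ j ih =>
      rw [pow_succ', mul_apply]
      exact hc _ ⟨j, by simp⟩ ih
  exact this k (hk ▸ hb)

/-- The cycle can leave `p` only at `x`, so the walk from `a` stays in `p` up to its first visit to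
`x`. This turns one side of a face boundary into a directed path. -/
theorem SameCycle.exists_path_of_unique_transition [Finite α] {f : Perm α} {p : α → Prop} {a x : α}
    (h : f.SameCycle a x) (ha : p a)
    (hx : ∀ c, f.SameCycle a c → p c → ¬ p (f c) → c = x) :
    ∃ k : ℕ, (f ^ k) a = x ∧ ∀ i ≤ k, p ((f ^ i) a) := by
  classical
  have hex := h.exists_nat_pow_eq
  refine ⟨Nat.find hex, Nat.find_spec hex, fun i => ?_⟩
  induction i with
  | zero => intro _; simpa using ha
  | succ i ih =>
    intro hi
    by_contra hp
    rw [pow_succ', mul_apply] at hp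
    exact Nat.find_min hex (Nat.lt_of_succ_le hi) (hx _ ⟨i, by simp⟩ (ih (by omega)) hp)

end Equiv.Perm

theorem exists_numbering {V : Type*} [Fintype V] (r : V → V → Prop)
    (h : ∀ v, ¬ Relation.TransGen r v v) :
    ∃ π : V ≃ Fin (Fintype.card V), ∀ a b, r a b → π a < π b := by
  classical
  have : IsPartialOrder V (Relation.ReflTransGen r) :=
    { refl := fun _ => .refl
      trans := fun _ _ _ => .trans
      antisymm := fun a b hab hba => by
        by_contra hne
        rcases Relation.reflTransGen_iff_eq_or_transGen.1 hab with h1 | h1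
        · exact hne h1.symm
        · exact h a (h1.trans_left hba) }
  obtain ⟨s, hs, hrs⟩ := extend_partialOrder (Relation.ReflTransGen r)
  let _ : LinearOrder V :=
    { le := s
      le_refl := hs.refl
      le_trans := hs.trans
      le_antisymm := hs.antisymm
      le_total := hs.total
      toDecidableLE := Classical.decRel _ }
  refine ⟨(Fintype.orderIsoFinOfCardEq V rfl).symm.toEquiv, fun a b hab => ?_⟩
  refine (Fintype.orderIsoFinOfCardEq V rfl).symm.lt_iff_lt.2 (lt_of_le_of_ne ?_ ?_)
  · exact hrs _ _ (.single hab)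
  · rintro rfl
    exact h a (.single hab)

/-- The weight of an arc counts how often the path uses it, and the sum telescopes. For `x = y` this
is a nonzero circulation. -/
theorem exists_flow {A X : Type*} [Fintype A] (S : Set A) (tl hd : A → X) {x y : X}
    (h : Relation.TransGen (fun x y => ∃ a ∈ S, tl a = x ∧ hd a = y) x y) :
    ∃ c : A → ℚ, (∀ a, 0 ≤ c a) ∧ (∀ a ∉ S, c a = 0) ∧ (∃ a, 0 < c a) ∧
      ∀ φ : X → ℚ, ∑ a, c a * (φ (hd a) - φ (tl a)) = φ y - φ x := by
  classical
  have key : ∀ a : A, ∀ φ : X → ℚ,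
      ∑ b, (Pi.single a 1 : A → ℚ) b * (φ (hd b) - φ (tl b)) = φ (hd a) - φ (tl a) := by
    intro a φ
    rw [Finset.sum_eq_single a] <;> simp +contextual
  have single : ∀ a ∈ S, ∀ b, 0 ≤ (Pi.single a 1 : A → ℚ) b ∧
      (b ∉ S → (Pi.single a 1 : A → ℚ) b = 0) := by
    intro a ha b
    rcases eq_or_ne b a with rfl | hb
    · simp [ha]
    · simp [hb]
  induction h with
  | single h =>
    obtain ⟨a, ha, rfl, rfl⟩ := h
    exact ⟨Pi.single a 1, fun b => (single a ha b).1, fun b => (single a ha b).2,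
      ⟨a, by simp⟩, key a⟩
  | tail _ h ih =>
    obtain ⟨a, ha, rfl, rfl⟩ := h
    obtain ⟨c, h0, hS, ⟨a', ha'⟩, hc⟩ := ih
    refine ⟨c + Pi.single a 1, fun b => add_nonneg (h0 b) (single a ha b).1,
      fun b hb => ?_, ⟨a', add_pos_of_pos_of_nonneg ha' (single a ha a').1⟩, fun φ => ?_⟩
    · simp [hS b hb, (single a ha b).2 hb]
    · simp only [Pi.add_apply, add_mul, Finset.sum_add_distrib, hc, key]
      ring

/-! ### Linear algebra: orthogonal complements and dimension counts -/

theorem card_le_finrank_range_add_one {V E : Type*} [Fintype V] [Finite E]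
    (a : (V → ℚ) →ₗ[ℚ] (E → ℚ)) (ha : ∀ φ, a φ = 0 → ∀ x y, φ x = φ y) :
    Fintype.card V ≤ Module.finrank ℚ (LinearMap.range a) + 1 := by
  have h1 : LinearMap.ker a ≤ Submodule.span ℚ {fun _ => (1 : ℚ)} := by
    intro φ hφ
    rw [Submodule.mem_span_singleton]
    rcases isEmpty_or_nonempty V with hV | ⟨⟨x⟩⟩
    · exact ⟨0, Subsingleton.elim _ _⟩
    · exact ⟨φ x, funext fun y => by simpa using ha φ hφ x y⟩
  have h2 := (Submodule.finrank_mono h1).trans (finrank_span_le_card _)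
  have h3 := a.finrank_range_add_finrank_ker
  simp at h2 h3
  omega

/-- If the ranges of two linear maps into `E → ℚ` are orthogonal, if their kernels contain only
constants and if the dimensions match, then each range is the orthogonal complement of the other. -/
theorem exists_preimage_of_orthogonal {V F E : Type*} [Fintype V] [Fintype F] [Fintype E]
    (a : (V → ℚ) →ₗ[ℚ] (E → ℚ)) (b : (F → ℚ) →ₗ[ℚ] (E → ℚ))
    (hab : ∀ φ w, ∑ e, b w e * a φ e = 0) (ha : ∀ φ, a φ = 0 → ∀ x y, φ x = φ y)
    (hb : ∀ w, b w = 0 → ∀ x y, w x = w y)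
    (hcard : Fintype.card E + 2 ≤ Fintype.card V + Fintype.card F)
    (c : E → ℚ) (hc : ∀ φ, ∑ e, c e * a φ e = 0) : ∃ w, b w = c := by
  classical
  have hra := card_le_finrank_range_add_one a ha
  have hrb := card_le_finrank_range_add_one b hb
  let A := LinearMap.toMatrix' a
  have hA : ∀ φ, A.mulVec φ = a φ := fun φ => LinearMap.toMatrix'_mulVec a φ
  -- The kernel of the transposed matrix is the orthogonal complement of the range of `a`.
  have horth : ∀ c : E → ℚ, (∀ φ, ∑ e, c e * a φ e = 0) → c ∈ LinearMap.ker A.transpose.mulVecLin := by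
    intro c hc
    rw [LinearMap.mem_ker, Matrix.mulVecLin_apply, Matrix.mulVec_transpose]
    refine dotProduct_eq_zero _ fun φ => ?_
    rw [← Matrix.dotProduct_mulVec, hA]
    exact hc φ
  have hle : LinearMap.range b ≤ LinearMap.ker A.transpose.mulVecLin := by
    rintro _ ⟨w, rfl⟩
    exact horth _ fun φ => hab φ w
  have hrank : Module.finrank ℚ (LinearMap.range A.transpose.mulVecLin) =
      Module.finrank ℚ (LinearMap.range a) := by
    have := A.rank_transpose
    rw [Matrix.rank, Matrix.rank] at this
    rw [this, show A.mulVecLin = a from LinearMap.ext hA]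
  have hdim := A.transpose.mulVecLin.finrank_range_add_finrank_ker
  rw [hrank, Module.finrank_fintype_fun_eq_card] at hdim
  -- The complement has dimension `|E| - rank a`, which is at most `rank b` by the two rank bounds
  -- and `hcard`.
  have heq := Submodule.eq_of_le_of_finrank_le hle (by omega)
  have := horth c hc
  rw [← heq] at this
  exact this

/-! ### Angles at the vertices and in the faces of a planar st-graph -/

namespace EmbeddedDigraph

variable {V E : Type*} {G : EmbeddedDigraph V E}

@[simp] theorem origin_true (e : E) : G.origin (e, true) = G.tail e := rfl

@[simp] theorem origin_false (e : E) : G.origin (e, false) = G.head e := rfl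

@[simp] theorem twin_apply (e : E) (b : Bool) : twin (e, b) = (e, !b) := rfl

theorem rot_inv_rot (d : E × Bool) : G.rot⁻¹ (G.rot d) = d := by simp

theorem rot_rot_inv (d : E × Bool) : G.rot (G.rot⁻¹ d) = d := by simp

theorem faceNext_eq_iff {d : E × Bool} {e : E} {b : Bool} :
    G.faceNext (e, b) = d ↔ G.rot d = (e, !b) := by
  rw [faceNext, Equiv.Perm.mul_apply, Equiv.Perm.inv_eq_iff_eq, twin_apply, eq_comm]

theorem rot_faceNext (d : E × Bool) : G.rot (G.faceNext d) = twin d :=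
  faceNext_eq_iff.1 rfl

/-- The type of faces. -/
abbrev Face (G : EmbeddedDigraph V E) : Type _ :=
  Quotient (Equiv.Perm.SameCycle.setoid G.faceNext)

/-- The face to the right of a dart. -/
def face (G : EmbeddedDigraph V E) (d : E × Bool) : G.Face := Quotient.mk _ d

theorem face_eq_iff {d d' : E × Bool} : G.face d = G.face d' ↔ G.faceNext.SameCycle d d' :=
  Quotient.eq

theorem face_faceNext (d : E × Bool) : G.face (G.faceNext d) = G.face d :=
  face_eq_iff.2 ⟨-1, by simp⟩

/-- The angle from `d` clockwise to `G.rot d` is a corner of the face to the right of `d`; the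
boundary walk arrives at this corner along the twin of `G.rot d`. -/
theorem face_of_rot {d : E × Bool} {e : E} {b : Bool} (h : G.rot d = (e, !b)) :
    G.face d = G.face (e, b) := by
  rw [← faceNext_eq_iff.2 h, face_faceNext]

theorem exists_face_eq (f : G.Face) : ∃ d, G.face d = f := Quotient.exists_rep f

noncomputable instance [Fintype E] : Fintype G.Face := Fintype.ofFinite _

namespace IsPlanarST

variable [Fintype V] [Fintype E]

section
variable (hG : G.IsPlanarST)
include hG

theorem card_face : Fintype.card V + Fintype.card G.Face = Fintype.card E + 2 := by
  rw [← hG.euler, numFaces, Nat.card_eq_fintype_card]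

theorem origin_rot (d : E × Bool) : G.origin (G.rot d) = G.origin d :=
  ((hG.rotation _ _).1 ⟨1, by simp⟩).symm

theorem origin_rot_inv (d : E × Bool) : G.origin (G.rot⁻¹ d) = G.origin d := by
  rw [← hG.origin_rot (G.rot⁻¹ d)]
  simp

theorem origin_faceNext (d : E × Bool) : G.origin (G.faceNext d) = G.origin (twin d) := by
  rw [← hG.origin_rot, rot_faceNext]

theorem tail_ne_head (e e' : E) (h : G.tail e = G.tail e') (h' : G.head e = G.head e') : e = e' :=
  hG.simple (Prod.ext h h')

theorem head_ne_source (e : E) : G.head e ≠ G.s := (hG.source _).2 rfl e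

theorem tail_ne_sink (e : E) : G.tail e ≠ G.t := (hG.sink _).2 rfl e

theorem tail_ne_head_self (e : E) : G.tail e ≠ G.head e := fun h =>
  hG.acyclic (G.tail e) (.single ⟨e, rfl, h.symm⟩)

theorem snd_of_origin_eq_source {d : E × Bool} (h : G.origin d = G.s) : d.2 = true := by
  obtain ⟨e, _ | _⟩ := d
  · exact absurd h (hG.head_ne_source e)
  · rfl

theorem snd_of_origin_eq_sink {d : E × Bool} (h : G.origin d = G.t) : d.2 = false := by
  obtain ⟨e, _ | _⟩ := d
  · rfl
  · exact absurd h (hG.tail_ne_sink e)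

theorem exists_height : ∃ π : V ≃ Fin (Fintype.card V), ∀ e, π (G.tail e) < π (G.head e) := by
  obtain ⟨π, hπ⟩ := exists_numbering G.Adj hG.acyclic
  exact ⟨π, fun e => hπ _ _ ⟨e, rfl, rfl⟩⟩

theorem reach_of_source (v : V) : Relation.ReflTransGen G.Adj G.s v := by
  obtain ⟨π, hπ⟩ := hG.exists_height
  induction h : π v using WellFoundedLT.induction generalizing v with
  | ind k ih =>
    subst h
    by_cases hv : v = G.s
    · rw [hv]
    · have := (hG.source v).not.2 hv
      push Not at this
      obtain ⟨e, rfl⟩ := this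
      exact (ih _ (hπ e) _ rfl).tail ⟨e, rfl, rfl⟩

theorem reach_sink (v : V) : Relation.ReflTransGen G.Adj v G.t := by
  obtain ⟨π, hπ⟩ := hG.exists_height
  induction h : π v using WellFoundedGT.induction generalizing v with
  | ind k ih =>
    subst h
    by_cases hv : v = G.t
    · rw [hv]
    · have := (hG.sink v).not.2 hv
      push Not at this
      obtain ⟨e, rfl⟩ := this
      exact (ih _ (hπ e) _ rfl).head ⟨e, rfl, rfl⟩

/-- The boundary of a face is not a directed cycle. -/
theorem exists_dart_of_face (d : E × Bool) (b : Bool) : ∃ e, G.face (e, b) = G.face d := by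
  obtain ⟨π, hπ⟩ := hG.exists_height
  by_contra! hb
  have hd : ∀ j : ℕ, ((G.faceNext ^ j) d).2 = !b := by
    intro j
    by_contra hj
    refine hb ((G.faceNext ^ j) d).1 (face_eq_iff.2 (Equiv.Perm.SameCycle.symm ⟨j, ?_⟩))
    rw [zpow_natCast]
    refine Prod.ext rfl ?_
    revert hj
    cases b <;> simp
  -- If all darts of the boundary pointed the same way, the height would be strictly monotone along
  -- a periodic walk.
  have hlt : ∀ j : ℕ, if b then (π (G.origin ((G.faceNext ^ (j + 1)) d))) <
      π (G.origin ((G.faceNext ^ j) d)) else π (G.origin ((G.faceNext ^ j) d)) <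
      (π (G.origin ((G.faceNext ^ (j + 1)) d))) := by
    intro j
    have h1 := hd j
    rw [pow_succ', Equiv.Perm.mul_apply, hG.origin_faceNext]
    generalize (G.faceNext ^ j) d = d' at h1
    obtain ⟨e, b'⟩ := d'
    obtain rfl : b' = !b := h1
    cases b <;> simpa using hπ e
  have hper : (G.faceNext ^ orderOf G.faceNext) d = (G.faceNext ^ 0) d := by
    rw [pow_orderOf_eq_one, pow_zero]
  have hpos := orderOf_pos G.faceNext
  cases b
  · have hm : StrictMono fun j : ℕ => π (G.origin ((G.faceNext ^ j) d)) :=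
      strictMono_nat_of_lt_succ fun j => by simpa using hlt j
    exact absurd (congrArg (fun x => π (G.origin x)) hper) (hm hpos).ne'
  · have hm : StrictAnti fun j : ℕ => π (G.origin ((G.faceNext ^ j) d)) :=
      strictAnti_nat_of_succ_lt fun j => by simpa using hlt j
    exact absurd (congrArg (fun x => π (G.origin x)) hper) (hm hpos).ne

/-- Where the boundary walk changes from backward to forward darts, it passes a corner between two
consecutive outgoing edges. -/
theorem exists_source_angle (f : G.Face) :
    ∃ e, (G.rot (e, true)).2 = true ∧ G.face (e, true) = f := by
  obtain ⟨d, rfl⟩ := exists_face_eq f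
  obtain ⟨e₁, h₁⟩ := hG.exists_dart_of_face d false
  obtain ⟨e₂, h₂⟩ := hG.exists_dart_of_face d true
  obtain ⟨⟨c, b⟩, hc, hc₁, hc₂⟩ := (face_eq_iff.1 (h₁.trans h₂.symm)).exists_transition
    (p := fun d => d.2 = true) (by simp) rfl
  obtain rfl : b = false := by simpa using hc₁
  obtain ⟨⟨e, b⟩, he⟩ : ∃ x, x = G.faceNext (c, false) := ⟨_, rfl⟩
  rw [← he] at hc₂
  obtain rfl : b = true := hc₂
  refine ⟨e, by rw [faceNext_eq_iff.1 he.symm]; rfl, ?_⟩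
  rw [he, face_faceNext, ← face_eq_iff.2 hc, h₁]

theorem exists_sink_angle (f : G.Face) :
    ∃ e, (G.rot (e, false)).2 = false ∧ G.face (e, false) = f := by
  obtain ⟨d, rfl⟩ := exists_face_eq f
  obtain ⟨e₁, h₁⟩ := hG.exists_dart_of_face d true
  obtain ⟨e₂, h₂⟩ := hG.exists_dart_of_face d false
  obtain ⟨⟨c, b⟩, hc, hc₁, hc₂⟩ := (face_eq_iff.1 (h₁.trans h₂.symm)).exists_transition
    (p := fun d => d.2 = false) (by simp) rfl
  obtain rfl : b = true := by simpa using hc₁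
  obtain ⟨⟨e, b⟩, he⟩ : ∃ x, x = G.faceNext (c, true) := ⟨_, rfl⟩
  rw [← he] at hc₂
  obtain rfl : b = false := hc₂
  refine ⟨e, by rw [faceNext_eq_iff.1 he.symm]; rfl, ?_⟩
  rw [he, face_faceNext, ← face_eq_iff.2 hc, h₁]

theorem exists_turn (v : V) (hs : v ≠ G.s) (ht : v ≠ G.t) :
    ∃ e, (G.rot (e, false)).2 = true ∧ G.head e = v := by
  have h₁ := (hG.source v).not.2 hs
  have h₂ := (hG.sink v).not.2 ht
  push Not at h₁ h₂
  obtain ⟨e₁, h₁⟩ := h₁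
  obtain ⟨e₂, h₂⟩ := h₂
  obtain ⟨⟨c, b⟩, hc, hc₁, hc₂⟩ := ((hG.rotation (e₁, false) (e₂, true)).2
    (h₁.trans h₂.symm)).exists_transition (p := fun d => d.2 = true) (by simp) rfl
  obtain rfl : b = false := by simpa using hc₁
  exact ⟨c, hc₂, ((hG.rotation _ _).1 hc).symm.trans h₁⟩

/-- Counting angles with Euler's formula: each face has only one source and one sink, and each
inner vertex has only one angle from an incoming to the clockwise next outgoing edge. -/
theorem unique_angles :
    Function.Injective (fun e : {e // (G.rot (e, true)).2 = true} => G.face (e.1, true)) ∧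
    Function.Injective (fun e : {e // (G.rot (e, false)).2 = false} => G.face (e.1, false)) ∧
    Function.Injective (fun e : {e // (G.rot (e, false)).2 = true} => G.head e.1) := by
  classical
  -- An incoming dart is followed either by an outgoing or by an incoming one.
  have c₁ : Fintype.card {e // (G.rot (e, false)).2 = true} +
      Fintype.card {e // (G.rot (e, false)).2 = false} = Fintype.card E := by
    have h := Fintype.card_subtype_compl (fun e => (G.rot (e, false)).2 = false)
    have h' := Fintype.card_subtype_le (fun e => (G.rot (e, false)).2 = false)
    simp only [Bool.not_eq_false] at h
    omega
  -- An outgoing dart follows either an incoming or an outgoing one; the count is transported along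
  -- the bijection `G.rot`.
  have c₂ : Fintype.card {e // (G.rot (e, false)).2 = true} +
      Fintype.card {e // (G.rot (e, true)).2 = true} = Fintype.card E := by
    have h₁ : Fintype.card {d : E × Bool // (G.rot d).2 = true} =
        Fintype.card {d : E × Bool // d.2 = true} :=
      Fintype.card_congr (G.rot.subtypeEquiv fun _ => Iff.rfl)
    have h₂ : ∀ p : E × Bool → Bool, Fintype.card {d : E × Bool // p d = true} =
        Fintype.card {e // p (e, false) = true} + Fintype.card {e // p (e, true) = true} := by
      intro p
      simp only [Fintype.card_subtype, Finset.card_filter, Fintype.sum_prod_type,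
        Fintype.sum_bool, Finset.sum_add_distrib]
      exact add_comm _ _
    rw [h₂ (fun d => (G.rot d).2), h₂ (fun d => d.2)] at h₁
    simpa using h₁
  have s₁ : Function.Surjective
      (fun e : {e // (G.rot (e, true)).2 = true} => G.face (e.1, true)) := fun f => by
    obtain ⟨e, h, h'⟩ := hG.exists_source_angle f
    exact ⟨⟨e, h⟩, h'⟩
  have s₂ : Function.Surjective
      (fun e : {e // (G.rot (e, false)).2 = false} => G.face (e.1, false)) := fun f => by
    obtain ⟨e, h, h'⟩ := hG.exists_sink_angle f
    exact ⟨⟨e, h⟩, h'⟩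
  have ht : ∀ e : {e // (G.rot (e, false)).2 = true}, G.head e.1 ≠ G.s ∧ G.head e.1 ≠ G.t := by
    refine fun e => ⟨hG.head_ne_source _, fun h => ?_⟩
    have := hG.snd_of_origin_eq_sink ((hG.origin_rot (e.1, false)).trans h)
    simp [e.2] at this
  have s₃ : Function.Surjective (fun e : {e // (G.rot (e, false)).2 = true} =>
      (⟨G.head e.1, ht e⟩ : {v // v ≠ G.s ∧ v ≠ G.t})) := fun ⟨v, hv⟩ => by
    obtain ⟨e, h, h'⟩ := hG.exists_turn v hv.1 hv.2
    exact ⟨⟨e, h⟩, Subtype.ext h'⟩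
  have c₃ : Fintype.card V ≤ Fintype.card {v // v ≠ G.s ∧ v ≠ G.t} + 2 := by
    have := Fintype.card_subtype_compl (fun v => v = G.s ∨ v = G.t)
    have h2 : Fintype.card {v // v = G.s ∨ v = G.t} ≤ 2 := by
      rw [Fintype.card_subtype]
      refine (Finset.card_le_card (t := {G.s, G.t}) fun v => ?_).trans Finset.card_le_two
      simp
    have h3 : Fintype.card {v // ¬ (v = G.s ∨ v = G.t)} =
        Fintype.card {v // v ≠ G.s ∧ v ≠ G.t} :=
      Fintype.card_congr (Equiv.subtypeEquivRight fun v => by simp)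
    omega
  -- With `T` turns, `A` source angles, `B` sink angles and `F` faces: `T + A = T + B = |E|`, while
  -- `T ≥ |V| - 2` and `A, B ≥ F`. Euler's formula `|V| - 2 + F = |E|` forces equality everywhere,
  -- so the three surjections are bijections.
  have hE := hG.card_face
  have l₁ := Fintype.card_le_of_surjective _ s₁
  have l₂ := Fintype.card_le_of_surjective _ s₂
  have l₃ := Fintype.card_le_of_surjective _ s₃
  refine ⟨((Fintype.bijective_iff_surjective_and_card _).2 ⟨s₁, ?_⟩).1,
    ((Fintype.bijective_iff_surjective_and_card _).2 ⟨s₂, ?_⟩).1, fun e e' h =>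
    ((Fintype.bijective_iff_surjective_and_card _).2 ⟨s₃, ?_⟩).1 (Subtype.ext h)⟩ <;> omega

theorem source_angle_unique {e e' : E} (h : (G.rot (e, true)).2 = true)
    (h' : (G.rot (e', true)).2 = true) (hf : G.face (e, true) = G.face (e', true)) : e = e' :=
  congrArg Subtype.val (@hG.unique_angles.1 ⟨e, h⟩ ⟨e', h'⟩ hf)

theorem sink_angle_unique {e e' : E} (h : (G.rot (e, false)).2 = false)
    (h' : (G.rot (e', false)).2 = false) (hf : G.face (e, false) = G.face (e', false)) : e = e' :=
  congrArg Subtype.val (@hG.unique_angles.2.1 ⟨e, h⟩ ⟨e', h'⟩ hf)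

theorem turn_unique {e e' : E} (h : (G.rot (e, false)).2 = true)
    (h' : (G.rot (e', false)).2 = true) (hf : G.head e = G.head e') : e = e' :=
  congrArg Subtype.val (@hG.unique_angles.2.2 ⟨e, h⟩ ⟨e', h'⟩ hf)

end

end IsPlanarST

end EmbeddedDigraph

/-! ### Potentials and the acyclicity of augmented graphs -/

namespace EmbeddedDigraph

variable {V E : Type*} {G : EmbeddedDigraph V E}

/-- The difference of a function on the vertices along the edges. -/
def vertexDiff (G : EmbeddedDigraph V E) : (V → ℚ) →ₗ[ℚ] (E → ℚ) where
  toFun φ e := φ (G.head e) - φ (G.tail e)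
  map_add' _ _ := funext fun _ => by simp only [Pi.add_apply]; ring
  map_smul' _ _ := funext fun _ => by simp only [Pi.smul_apply, smul_eq_mul, RingHom.id_apply]; ring

/-- The difference of a function on the faces across the edges, from right to left. -/
def faceDiff (G : EmbeddedDigraph V E) : (G.Face → ℚ) →ₗ[ℚ] (E → ℚ) where
  toFun w e := w (G.face (e, false)) - w (G.face (e, true))
  map_add' _ _ := funext fun _ => by simp only [Pi.add_apply]; ring
  map_smul' _ _ := funext fun _ => by simp only [Pi.smul_apply, smul_eq_mul, RingHom.id_apply]; ring

namespace IsPlanarST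

variable [Fintype V] [Fintype E]

section
variable (hG : G.IsPlanarST)
include hG

/-- Written over darts, the sum is a difference of two sums of `φ * w` over all corners, since a
corner lies to the right of its first dart and to the left of its second. -/
theorem sum_faceDiff_mul_vertexDiff (φ : V → ℚ) (w : G.Face → ℚ) :
    ∑ e, G.faceDiff w e * G.vertexDiff φ e = 0 := by
  have h₁ : ∑ e, G.faceDiff w e * G.vertexDiff φ e =
      ∑ d : E × Bool, φ (G.origin d) * w (G.face d) -
        ∑ d : E × Bool, φ (G.origin d) * w (G.face (twin d)) := by
    rw [← Finset.sum_sub_distrib, Fintype.sum_prod_type]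
    refine Finset.sum_congr rfl fun e _ => ?_
    simp only [faceDiff, vertexDiff, LinearMap.coe_mk, AddHom.coe_mk, Fintype.sum_bool,
      origin_true, origin_false, twin_apply, Bool.not_true, Bool.not_false]
    ring
  rw [h₁, sub_eq_zero, ← Equiv.sum_comp G.rot fun d => φ (G.origin d) * w (G.face (twin d))]
  refine Finset.sum_congr rfl fun d _ => ?_
  rw [hG.origin_rot, face_of_rot (d := d) (e := (G.rot d).1) (b := !(G.rot d).2) (by simp)]
  rfl

theorem eq_source_of_vertexDiff {φ : V → ℚ} (h : G.vertexDiff φ = 0) (v : V) : φ v = φ G.s := by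
  induction hG.reach_of_source v with
  | refl => rfl
  | tail _ h' ih =>
    obtain ⟨e, rfl, rfl⟩ := h'
    rw [← ih]
    exact sub_eq_zero.1 (congrFun h e)

/-- `w` agrees on the two sides of each edge, hence on all faces around a vertex; this spreads from
the source along paths. -/
theorem eq_outer_of_faceDiff {w : G.Face → ℚ} (h : G.faceDiff w = 0) (f : G.Face) :
    w f = w (G.face (G.outer, true)) := by
  have htwin : ∀ d, w (G.face (twin d)) = w (G.face d) := by
    rintro ⟨e, _ | _⟩
    · exact (sub_eq_zero.1 (congrFun h e)).symm
    · exact sub_eq_zero.1 (congrFun h e)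
  have hrot : ∀ d, w (G.face (G.rot d)) = w (G.face d) := by
    intro d
    rw [face_of_rot (d := d) (e := (G.rot d).1) (b := !(G.rot d).2) (by simp)]
    exact (htwin _).symm
  have hsame : ∀ d d', G.origin d = G.origin d' → w (G.face d) = w (G.face d') := by
    intro d d' hd
    obtain ⟨k, rfl⟩ := ((hG.rotation d d').2 hd).exists_nat_pow_eq
    clear hd
    induction k with
    | zero => simp
    | succ k ih => rw [pow_succ', Equiv.Perm.mul_apply, hrot, ih]
  suffices H : ∀ v d, G.origin d = v → w (G.face d) = w (G.face (G.outer, true)) by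
    obtain ⟨d, rfl⟩ := exists_face_eq f
    exact H _ d rfl
  intro v
  induction hG.reach_of_source v with
  | refl => exact fun d hd => hsame _ _ (hd.trans hG.outer_source.symm)
  | tail _ h' ih =>
    obtain ⟨e, rfl, rfl⟩ := h'
    intro d hd
    rw [hsame d (e, false) hd, ← ih (e, true) rfl]
    exact htwin (e, true)

/-- On the sphere every circulation comes from a potential of the faces. -/
theorem exists_face_potential (c : E → ℚ) (hc : ∀ φ, ∑ e, c e * G.vertexDiff φ e = 0) :
    ∃ w, G.faceDiff w = c :=
  exists_preimage_of_orthogonal G.vertexDiff G.faceDiff hG.sum_faceDiff_mul_vertexDiff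
    (fun _ h x y => (hG.eq_source_of_vertexDiff h x).trans (hG.eq_source_of_vertexDiff h y).symm)
    (fun _ h x y => (hG.eq_outer_of_faceDiff h x).trans (hG.eq_outer_of_faceDiff h y).symm)
    hG.card_face.ge c hc

/-- On the sphere every circulation of the dual graph comes from a potential of the vertices. -/
theorem exists_vertex_potential (c : E → ℚ) (hc : ∀ w, ∑ e, c e * G.faceDiff w e = 0) :
    ∃ p, G.vertexDiff p = c :=
  exists_preimage_of_orthogonal G.faceDiff G.vertexDiff
    (fun w φ => by simpa only [mul_comm] using hG.sum_faceDiff_mul_vertexDiff φ w)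
    (fun _ h x y => (hG.eq_outer_of_faceDiff h x).trans (hG.eq_outer_of_faceDiff h y).symm)
    (fun _ h x y => (hG.eq_source_of_vertexDiff h x).trans (hG.eq_source_of_vertexDiff h y).symm)
    (by have := hG.card_face; omega) c hc

/-- Every cycle of the dual graph passes through the outer face. -/
theorem dual_acyclic (b : Bool) (f : G.Face) :
    ¬ Relation.TransGen (fun f g => ∃ e ∈ {e | G.face (e, true) ≠ G.face (G.outer, true) ∧
      G.face (e, false) ≠ G.face (G.outer, true)},
      G.face (e, b) = f ∧ G.face (e, !b) = g) f f := by
  intro h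
  obtain ⟨c, hc₀, hcS, ⟨e₀, he₀⟩, hc⟩ := exists_flow _ _ _ h
  -- A circulation of the dual graph is the difference of a vertex potential `p`, which does not
  -- decrease along edges because the flow is nonnegative.
  obtain ⟨p, hp⟩ := hG.exists_vertex_potential c fun w => by
    have h := hc w
    rw [sub_self] at h
    cases b
    · rw [← neg_eq_zero, ← h, ← Finset.sum_neg_distrib]
      refine Finset.sum_congr rfl fun e _ => ?_
      simp only [faceDiff, LinearMap.coe_mk, AddHom.coe_mk, Bool.not_false]
      ring
    · exact h
  have hp' : ∀ e, p (G.head e) - p (G.tail e) = c e := congrFun hp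
  have hmono : ∀ u v, Relation.ReflTransGen G.Adj u v → p u ≤ p v := by
    intro u v huv
    induction huv with
    | refl => exact le_rfl
    | tail _ h' ih =>
      obtain ⟨e, rfl, rfl⟩ := h'
      linarith [hp' e, hc₀ e]
  -- Edges on the outer boundary carry no flow, so `p` is constant there. Both `s` and `t` lie on
  -- it, although `p` must increase along a path from `s` to `t` through an edge with positive flow.
  have houter : ∀ k : ℕ, p (G.origin ((G.faceNext ^ k) (G.outer, true))) = p G.s := by
    intro k
    induction k with
    | zero => exact congrArg p hG.outer_source
    | succ k ih =>
      rw [pow_succ', Equiv.Perm.mul_apply, hG.origin_faceNext, ← ih]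
      have hk : G.face ((G.faceNext ^ k) (G.outer, true)) = G.face (G.outer, true) :=
        face_eq_iff.2 (Equiv.Perm.SameCycle.symm ⟨k, by simp⟩)
      generalize (G.faceNext ^ k) (G.outer, true) = d at hk
      obtain ⟨e, b'⟩ := d
      have he : c e = 0 := hcS e fun he => by
        cases b'
        · exact he.2 hk
        · exact he.1 hk
      have := hp' e
      cases b' <;> simp only [twin_apply, Bool.not_true, Bool.not_false, origin_true,
        origin_false] <;> linarith
  have hst : p G.t = p G.s := by
    obtain ⟨e, he, hcyc⟩ := hG.outer_sink
    obtain ⟨k, hk⟩ := hcyc.exists_nat_pow_eq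
    rw [← houter k, hk, origin_false, he]
  have h₁ := hmono _ _ (hG.reach_of_source (G.tail e₀))
  have h₂ := hmono _ _ (hG.reach_sink (G.head e₀))
  linarith [hp' e₀]

/-- A nonempty set of faces in which each inner face has a neighbour across an edge, always from the
right to the left or always from the left to the right, contains the outer face. -/
theorem outer_mem_of_closed (b : Bool) (M : Set G.Face) (hM : M.Nonempty)
    (h : ∀ f ∈ M, ∃ e, G.face (e, b) = f ∧ G.face (e, !b) ∈ M) :
    G.face (G.outer, true) ∈ M := by
  by_contra hout
  let r : G.Face → G.Face → Prop := fun f g => ∃ e ∈ {e | G.face (e, true) ≠ G.face (G.outer, true) ∧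
      G.face (e, false) ≠ G.face (G.outer, true)}, G.face (e, b) = f ∧ G.face (e, !b) = g
  -- By `dual_acyclic` the relation `r` on the finitely many faces is well-founded upwards, so `M`
  -- would contain a face without a successor in `M`.
  have : Std.Irrefl (Function.swap (Relation.TransGen r)) := ⟨hG.dual_acyclic b⟩
  have : IsTrans G.Face (Function.swap (Relation.TransGen r)) := ⟨fun _ _ _ h h' => h'.trans h⟩
  obtain ⟨f, hf, hmin⟩ :=
    (Finite.wellFounded_of_trans_of_irrefl (Function.swap (Relation.TransGen r))).has_min M hM
  obtain ⟨e, rfl, he'⟩ := h f hf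
  refine hmin _ he' (.single ⟨e, ?_, rfl, rfl⟩)
  have h₁ : G.face (e, b) ≠ G.face (G.outer, true) := fun h => hout (h ▸ hf)
  have h₂ : G.face (e, !b) ≠ G.face (G.outer, true) := fun h => hout (h ▸ he')
  cases b
  · exact ⟨h₂, h₁⟩
  · exact ⟨h₁, h₂⟩

/-- Edges between consecutive successors of a vertex can be added, in given directions, without
creating directed cycles, unless a new edge leaves the sink of the face in which it is drawn. -/
theorem augmented_acyclic (N : Set E) (up : E → Prop) (nxt : E → E)
    (hN : ∀ e ∈ N, e ≠ G.outer ∧ G.rot (e, true) = (nxt e, true))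
    (hup : ∀ e ∈ N, up e → (G.rot⁻¹ (e, false)).2 = true)
    (hdown : ∀ e ∈ N, ¬ up e → (G.rot (nxt e, false)).2 = true) (v : V) :
    ¬ Relation.TransGen (fun x y => G.Adj x y ∨ ∃ e ∈ N, up e ∧ G.head e = x ∧ G.head (nxt e) = y ∨
      ¬ up e ∧ G.head (nxt e) = x ∧ G.head e = y) v v := by
  classical
  intro hcyc
  -- a flow along the cycle
  obtain ⟨c, hc₀, hcS, ⟨a₀, ha₀⟩, hc⟩ := exists_flow (A := E ⊕ E) (X := V)
    {a | a.elim (fun _ => True) (· ∈ N)}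
    (Sum.elim G.tail fun e => if up e then G.head e else G.head (nxt e))
    (Sum.elim G.head fun e => if up e then G.head (nxt e) else G.head e)
    (x := v) (y := v) (by
      refine hcyc.lift id ?_
      rintro x y (⟨e, rfl, rfl⟩ | ⟨e, he, ⟨hu, rfl, rfl⟩ | ⟨hu, rfl, rfl⟩⟩)
      · exact ⟨.inl e, trivial, rfl, rfl⟩
      · exact ⟨.inr e, he, by simp [hu], by simp [hu]⟩
      · exact ⟨.inr e, he, by simp [hu], by simp [hu]⟩)
  -- The signed flow from the head of `e` to the head of `nxt e` on the new edge between them.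
  let y : E → ℚ := fun e => if up e then c (.inr e) else - c (.inr e)
  have hyN : ∀ e ∉ N, y e = 0 := fun e he => by simp [y, hcS (.inr e) he]
  have hy_pos : ∀ e, 0 < y e → e ∈ N ∧ up e := by
    intro e he
    refine ⟨by_contra fun h => he.ne' (hyN e h), by_contra fun h => ?_⟩
    simp only [y, if_neg h] at he
    linarith [hc₀ (.inr e)]
  have hy_neg : ∀ e, y e < 0 → e ∈ N ∧ ¬ up e := by
    intro e he
    refine ⟨by_contra fun h => he.ne (hyN e h), fun h => ?_⟩
    simp only [y, if_pos h] at he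
    linarith [hc₀ (.inr e)]
  -- The value of `y` at the edge just before `e` in clockwise order. The flow on a new edge is
  -- rerouted back along `e` and then forward along `nxt e`, so `e` loses `y e` and gains `yp e`.
  let yp : E → ℚ := fun e => if (G.rot⁻¹ (e, true)).2 then y (G.rot⁻¹ (e, true)).1 else 0
  -- the flow moved to the edges of the graph
  obtain ⟨w, hw⟩ := hG.exists_face_potential (fun e => c (.inl e) + yp e - y e) fun φ => by
    have h₁ := hc φ
    rw [sub_self, Fintype.sum_sum_type] at h₁
    have h₂ : ∑ e, yp e * G.vertexDiff φ e = ∑ e, y e * G.vertexDiff φ (nxt e) := by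
      let Y : E × Bool → ℚ := fun d => if d.2 then y d.1 else 0
      let H : E × Bool → ℚ := fun d => if d.2 then G.vertexDiff φ d.1 else 0
      have h := Equiv.sum_comp G.rot fun d => Y (G.rot⁻¹ d) * H d
      simp only [rot_inv_rot, Fintype.sum_prod_type, Fintype.sum_bool] at h
      simp only [Y, H, if_true, Bool.false_eq_true, if_false, mul_zero, zero_mul, add_zero] at h
      refine h.symm.trans (Finset.sum_congr rfl fun e _ => ?_)
      by_cases he : e ∈ N
      · simp [(hN e he).2]
      · simp [hyN e he]
    have h₃ : ∀ e, y e * G.vertexDiff φ (nxt e) - y e * G.vertexDiff φ e =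
        c (.inr e) * (φ (if up e then G.head (nxt e) else G.head e) -
          φ (if up e then G.head e else G.head (nxt e))) := by
      intro e
      by_cases he : e ∈ N
      · have ht : G.tail (nxt e) = G.tail e := by
          simpa [(hN e he).2] using hG.origin_rot (e, true)
        simp only [vertexDiff, LinearMap.coe_mk, AddHom.coe_mk, ht, y]
        split_ifs <;> ring
      · rw [hyN e he, hcS (.inr e) he]
        ring
    simp only [add_mul, sub_mul, Finset.sum_add_distrib, Finset.sum_sub_distrib, h₂]
    rw [add_sub_assoc, ← Finset.sum_sub_distrib, Finset.sum_congr rfl fun e _ => h₃ e]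
    exact h₁
  -- A new edge cuts its face into a part at the source of the face, with potential `w - y`, and the
  -- rest, with potential `w`. In these terms no potential drops when an edge is crossed from right
  -- to left.
  have hw' : ∀ e, w (G.face (e, true)) - y e ≤ w (G.face (e, false)) - yp e := by
    intro e
    have h : w (G.face (e, false)) - w (G.face (e, true)) = c (.inl e) + yp e - y e := congrFun hw e
    linarith [hc₀ (.inl e)]
  choose src hsrc hface using hG.exists_source_angle
  have hsrc_eq : ∀ e, (G.rot (e, true)).2 = true → src (G.face (e, true)) = e := fun e he =>
    hG.source_angle_unique (hsrc _) he (hface _)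
  have hy_eq : ∀ e, y e = 0 ∨ y e = y (src (G.face (e, true))) := by
    intro e
    by_cases he : e ∈ N
    · rw [hsrc_eq e (by rw [(hN e he).2])]
      exact Or.inr rfl
    · exact Or.inl (hyN e he)
  have hyp_eq : ∀ e e₀, G.rot (e₀, true) = (e, true) →
      yp e = y e₀ ∧ src (G.face (e, false)) = e₀ := by
    intro e e₀ h
    have h' : G.rot⁻¹ (e, true) = (e₀, true) := by rw [← h, rot_inv_rot]
    refine ⟨by simp only [yp, h', if_true], ?_⟩
    rw [← face_of_rot (e := e) (b := false) h, hsrc_eq e₀ (by rw [h])]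
  have hyp_eq' : ∀ e, yp e = 0 ∨ yp e = y (src (G.face (e, false))) := by
    intro e
    obtain ⟨⟨e₀, b⟩, h⟩ : ∃ x, x = G.rot⁻¹ (e, true) := ⟨_, rfl⟩
    cases b
    · exact Or.inl (by simp only [yp, ← h]; rfl)
    · have := hyp_eq e e₀ (by rw [h]; simp)
      rw [this.1, this.2]
      exact Or.inr rfl
  -- The larger and the smaller potential of the two parts of a face.
  let hi : G.Face → ℚ := fun f => max (w f) (w f - y (src f))
  let lo : G.Face → ℚ := fun f => min (w f) (w f - y (src f))
  have hhi : ∀ f z, z = 0 ∨ z = y (src f) → w f - z ≤ hi f := by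
    rintro f z (rfl | rfl)
    · simp [hi]
    · exact le_max_right _ _
  have hlo : ∀ f z, z = 0 ∨ z = y (src f) → lo f ≤ w f - z := by
    rintro f z (rfl | rfl)
    · simp [lo]
    · exact min_le_right _ _
  -- The source angle of the outer face is the one after `G.outer`, which is not in `N`, so this
  -- face is not cut.
  have hout : hi (G.face (G.outer, true)) = lo (G.face (G.outer, true)) := by
    have : src (G.face (G.outer, true)) = G.outer := hsrc_eq _
      (hG.snd_of_origin_eq_source ((hG.origin_rot _).trans hG.outer_source))
    have hy : y G.outer = 0 := hyN _ fun h => (hN _ h).1 rfl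
    simp [hi, lo, this, hy]
  have hmax : ∀ g, hi g ≤ hi (G.face (G.outer, true)) := by
    refine hG.outer_mem_of_closed true {f | ∀ g, hi g ≤ hi f}
      (Set.nonempty_def.2 (by
        have : Nonempty G.Face := ⟨G.face (G.outer, true)⟩
        exact Finite.exists_max hi)) fun f hf => ?_
    suffices h : ∃ e, G.face (e, true) = f ∧ hi f ≤ w (G.face (e, true)) - y e by
      obtain ⟨e, he, h⟩ := h
      exact ⟨e, he, fun g => (hf g).trans ((h.trans (hw' e)).trans (hhi _ _ (hyp_eq' e)))⟩
    -- If the part at the source has the maximal potential, the edge `src f` leads out of it to the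
    -- left. Otherwise the new edge leaves the head of `src f`, and by `hup` the boundary continues
    -- from there along an edge with the rest of the face on its right.
    rcases le_or_gt (y (src f)) 0 with hy | hy
    · refine ⟨src f, hface f, ?_⟩
      rw [hface]
      exact max_le (by linarith) le_rfl
    · obtain ⟨hsN, hsup⟩ := hy_pos _ hy
      obtain ⟨⟨e, b⟩, he⟩ : ∃ x, x = G.rot⁻¹ (src f, false) := ⟨_, rfl⟩
      have hb := hup _ hsN hsup
      rw [← he] at hb
      obtain rfl : b = true := hb
      have hrot : G.rot (e, true) = (src f, false) := by rw [he]; simp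
      refine ⟨e, (face_of_rot hrot).trans (hface f), ?_⟩
      rw [hyN e fun h => by simp [(hN e h).2] at hrot, face_of_rot (b := true) hrot, hface]
      exact max_le (by linarith) (by linarith)
  have hmin : ∀ g, lo (G.face (G.outer, true)) ≤ lo g := by
    refine hG.outer_mem_of_closed false {f | ∀ g, lo f ≤ lo g}
      (Set.nonempty_def.2 (by
        have : Nonempty G.Face := ⟨G.face (G.outer, true)⟩
        exact Finite.exists_min lo)) fun f hf => ?_
    suffices h : ∃ e, G.face (e, false) = f ∧ w (G.face (e, false)) - yp e ≤ lo f by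
      obtain ⟨e, he, h⟩ := h
      exact ⟨e, he, fun g => ((((hlo _ _ (hy_eq e)).trans (hw' e)).trans h).trans (hf g))⟩
    obtain ⟨⟨e', b⟩, he'⟩ : ∃ x, x = G.rot (src f, true) := ⟨_, rfl⟩
    have hb := hsrc f
    rw [← he'] at hb
    obtain rfl : b = true := hb
    have hf' : G.face (e', false) = f := (face_of_rot he'.symm).symm.trans (hface f)
    -- The mirror image: the two edges now have `f` on their left and are crossed from left to
    -- right.
    rcases le_or_gt 0 (y (src f)) with hy | hy
    · refine ⟨e', hf', ?_⟩
      rw [hf', (hyp_eq e' _ he'.symm).1]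
      exact le_min (by linarith) le_rfl
    · obtain ⟨hsN, hsup⟩ := hy_neg _ hy
      obtain ⟨⟨z, b⟩, hz⟩ : ∃ x, x = G.rot (nxt (src f), false) := ⟨_, rfl⟩
      have hb := hdown _ hsN hsup
      rw [← hz] at hb
      obtain rfl : b = true := hb
      have hn : nxt (src f) = e' := by
        have := (hN _ hsN).2
        rw [← he'] at this
        simpa using this.symm
      rw [hn] at hz
      have hzf : G.face (z, false) = f := (face_of_rot hz.symm).symm.trans hf'
      have hypz : yp z = 0 := by simp [yp, hz]
      refine ⟨z, hzf, ?_⟩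
      rw [hzf, hypz]
      exact le_min (by linarith) (by linarith)
  -- Maximum and minimum are both attained at the outer face, where they agree. All parts thus have
  -- the same potential, and no edge, old or new, carries flow.
  have hconst : ∀ f z, z = 0 ∨ z = y (src f) → w f - z = hi (G.face (G.outer, true)) := fun f z hz =>
    le_antisymm ((hhi f z hz).trans (hmax f)) (hout ▸ (hmin f).trans (hlo f z hz))
  have hysrc : ∀ f, y (src f) = 0 := fun f => by
    linarith [hconst f 0 (Or.inl rfl), hconst f _ (Or.inr rfl)]
  have hy : ∀ e, y e = 0 := fun e => (hy_eq e).elim id fun h => h.trans (hysrc _)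
  rcases a₀ with e | e
  · have h : w (G.face (e, false)) - w (G.face (e, true)) = c (.inl e) + yp e - y e := congrFun hw e
    have h₁ := hconst _ _ (hyp_eq' e)
    have h₂ := hconst _ _ (hy_eq e)
    linarith
  · have := hy e
    simp only [y] at this
    split_ifs at this <;> linarith

end

end IsPlanarST

end EmbeddedDigraph

/-! ### Successor lists -/

namespace Function

theorem exists_lt_minimalPeriod_of_iterate {α : Type*} {f : α → α} {x : α}
    (hx : x ∈ periodicPts f) (k : ℕ) : ∃ i < minimalPeriod f x, f^[i] x = f^[k] x :=
  ⟨k % minimalPeriod f x, Nat.mod_lt _ (minimalPeriod_pos_of_mem_periodicPts hx),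
    iterate_mod_minimalPeriod_eq⟩

end Function

namespace List

theorem eq_of_isChain {α : Type*} {R : α → α → Prop} (hR : ∀ a b b', R a b → R a b' → b = b') :
    ∀ {l l' : List α}, l.IsChain R → l'.IsChain R → l.length = l'.length → l.head? = l'.head? →
      l = l'
  | [], [], _, _, _, _ => rfl
  | a :: l, a' :: l', h, h', hl, hh => by
    obtain rfl : a = a' := by simpa using hh
    rw [isChain_cons] at h h'
    have hl' : l.length = l'.length := by simpa using hl
    rw [eq_of_isChain hR h.2 h'.2 hl']
    rcases l with _ | ⟨b, l⟩ <;> rcases l' with _ | ⟨b', l'⟩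
    · rfl
    · simp at hl'
    · simp at hl'
    · simp only [head?_cons, Option.some.injEq]
      exact hR a b b' (h.1 b rfl) (h'.1 b' rfl)

theorem isChain_iterate {α : Type*} (f : α → α) (a : α) (n : ℕ) :
    (iterate f a n).IsChain fun x y => f x = y := by
  induction n generalizing a with
  | zero => simp
  | succ n ih =>
    rw [iterate, isChain_cons]
    refine ⟨fun y hy => ?_, ih _⟩
    cases n <;> simp_all

end List

namespace EmbeddedDigraph

variable {V E : Type*} {G : EmbeddedDigraph V E}

/-- The characteristic properties of the successor list of `u`. -/
structure IsSuccList (G : EmbeddedDigraph V E) (u : V) (l : List E) : Prop where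
  nodup : l.Nodup
  mem_iff : ∀ e, e ∈ l ↔ G.tail e = u
  chain : l.IsChain fun e e' => G.rot (e, true) = (e', true)
  first : ∀ e ∈ l.head?, (G.rot⁻¹ (e, true)).2 = false ∨ G.rot⁻¹ (e, true) = (G.outer, true)

/-- The outgoing edge of a dart. -/
def outEdge (d : E × Bool) : Option E := if d.2 then some d.1 else none

@[simp] theorem outEdge_true (e : E) : outEdge (e, true) = some e := rfl

@[simp] theorem outEdge_false (e : E) : outEdge (e, false) = none := rfl

theorem filterMap_outEdge_of_head_false : ∀ {l : List (E × Bool)},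
    l.IsChain (fun d d' => ¬ (d.2 = false ∧ d'.2 = true)) → (∀ d ∈ l.head?, d.2 = false) →
    l.filterMap outEdge = []
  | [], _, _ => rfl
  | (e, b) :: l, h, hh => by
    obtain rfl : b = false := by simpa using hh
    rw [List.isChain_cons] at h
    rw [List.filterMap_cons_none (by rfl)]
    exact filterMap_outEdge_of_head_false h.2 fun d hd => by simpa using h.1 d hd

theorem isChain_filterMap_outEdge : ∀ {l : List (E × Bool)},
    l.IsChain (fun d d' => G.rot d = d' ∧ ¬ (d.2 = false ∧ d'.2 = true)) →
    (l.filterMap outEdge).IsChain fun e e' => G.rot (e, true) = (e', true)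
  | [], _ => by simp
  | (e, false) :: l, h => by
    rw [List.isChain_cons] at h
    rw [List.filterMap_cons_none (by rfl)]
    exact isChain_filterMap_outEdge h.2
  | (e, true) :: l, h => by
    rw [List.isChain_cons] at h
    rw [List.filterMap_cons_some (by rfl), List.isChain_cons]
    refine ⟨fun e' he' => ?_, isChain_filterMap_outEdge h.2⟩
    rcases l with _ | ⟨⟨x, _ | _⟩, l⟩
    · simp at he'
    · rw [filterMap_outEdge_of_head_false (h.2.imp fun _ _ h => h.2) (by simp)] at he'
      simp at he'
    · obtain rfl : x = e' := by simpa using he'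
      exact (h.1 _ rfl).1

/-- Once the only change from incoming to outgoing darts has been passed, it cannot recur in a list
without repetitions, so the outgoing darts form one block. -/
theorem isChain_filterMap_outEdge_of_unique_turn {l : List (E × Bool)}
    (h : l.IsChain (fun d d' => G.rot d = d')) (hn : l.Nodup) (hh : ∀ d ∈ l.head?, d.2 = false)
    (hu : ∀ d ∈ l, ∀ d' ∈ l, d.2 = false → (G.rot d).2 = true → d'.2 = false →
      (G.rot d').2 = true → d = d') :
    ((l.filterMap outEdge).IsChain fun e e' => G.rot (e, true) = (e', true)) ∧
      ∀ e ∈ (l.filterMap outEdge).head?, (G.rot⁻¹ (e, true)).2 = false := by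
  induction l with
  | nil => simp
  | cons d l ih =>
    obtain ⟨e, b⟩ := d
    obtain rfl : b = false := by simpa using hh
    rw [List.isChain_cons] at h
    rw [List.nodup_cons] at hn
    rw [List.filterMap_cons_none (by rfl)]
    rcases l with _ | ⟨⟨x, _ | _⟩, l⟩
    · simp
    · exact ih h.2 hn.2 (by simp) fun d hd d' hd' =>
        hu d (List.mem_cons_of_mem _ hd) d' (List.mem_cons_of_mem _ hd')
    · have hx : G.rot (e, false) = (x, true) := h.1 _ rfl
      refine ⟨isChain_filterMap_outEdge (h.2.imp_of_mem_imp fun d d' hd hd' hdd' =>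
        ⟨hdd', fun ht => ?_⟩), fun e' he' => ?_⟩
      · subst hdd'
        have := hu (e, false) (by simp) d (List.mem_cons_of_mem _ hd) rfl (by rw [hx]) ht.1 ht.2
        exact hn.1 (this ▸ hd)
      · obtain rfl : x = e' := by simpa using he'
        rw [← hx, rot_inv_rot]

namespace IsPlanarST

variable [Fintype V] [Fintype E]

section
variable (hG : G.IsPlanarST)
include hG

theorem origin_startDart (u : V) : G.origin (G.startDart u) = u := by
  unfold startDart
  split_ifs with h
  · exact h.choose_spec
  · push Not at h
    rw [hG.origin_rot, (hG.source u).1 h]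
    exact hG.outer_source

/-- The degree of `u` is the length of the cycle of `G.rot` through the start dart. -/
theorem darts_nodup_mem (u : V) :
    (List.iterate G.rot (G.startDart u) (G.degree u)).Nodup ∧
      ∀ d, d ∈ List.iterate G.rot (G.startDart u) (G.degree u) ↔ G.origin d = u := by
  classical
  set d₀ := G.startDart u with hd₀
  have hmem : d₀ ∈ Function.periodicPts G.rot :=
    G.rot.injective.mem_periodicPts d₀
  have hor : ∀ d, G.origin d = u ↔ ∃ k : ℕ, G.rot^[k] d₀ = d := by
    intro d
    rw [← hG.origin_startDart u, eq_comm, ← hG.rotation]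
    constructor
    · intro h
      obtain ⟨k, hk⟩ := h.exists_nat_pow_eq
      exact ⟨k, by rw [← hk, Equiv.Perm.iterate_eq_pow]⟩
    · rintro ⟨k, rfl⟩
      exact ⟨k, by rw [Equiv.Perm.iterate_eq_pow, zpow_natCast]⟩
  have hdeg : G.degree u = Function.minimalPeriod G.rot d₀ := by
    rw [degree, ← Finset.card_range (Function.minimalPeriod G.rot d₀),
      ← Finset.card_image_of_injOn (s := Finset.range _) (f := fun k => G.rot^[k] d₀)]
    · congr 1
      ext d
      simp only [Finset.mem_filter, Finset.mem_univ, true_and, hor, Finset.mem_image,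
        Finset.mem_range]
      constructor
      · rintro ⟨k, rfl⟩
        exact Function.exists_lt_minimalPeriod_of_iterate hmem k
      · rintro ⟨k, _, rfl⟩
        exact ⟨k, rfl⟩
    · intro i hi j hj
      exact Function.iterate_injOn_Iio_minimalPeriod (by simpa using hi) (by simpa using hj)
  constructor
  · rw [List.nodup_iff_injective_getElem]
    intro i j hij
    simp only [List.getElem_iterate] at hij
    refine Fin.ext (Function.iterate_injOn_Iio_minimalPeriod (f := G.rot) (x := d₀) ?_ ?_ hij)
    · simpa [hdeg] using i.2
    · simpa [hdeg] using j.2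
  · intro d
    rw [List.mem_iterate, hdeg, hor]
    constructor
    · rintro ⟨k, _, rfl⟩
      exact ⟨k, rfl⟩
    · rintro ⟨k, rfl⟩
      obtain ⟨i, hi, h⟩ := Function.exists_lt_minimalPeriod_of_iterate hmem k
      exact ⟨i, hi, h.symm⟩

theorem isSuccList_succList (u : V) : G.IsSuccList u (G.succList u) := by
  obtain ⟨hn, hm⟩ := hG.darts_nodup_mem u
  have hl : G.succList u =
    (List.iterate G.rot (G.startDart u) (G.degree u)).filterMap outEdge := rfl
  have hch := List.isChain_iterate G.rot (G.startDart u) (G.degree u)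
  have hhead : ∀ d ∈ (List.iterate G.rot (G.startDart u) (G.degree u)).head?,
      d = G.startDart u := by
    cases G.degree u <;> simp
  rw [hl]
  generalize List.iterate G.rot (G.startDart u) (G.degree u) = l at *
  have key : (l.filterMap outEdge).IsChain (fun e e' => G.rot (e, true) = (e', true)) ∧
      ∀ e ∈ (l.filterMap outEdge).head?, (G.rot⁻¹ (e, true)).2 = false ∨
        G.rot⁻¹ (e, true) = (G.outer, true) := by
    by_cases hu : ∃ e, G.head e = u
    · have h := isChain_filterMap_outEdge_of_unique_turn hch hn (fun d hd => by
        rw [hhead d hd, startDart, dif_pos hu]) (by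
        rintro ⟨e, b⟩ hd ⟨e', b'⟩ hd' rfl h₁ rfl h₂
        rw [hm] at hd hd'
        rw [hG.turn_unique h₁ h₂ (hd.trans hd'.symm)])
      exact ⟨h.1, fun e he => Or.inl (h.2 e he)⟩
    · have hs : G.startDart u = G.rot (G.outer, true) := by rw [startDart, dif_neg hu]
      push Not at hu
      have hu' := (hG.source u).1 hu
      have htrue : ∀ d ∈ l, d.2 = true := fun d hd =>
        hG.snd_of_origin_eq_source (((hm d).1 hd).trans hu')
      refine ⟨isChain_filterMap_outEdge (hch.imp_of_mem_imp fun d d' hd hd' h =>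
        ⟨h, fun h => by simp [htrue d hd] at h⟩), fun e he => Or.inr ?_⟩
      rcases l with _ | ⟨⟨x, b⟩, l⟩
      · simp at he
      · obtain rfl : b = true := htrue (x, b) (by simp)
        obtain rfl : x = e := by simpa using he
        rw [hhead (x, true) rfl, hs, rot_inv_rot]
  refine ⟨hn.filterMap ?_, fun e => ?_, key.1, key.2⟩
  · rintro ⟨e, _ | _⟩ ⟨e', _ | _⟩ x <;> simp +contextual
  · rw [List.mem_filterMap]
    constructor
    · rintro ⟨⟨e', _ | _⟩, hd, he⟩
      · simp at he
      · obtain rfl : e' = e := by simpa using he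
        exact (hm _).1 hd
    · intro he
      exact ⟨(e, true), (hm _).2 he, rfl⟩

theorem mem_succList {u : V} {e : E} : e ∈ G.succList u ↔ G.tail e = u :=
  (hG.isSuccList_succList u).mem_iff e

theorem rot_eq_outer_of_source {e : E} (h : G.tail e = G.s)
    (h' : (G.rot⁻¹ (e, true)).2 = false ∨ G.rot⁻¹ (e, true) = (G.outer, true)) :
    G.rot⁻¹ (e, true) = (G.outer, true) := by
  refine h'.resolve_left fun h₁ => ?_
  rw [hG.snd_of_origin_eq_source ((hG.origin_rot_inv (e, true)).trans h)] at h₁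
  cases h₁

/-- A chain is determined by its first edge and its length. The first edge follows the unique turn
at an inner vertex, and `G.outer` at the source. Lists of split graphs are identified in this way,
whatever start dart was chosen. -/
theorem isSuccList_unique {u : V} {l l' : List E} (h : G.IsSuccList u l) (h' : G.IsSuccList u l') :
    l = l' := by
  have hmem : ∀ e, e ∈ l ↔ e ∈ l' := fun e => by rw [h.mem_iff, h'.mem_iff]
  have hlen : l.length = l'.length :=
    ((List.perm_ext_iff_of_nodup h.nodup h'.nodup).2 hmem).length_eq
  refine List.eq_of_isChain (fun e x y hx hy => ?_) h.chain h'.chain hlen ?_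
  · rw [hx] at hy
    simpa using hy
  · rcases l with _ | ⟨e, l⟩ <;> rcases l' with _ | ⟨e', l'⟩
    · rfl
    · simp at hlen
    · simp at hlen
    have he := (h.mem_iff e).1 (by simp)
    have he' := (h'.mem_iff e').1 (by simp)
    have hf := h.first e rfl
    have hf' := h'.first e' rfl
    suffices H : G.rot⁻¹ (e, true) = G.rot⁻¹ (e', true) by
      have := G.rot⁻¹.injective H
      simpa using this
    by_cases hu : u = G.s
    · rw [hG.rot_eq_outer_of_source (he.trans hu) hf, hG.rot_eq_outer_of_source (he'.trans hu) hf']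
    · have aux : ∀ e, G.tail e = u → ((G.rot⁻¹ (e, true)).2 = false ∨
          G.rot⁻¹ (e, true) = (G.outer, true)) →
          ∃ x, G.rot⁻¹ (e, true) = (x, false) ∧ G.head x = u ∧ (G.rot (x, false)).2 = true := by
        intro e he hf
        have ho := hG.origin_rot_inv (e, true)
        have hr := G.rot_rot_inv (e, true)
        obtain ⟨⟨x, b⟩, hx⟩ : ∃ x, x = G.rot⁻¹ (e, true) := ⟨_, rfl⟩
        rw [← hx] at hf ho hr ⊢
        cases b
        · exact ⟨x, rfl, ho.trans he, by rw [hr]⟩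
        · refine absurd ?_ hu
          have : x = G.outer := by simpa using hf
          rw [← he, ← hG.outer_source, ← this]
          exact ho.symm
      obtain ⟨x, hx, hxu, hxt⟩ := aux e he hf
      obtain ⟨x', hx', hxu', hxt'⟩ := aux e' he' hf'
      rw [hx, hx', hG.turn_unique hxt hxt' (hxu.trans hxu'.symm)]

theorem length_succList_eq_zero {u : V} : (G.succList u).length = 0 ↔ u = G.t := by
  rw [List.length_eq_zero_iff, List.eq_nil_iff_forall_not_mem, ← hG.sink]
  simp only [hG.mem_succList]

theorem rot_succList {u : V} {i : ℕ} {e e' : E} (h : (G.succList u)[i]? = some e)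
    (h' : (G.succList u)[i + 1]? = some e') : G.rot (e, true) = (e', true) := by
  have hc := (hG.isSuccList_succList u).chain
  rw [List.isChain_iff_getElem] at hc
  rw [List.getElem?_eq_some_iff] at h h'
  obtain ⟨hi, rfl⟩ := h
  obtain ⟨hi', rfl⟩ := h'
  exact hc i hi'

theorem index_unique {u : V} {i j : ℕ} {e : E} (h : (G.succList u)[i]? = some e)
    (h' : (G.succList u)[j]? = some e) : i = j := by
  have hn := (hG.isSuccList_succList u).nodup
  rw [List.getElem?_eq_some_iff] at h h'
  obtain ⟨hi, rfl⟩ := h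
  obtain ⟨hi', h'⟩ := h'
  exact ((hn.getElem_inj_iff).1 h').symm

theorem tail_of_getElem? {u : V} {i : ℕ} {e : E} (h : (G.succList u)[i]? = some e) :
    G.tail e = u := hG.mem_succList.1 (List.mem_of_getElem? h)

/-- The edge after `G.outer` is the first in the list of the source, so `G.outer` is the last. -/
theorem ne_outer {u : V} {i : ℕ} {e e' : E} (h : (G.succList u)[i]? = some e)
    (h' : (G.succList u)[i + 1]? = some e') : e ≠ G.outer := by
  rintro rfl
  have hu : u = G.s := (hG.tail_of_getElem? h).symm.trans hG.outer_source
  have hlt := (List.getElem?_eq_some_iff.1 h').1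
  have h₀ : (G.succList u)[0]? = some (G.succList u)[0] := List.getElem?_eq_getElem (by omega)
  have h₁ := hG.rot_eq_outer_of_source ((hG.tail_of_getElem? h₀).trans hu)
    ((hG.isSuccList_succList u).first _ (by rw [List.head?_eq_getElem?, h₀]; rfl))
  have h₂ := hG.rot_succList h h'
  rw [← h₁, rot_rot_inv] at h₂
  have h₃ : (G.succList u)[0] = e' := by simpa using h₂
  rw [h₃] at h₀
  exact absurd (hG.index_unique h₀ h') (by omega)

theorem eq_last {u : V} {i : ℕ} {e : E} (h : (G.succList u)[i]? = some e)
    (h' : (G.succList u)[i + 1]? = none) : (G.rot (e, true)).2 = false ∨ e = G.outer := by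
  by_contra! hne
  obtain ⟨⟨e', b⟩, he'⟩ : ∃ x, x = G.rot (e, true) := ⟨_, rfl⟩
  rw [← he'] at hne
  obtain rfl : b = true := by simpa using hne.1
  have ho := hG.origin_rot (e, true)
  rw [← he'] at ho
  have hmem : e' ∈ G.succList u := hG.mem_succList.2 (ho.trans (hG.tail_of_getElem? h))
  obtain ⟨j, hj⟩ := List.mem_iff_getElem?.1 hmem
  have hr : G.rot⁻¹ (e', true) = (e, true) := by rw [he', rot_inv_rot]
  rcases j with _ | j
  · have := (hG.isSuccList_succList u).first e' (by rw [List.head?_eq_getElem?, hj]; rfl)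
    rw [hr] at this
    simp [hne.2] at this
  · have hlt := (List.getElem?_eq_some_iff.1 hj).1
    have hj' : (G.succList u)[j]? = some (G.succList u)[j] := List.getElem?_eq_getElem (by omega)
    have h₂ := hG.rot_succList hj' hj
    rw [he'] at h₂
    have h₃ : (G.succList u)[j] = e := by simpa using G.rot.injective h₂
    rw [h₃] at hj'
    rw [hG.index_unique h hj', hj] at h'
    cases h'

theorem tail_eq_of_rot {e e' : E} (h : G.rot (e, true) = (e', true)) : G.tail e' = G.tail e := by
  have := hG.origin_rot (e, true)
  rwa [h] at this

theorem reach_of_reflTransGen {e e' : E} (ht : G.tail e' = G.tail e) (hne : e ≠ e')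
    (h : Relation.ReflTransGen G.Adj (G.head e) (G.head e')) : G.Reach (G.head e) (G.head e') := by
  rcases Relation.reflTransGen_iff_eq_or_transGen.1 h with h | h
  · exact absurd (hG.tail_ne_head e e' ht.symm h.symm) hne
  · exact h

/-- There is a path from a successor to the next one if and only if the latter is the sink of the
face between them. -/
theorem reach_next_iff {e e' : E} (h : G.rot (e, true) = (e', true)) (ho : e ≠ G.outer)
    (hne : e ≠ e') : G.Reach (G.head e) (G.head e') ↔ (G.rot (e', false)).2 = false := by
  constructor
  · intro hr
    -- If the boundary continued beyond the head of `e'`, an edge from there to the head of `e`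
    -- could be added acyclically, but the given path would close it to a cycle.
    by_contra hs
    refine hG.augmented_acyclic {e} (fun _ => False) (fun _ => e') (by simp [h, ho]) (by simp)
      (by simpa using hs) (G.head e') (.head (Or.inr ⟨e, rfl, Or.inr ⟨not_false, rfl, rfl⟩⟩)
        (Relation.TransGen.mono (fun _ _ h => Or.inl h) _ _ hr))
  · intro hs
    refine hG.reach_of_reflTransGen (hG.tail_eq_of_rot h) hne ?_
    obtain ⟨⟨x, b⟩, hx⟩ : ∃ x, x = G.rot (e', false) := ⟨_, rfl⟩
    rw [← hx] at hs
    obtain rfl : b = false := hs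
    have hf : G.face (e', false) = G.face (x, true) := face_of_rot hx.symm
    have hf' : G.face (e, true) = G.face (e', false) := face_of_rot h
    -- The only sink of the face is at the head of `e'`, so the boundary walk from `e` uses forward
    -- darts until it arrives there.
    obtain ⟨k, hk, hp⟩ := (face_eq_iff.1 (hf'.trans hf)).exists_path_of_unique_transition
      (p := fun d => d.2 = true) rfl (by
        rintro ⟨c, b⟩ hc rfl hc'
        obtain ⟨⟨z, b⟩, hz⟩ : ∃ z, z = G.faceNext (c, true) := ⟨_, rfl⟩
        rw [← hz] at hc'
        obtain rfl : b = false := by simpa using hc'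
        have hz' := faceNext_eq_iff.1 hz.symm
        have := hG.sink_angle_unique (e := z) (e' := e') (by rw [hz']; rfl) (by rw [← hx])
          (by rw [hz, face_faceNext, ← hf', face_eq_iff.2 hc])
        rw [this, ← hx] at hz'
        simpa using hz'.symm)
    have key : ∀ i ≤ k, Relation.ReflTransGen G.Adj (G.head e)
        (G.head ((G.faceNext ^ i) (e, true)).1) := by
      intro i
      induction i with
      | zero => exact fun _ => .refl
      | succ i ih =>
        intro hi
        have h₁ := hp i (by omega)
        have h₂ := hp (i + 1) hi
        have h₃ := ih (by omega)
        rw [pow_succ', Equiv.Perm.mul_apply] at h₂ ⊢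
        generalize (G.faceNext ^ i) (e, true) = d at h₁ h₂ h₃
        obtain ⟨a, b⟩ := d
        obtain rfl : b = true := h₁
        have h₄ := hG.origin_faceNext (a, true)
        obtain ⟨⟨a', b⟩, ha'⟩ : ∃ z, z = G.faceNext (a, true) := ⟨_, rfl⟩
        rw [← ha'] at h₂ h₄ ⊢
        obtain rfl : b = true := h₂
        exact h₃.tail ⟨a', h₄, rfl⟩
    have := key k le_rfl
    rw [hk] at this
    have hh := hG.origin_rot (e', false)
    rw [← hx] at hh
    rw [← (show G.head x = G.head e' from hh)]
    exact this

/-- There is a path from a successor to the previous one if and only if the latter is the sink of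
the face between them. -/
theorem reach_prev_iff {e e' : E} (h : G.rot (e, true) = (e', true)) (ho : e ≠ G.outer)
    (hne : e ≠ e') : G.Reach (G.head e') (G.head e) ↔ (G.rot⁻¹ (e, false)).2 = false := by
  constructor
  · intro hr
    by_contra hs
    refine hG.augmented_acyclic {e} (fun _ => True) (fun _ => e') (by simp [h, ho])
      (by simpa using hs) (by simp) (G.head e) (.head (Or.inr ⟨e, rfl, Or.inl ⟨trivial, rfl, rfl⟩⟩)
        (Relation.TransGen.mono (fun _ _ h => Or.inl h) _ _ hr))
  · intro hs
    refine hG.reach_of_reflTransGen (hG.tail_eq_of_rot h).symm hne.symm ?_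
    obtain ⟨⟨x, b⟩, hx⟩ : ∃ x, x = G.rot⁻¹ (e, false) := ⟨_, rfl⟩
    have hh := hG.origin_rot_inv (e, false)
    rw [← hx] at hs hh
    obtain rfl : b = false := hs
    have hxr : G.rot (x, false) = (e, false) := by rw [hx, rot_rot_inv]
    have hf : G.face (x, false) = G.face (e, true) := face_of_rot hxr
    have hf' : G.face (e, true) = G.face (e', false) := face_of_rot h
    have hpow : ∀ i : ℕ, G.faceNext⁻¹.SameCycle (e', false) ((G.faceNext⁻¹ ^ i) (e', false)) :=
      fun i => ⟨i, by simp⟩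
    -- The other side of the boundary consists of backward darts, so it is followed with the inverse
    -- walk.
    obtain ⟨k, hk, hp⟩ := (Equiv.Perm.sameCycle_inv.2
      (face_eq_iff.1 (hf.trans hf').symm)).exists_path_of_unique_transition
      (p := fun d => d.2 = false) rfl (by
        rintro ⟨c, b⟩ hc rfl hc'
        obtain ⟨⟨z, b⟩, hz⟩ : ∃ z, z = G.faceNext⁻¹ (c, false) := ⟨_, rfl⟩
        rw [← hz] at hc'
        obtain rfl : b = true := by simpa using hc'
        have hz' : G.faceNext (z, true) = (c, false) := by rw [hz]; simp
        have hz'' := faceNext_eq_iff.1 hz'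
        rw [hG.sink_angle_unique (e := c) (e' := x) (by rw [hz'']; rfl) (by rw [hxr])
          (by rw [hf.trans hf']; exact (face_eq_iff.2 (Equiv.Perm.sameCycle_inv.1 hc)).symm)])
    have key : ∀ i ≤ k, Relation.ReflTransGen G.Adj (G.head e')
        (G.head ((G.faceNext⁻¹ ^ i) (e', false)).1) := by
      intro i
      induction i with
      | zero => exact fun _ => .refl
      | succ i ih =>
        intro hi
        have h₁ := hp i (by omega)
        have h₂ := hp (i + 1) hi
        have h₃ := ih (by omega)
        rw [pow_succ', Equiv.Perm.mul_apply] at h₂ ⊢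
        generalize (G.faceNext⁻¹ ^ i) (e', false) = d at h₁ h₂ h₃
        obtain ⟨a, b⟩ := d
        obtain rfl : b = false := h₁
        obtain ⟨⟨a', b⟩, ha'⟩ : ∃ z, z = G.faceNext⁻¹ (a, false) := ⟨_, rfl⟩
        rw [← ha'] at h₂ ⊢
        obtain rfl : b = false := h₂
        have h₄ : G.faceNext (a', false) = (a, false) := by rw [ha']; simp
        have h₅ := hG.origin_faceNext (a', false)
        rw [h₄] at h₅
        exact h₃.tail ⟨a', h₅.symm, rfl⟩
    have := key k le_rfl
    rw [hk] at this
    rw [← (show G.head x = G.head e from hh)]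
    exact this

end

end IsPlanarST

end EmbeddedDigraph

/-! ### Splitting edges -/

theorem Equiv.Perm.SameCycle.apply_eq_of_invariant {α β : Type*} [Finite α] {σ : Equiv.Perm α}
    {f : α → β} (hf : ∀ x, f (σ x) = f x) {x y : α} (h : σ.SameCycle x y) : f x = f y := by
  obtain ⟨k, rfl⟩ := h.exists_nat_pow_eq
  induction k with
  | zero => simp
  | succ k ih => rw [pow_succ', Equiv.Perm.mul_apply, hf, ← ih ⟨k, by simp⟩]

/-- By transitivity only neighbours need to be compared, and these are the pairs joined by the added
edges. -/
theorem isBitonic_iff {α : Type*} [Preorder α] {a : List α} :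
    IsBitonic a ↔ ∃ h : ℕ, ∀ i (hi : i + 1 < a.length),
      (i < h → a[i] < a[i + 1]) ∧ (h ≤ i → a[i + 1] < a[i]) := by
  refine exists_congr fun h => ?_
  rw [← List.isChain_iff_pairwise, ← List.isChain_iff_pairwise, List.isChain_iff_getElem,
    List.isChain_iff_getElem]
  constructor
  · rintro ⟨h₁, h₂⟩ i hi
    refine ⟨fun hih => ?_, fun hhi => ?_⟩
    · have := h₁ i (by rw [List.length_take]; omega)
      rwa [List.getElem_take, List.getElem_take] at this
    · obtain ⟨j, rfl⟩ := Nat.exists_eq_add_of_le hhi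
      have := h₂ j (by rw [List.length_drop]; omega)
      rw [List.getElem_drop, List.getElem_drop] at this
      exact this
  · intro H
    refine ⟨fun i hi => ?_, fun i hi => ?_⟩
    · rw [List.length_take] at hi
      simpa only [List.getElem_take] using (H i (by omega)).1 (by omega)
    · rw [List.length_drop] at hi
      simpa only [List.getElem_drop, ← add_assoc] using (H (h + i) (by omega)).2 (by omega)

namespace EmbeddedDigraph

variable {V E : Type*} {G : EmbeddedDigraph V E} {D : Finset E}

/-- The dart of the split graph that lies at the same old vertex as a given dart. -/
noncomputable def oldDart (D : Finset E) (d : E × Bool) : (E ⊕ D) × Bool := (splitDarts D).symm (.inl d)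

/-- The darts of the split graph at the dummy vertices. -/
noncomputable def newDart (D : Finset E) (d : D × Bool) : (E ⊕ D) × Bool := (splitDarts D).symm (.inr d)

theorem oldDart_true (e : E) : oldDart D (e, true) = (.inl e, true) := rfl

theorem oldDart_false_of_mem (e : D) : oldDart D (e.1, false) = (.inr e, false) := by
  simp [oldDart, splitDarts]

theorem oldDart_false_of_notMem {e : E} (h : e ∉ D) : oldDart D (e, false) = (.inl e, false) := by
  simp [oldDart, splitDarts, h]

theorem newDart_true (e : D) : newDart D (e, true) = (.inr e, true) := rfl

theorem newDart_false (e : D) : newDart D (e, false) = (.inl e.1, false) := rfl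

theorem oldDart_or_newDart (x : (E ⊕ D) × Bool) :
    (∃ d, x = oldDart D d) ∨ ∃ d, x = newDart D d := by
  rcases h : splitDarts D x with d | d
  · exact Or.inl ⟨d, by rw [oldDart, ← h, Equiv.symm_apply_apply]⟩
  · exact Or.inr ⟨d, by rw [newDart, ← h, Equiv.symm_apply_apply]⟩

theorem oldDart_snd (d : E × Bool) : (oldDart D d).2 = d.2 := by
  obtain ⟨e, _ | _⟩ := d
  · by_cases h : e ∈ D
    · rw [oldDart_false_of_mem ⟨e, h⟩]
    · rw [oldDart_false_of_notMem h]
  · rfl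

/-- The rotation of the split graph acts as `G.rot` on old darts and as the swap on new ones; facts
about it are checked in these two cases. -/
theorem split_rot_oldDart (d : E × Bool) :
    (G.split D).rot (oldDart D d) = oldDart D (G.rot d) := by
  simp [split, oldDart]

theorem split_rot_newDart (d : D × Bool) :
    (G.split D).rot (newDart D d) = newDart D (twin d) := by
  simp [split, newDart]

theorem split_rot_inv_oldDart (d : E × Bool) :
    (G.split D).rot⁻¹ (oldDart D d) = oldDart D (G.rot⁻¹ d) := by
  rw [Equiv.Perm.inv_eq_iff_eq, split_rot_oldDart, rot_rot_inv]

theorem split_rot_inv_newDart (e : D) (b : Bool) :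
    (G.split D).rot⁻¹ (newDart D (e, b)) = newDart D (e, !b) := by
  rw [Equiv.Perm.inv_eq_iff_eq, split_rot_newDart, twin_apply, Bool.not_not]

theorem origin_oldDart (d : E × Bool) : (G.split D).origin (oldDart D d) = .inl (G.origin d) := by
  obtain ⟨e, _ | _⟩ := d
  · by_cases h : e ∈ D
    · rw [oldDart_false_of_mem ⟨e, h⟩]
      rfl
    · rw [oldDart_false_of_notMem h]
      simp [origin, split, h]
  · rfl

theorem origin_newDart (d : D × Bool) : (G.split D).origin (newDart D d) = .inr d.1 := by
  obtain ⟨e, _ | _⟩ := d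
  · rw [newDart_false]
    simp [origin, split]
  · rfl

/-- The edge that has been split. -/
def oldEdge : E ⊕ D → E := Sum.elim id Subtype.val

theorem oldEdge_oldDart (d : E × Bool) : oldEdge (oldDart D d).1 = d.1 := by
  obtain ⟨e, _ | _⟩ := d
  · by_cases h : e ∈ D
    · rw [oldDart_false_of_mem ⟨e, h⟩]
      rfl
    · rw [oldDart_false_of_notMem h]
      rfl
  · rfl

theorem newDart_eq (d : D × Bool) : oldEdge (newDart D d).1 = d.1 ∧ (newDart D d).2 = d.2 := by
  obtain ⟨e, _ | _⟩ := d <;> exact ⟨rfl, rfl⟩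

theorem split_faceNext (x : (E ⊕ D) × Bool) :
    (G.split D).faceNext x = (G.split D).rot⁻¹ (x.1, !x.2) := rfl

/-- Identifying the halves of an edge carries face walks into faces of `G`. This is the injective
half of the bijection of faces in `numFaces_split`. -/
theorem face_oldEdge_faceNext (x : (E ⊕ D) × Bool) :
    G.face (oldEdge ((G.split D).faceNext x).1, ((G.split D).faceNext x).2) =
      G.face (oldEdge x.1, x.2) := by
  obtain ⟨x, b⟩ := x
  rw [split_faceNext]
  rcases oldDart_or_newDart (x, !b) with ⟨⟨e, b'⟩, h⟩ | ⟨⟨e, b'⟩, h⟩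
  · have h₁ := congrArg (fun x => oldEdge x.1) h
    have h₂ := congrArg Prod.snd h
    simp only [oldEdge_oldDart, oldDart_snd] at h₁ h₂
    rw [h, split_rot_inv_oldDart, oldEdge_oldDart, oldDart_snd]
    rw [h₁]
    refine face_of_rot (d := G.rot⁻¹ (e, b')) ?_
    rw [rot_rot_inv, h₂]
  · have h₁ := congrArg (fun x => oldEdge x.1) h
    have h₂ := congrArg Prod.snd h
    simp only [newDart_eq] at h₁ h₂
    rw [h, split_rot_inv_newDart, (newDart_eq _).1, (newDart_eq _).2, h₁, ← h₂, Bool.not_not]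

theorem face_split_true (e : D) :
    (G.split D).face (.inr e, true) = (G.split D).face (.inl e.1, true) := by
  refine face_of_rot ?_
  rw [← newDart_true, split_rot_newDart]
  rfl

theorem face_split_false (e : D) :
    (G.split D).face (.inl e.1, false) = (G.split D).face (.inr e, false) := by
  refine face_of_rot ?_
  rw [← newDart_false, split_rot_newDart]
  rfl

theorem face_split_oldDart_faceNext (d : E × Bool) :
    (G.split D).face (oldDart D (G.faceNext d)) = (G.split D).face (oldDart D d) := by
  have h : (G.split D).rot (oldDart D (G.faceNext d)) = oldDart D (twin d) := by
    rw [split_rot_oldDart, rot_faceNext]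
  obtain ⟨e, b⟩ := d
  by_cases he : e ∈ D
  · cases b
    · rw [oldDart_false_of_mem ⟨e, he⟩, ← face_split_false]
      exact face_of_rot h
    · rw [oldDart_true, ← face_split_true ⟨e, he⟩]
      refine face_of_rot (h.trans ?_)
      exact oldDart_false_of_mem ⟨e, he⟩
  · cases b
    · rw [oldDart_false_of_notMem he]
      exact face_of_rot h
    · refine face_of_rot (h.trans ?_)
      exact oldDart_false_of_notMem he

theorem face_split_oldDart [Finite E] {d d' : E × Bool} (h : G.faceNext.SameCycle d d') :
    (G.split D).face (oldDart D d) = (G.split D).face (oldDart D d') :=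
  h.apply_eq_of_invariant (f := fun d => (G.split D).face (oldDart D d)) face_split_oldDart_faceNext

theorem numFaces_split [Finite E] : (G.split D).numFaces = G.numFaces := by
  symm
  refine Nat.card_eq_of_bijective
    (Quotient.lift (fun d => (G.split D).face (oldDart D d)) fun d d' h => face_split_oldDart h)
    ⟨?_, ?_⟩
  · rintro ⟨d⟩ ⟨d'⟩ h
    have := Equiv.Perm.SameCycle.apply_eq_of_invariant
      (f := fun x => G.face (oldEdge x.1, x.2)) face_oldEdge_faceNext (face_eq_iff.1 h)
    simp only [oldEdge_oldDart, oldDart_snd] at this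
    exact this
  · rintro ⟨x⟩
    rcases oldDart_or_newDart x with ⟨d, rfl⟩ | ⟨⟨e, _ | _⟩, rfl⟩
    · exact ⟨Quotient.mk _ d, rfl⟩
    · refine ⟨Quotient.mk _ (e.1, false), ?_⟩
      change (G.split D).face (oldDart D (e.1, false)) = _
      rw [oldDart_false_of_mem, ← face_split_false]
      rfl
    · refine ⟨Quotient.mk _ (e.1, true), ?_⟩
      change (G.split D).face (oldDart D (e.1, true)) = _
      rw [oldDart_true, ← face_split_true]
      rfl

theorem reach_split {u v : V} (h : G.Reach u v) : (G.split D).Reach (.inl u) (.inl v) := by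
  refine Relation.TransGen.lift' (p := (G.split D).Adj) Sum.inl ?_ _ _ h
  rintro _ _ ⟨e, rfl, rfl⟩
  by_cases he : e ∈ D
  · exact .head ⟨.inl e, rfl, dif_pos he⟩ (.single ⟨.inr ⟨e, he⟩, rfl, rfl⟩)
  · exact .single ⟨.inl e, rfl, dif_neg he⟩

theorem mem_peakSplitSet [Fintype E] {h : V → ℕ} {e : E} : e ∈ G.peakSplitSet h ↔ ∃ i e',
    (i < h (G.tail e) ∧ (G.succList (G.tail e))[i]? = some e ∧
      (G.succList (G.tail e))[i + 1]? = some e' ∧ G.Reach (G.head e') (G.head e)) ∨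
    (h (G.tail e) ≤ i ∧ (G.succList (G.tail e))[i]? = some e' ∧
      (G.succList (G.tail e))[i + 1]? = some e ∧ G.Reach (G.head e') (G.head e)) := by
  classical
  simp [peakSplitSet]

theorem lt_of_reach {W : Type*} [Preorder W] {π : V → W} (hπ : ∀ e, π (G.tail e) < π (G.head e))
    {u v : V} (h : G.Reach u v) : π u < π v := by
  induction h with
  | single h =>
    obtain ⟨e, rfl, rfl⟩ := h
    exact hπ e
  | tail _ h ih =>
    obtain ⟨e, rfl, rfl⟩ := h
    exact ih.trans (hπ e)

namespace IsPlanarST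

variable [Fintype V] [Fintype E]

section
variable (hG : G.IsPlanarST)
include hG

theorem isPlanarST_split (D : Finset E) : (G.split D).IsPlanarST where
  simple := by
    rintro (e | e) (e' | e') h
    · have h₁ : G.tail e = G.tail e' := by simpa [split] using congrArg Prod.fst h
      have h₂ := congrArg Prod.snd h
      simp only [split] at h₂
      split_ifs at h₂
      · simpa using h₂
      · rw [hG.tail_ne_head e e' h₁ (by simpa using h₂)]
    · simp [split] at h
    · simp [split] at h
    · have : e = e' := by simpa [split] using congrArg Prod.fst h
      rw [this]
  acyclic := by
    obtain ⟨π, hπ⟩ := hG.exists_height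
    intro v hv
    -- Doubled heights leave room for a dummy vertex just above the tail of its edge.
    refine lt_irrefl _ (lt_of_reach (π := Sum.elim (fun v => 2 * (π v : ℕ))
      fun e => 2 * (π (G.tail e.1) : ℕ) + 1) ?_ hv)
    rintro (e | e)
    · by_cases he : e ∈ D
      · simp [split, he]
      · have := hπ e
        simp only [split, he]
        simpa using this
    · have := hπ e.1
      simp only [split, Sum.elim_inl, Sum.elim_inr]
      omega
  source := by
    rintro (v | e)
    · rw [show (G.split D).s = .inl G.s from rfl, Sum.inl.injEq, ← hG.source]
      constructor
      · intro h e he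
        by_cases heD : e ∈ D
        · exact h (.inr ⟨e, heD⟩) (congrArg Sum.inl he)
        · exact h (.inl e) ((dif_neg heD).trans (congrArg Sum.inl he))
      · rintro h (e | e) he
        · simp only [split] at he
          split_ifs at he
          exact h e (by simpa using he)
        · exact h e.1 (by simpa [split] using he)
    · refine iff_of_false (fun h => h (.inl e.1) ?_) (by simp [split])
      simp [split]
  sink := by
    rintro (v | e)
    · rw [show (G.split D).t = .inl G.t from rfl, Sum.inl.injEq, ← hG.sink]
      constructor
      · exact fun h e he => h (.inl e) (congrArg Sum.inl he)
      · rintro h (e | e) he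
        · exact h e (by simpa [split] using he)
        · simp [split] at he
    · exact iff_of_false (fun h => h (.inr e) rfl) (by simp [split])
  rotation := by
    intro x y
    constructor
    · refine fun h => h.apply_eq_of_invariant (f := (G.split D).origin) fun x => ?_
      rcases oldDart_or_newDart x with ⟨d, rfl⟩ | ⟨d, rfl⟩
      · rw [split_rot_oldDart, origin_oldDart, origin_oldDart, hG.origin_rot]
      · rw [split_rot_newDart, origin_newDart, origin_newDart]
        rfl
    · intro h
      rcases oldDart_or_newDart x with ⟨d, rfl⟩ | ⟨⟨e, b⟩, rfl⟩ <;>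
        rcases oldDart_or_newDart y with ⟨d', rfl⟩ | ⟨⟨e', b'⟩, rfl⟩ <;>
        simp only [origin_oldDart, origin_newDart, Sum.inl.injEq, Sum.inr.injEq, reduceCtorEq] at h
      · obtain ⟨k, rfl⟩ := ((hG.rotation _ _).2 h).exists_nat_pow_eq
        refine ⟨k, ?_⟩
        rw [zpow_natCast]
        clear h
        induction k with
        | zero => rfl
        | succ k ih =>
          rw [pow_succ', Equiv.Perm.mul_apply, ih, split_rot_oldDart, pow_succ',
            Equiv.Perm.mul_apply]
      · subst h
        by_cases hb : b = b'
        · rw [hb]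
        · refine ⟨1, ?_⟩
          rw [zpow_one, split_rot_newDart, twin_apply]
          cases b <;> cases b' <;> simp_all
  euler := by
    rw [numFaces_split, Fintype.card_sum, Fintype.card_sum]
    have := hG.euler
    omega
  outer_source := congrArg Sum.inl hG.outer_source
  outer_sink := by
    obtain ⟨e, he, h⟩ := hG.outer_sink
    have h' : (G.split D).face (oldDart D (G.outer, true)) = _ := face_split_oldDart h
    by_cases heD : e ∈ D
    · rw [oldDart_false_of_mem ⟨e, heD⟩] at h'
      exact ⟨.inr ⟨e, heD⟩, congrArg Sum.inl he, face_eq_iff.1 h'⟩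
    · rw [oldDart_false_of_notMem heD] at h'
      exact ⟨.inl e, (dif_neg heD).trans (congrArg Sum.inl he), face_eq_iff.1 h'⟩

theorem succList_split_inl (D : Finset E) (u : V) :
    (G.split D).succList (.inl u) = (G.succList u).map Sum.inl := by
  have h := hG.isSuccList_succList u
  refine (hG.isPlanarST_split D).isSuccList_unique
    ((hG.isPlanarST_split D).isSuccList_succList _) ⟨?_, ?_, ?_, ?_⟩
  · exact h.nodup.map Sum.inl_injective
  · rintro (e | e)
    · simp [h.mem_iff, split]
    · simp [split]
  · rw [List.isChain_map]
    refine h.chain.imp fun e e' he => ?_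
    rw [← oldDart_true, split_rot_oldDart, he]
    rfl
  · intro x hx
    rw [List.head?_map] at hx
    obtain ⟨e, he, rfl⟩ := Option.map_eq_some_iff.1 hx
    rw [← oldDart_true, split_rot_inv_oldDart, oldDart_snd]
    exact (h.first e he).imp id fun h => by rw [h]; rfl

theorem succList_split_inr (D : Finset E) (e : D) : (G.split D).succList (.inr e) = [.inr e] := by
  refine (hG.isPlanarST_split D).isSuccList_unique
    ((hG.isPlanarST_split D).isSuccList_succList _) ⟨by simp, ?_, by simp, ?_⟩
  · rintro (e' | e') <;> simp [split]
  · intro x hx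
    obtain rfl : .inr e = x := by simpa using hx
    rw [← newDart_true, split_rot_inv_newDart]
    exact Or.inl rfl

/-- The vertex with the smallest number has no incoming edge and the one with the largest has no
outgoing edge. -/
theorem isSTOrdering_of_lt (π : V ≃ Fin (Fintype.card V)) (hπ : ∀ e, π (G.tail e) < π (G.head e)) :
    G.IsSTOrdering π := by
  have hpos : 0 < Fintype.card V := Fintype.card_pos_iff.2 ⟨G.s⟩
  refine ⟨?_, ?_, hπ⟩
  · by_contra h
    have hne : π.symm ⟨0, hpos⟩ ≠ G.s := fun h' => h (by rw [← h', Equiv.apply_symm_apply])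
    have := (hG.source _).not.2 hne
    push Not at this
    obtain ⟨e, he⟩ := this
    have := hπ e
    rw [he, Equiv.apply_symm_apply] at this
    exact absurd this (Nat.not_lt_zero _)
  · by_contra h
    have hne : π.symm ⟨Fintype.card V - 1, by omega⟩ ≠ G.t := fun h' => h (by
      rw [← h', Equiv.apply_symm_apply]
      simp only
      omega)
    have := (hG.sink _).not.2 hne
    push Not at this
    obtain ⟨e, he⟩ := this
    have := hπ e
    rw [he, Equiv.apply_symm_apply] at this
    have h₁ := (π (G.head e)).2
    have h₂ : Fintype.card V - 1 < (π (G.head e) : ℕ) := this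
    omega

/-- Any choice of peaks gives a split set. -/
theorem isSplitSet_peakSplitSet (h : V → ℕ) : G.IsSplitSet (G.peakSplitSet h) := by
  set D := G.peakSplitSet h with hD
  have hG' := hG.isPlanarST_split D
  refine ⟨hG', ?_⟩
  -- All edges between consecutive successors are added to the split graph, directed towards the
  -- peak. A new edge starting at a dummy vertex is harmless, since the other dart there is
  -- outgoing; one starting at the head of an unsplit edge does not leave a face sink, by the choice
  -- of `D`.
  have hacyc := hG'.augmented_acyclic
    {x | ∃ u i e e', x = .inl e ∧ (G.succList u)[i]? = some e ∧ (G.succList u)[i + 1]? = some e'}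
    (fun x => ∃ u i e, x = .inl e ∧ (G.succList u)[i]? = some e ∧ i < h u)
    (fun x => ((G.split D).rot (x, true)).1)
    (by
      rintro _ ⟨u, i, e, e', rfl, hi, hi'⟩
      refine ⟨fun h => hG.ne_outer hi hi' (Sum.inl_injective h), ?_⟩
      rw [← oldDart_true, split_rot_oldDart, hG.rot_succList hi hi']
      rfl)
    (by
      rintro _ ⟨u, i, e, e', rfl, hi, hi'⟩ ⟨u₁, i₁, e₁, he₁, hi₁, hlt⟩
      obtain rfl : e = e₁ := Sum.inl_injective he₁
      obtain rfl : u = u₁ := (hG.tail_of_getElem? hi).symm.trans (hG.tail_of_getElem? hi₁)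
      obtain rfl : i = i₁ := hG.index_unique hi hi₁
      by_cases he : e ∈ D
      · rw [← newDart_false ⟨e, he⟩, split_rot_inv_newDart]
        rfl
      · rw [← oldDart_false_of_notMem he, split_rot_inv_oldDart, oldDart_snd]
        by_contra hr
        refine he ?_
        rw [hD, mem_peakSplitSet]
        refine ⟨i, e', Or.inl ?_⟩
        rw [hG.tail_of_getElem? hi]
        refine ⟨hlt, hi, hi', (hG.reach_prev_iff (hG.rot_succList hi hi') (hG.ne_outer hi hi')
          fun h => ?_).2 (by simpa using hr)⟩
        subst h
        exact absurd (hG.index_unique hi hi') (by omega))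
    (by
      rintro _ ⟨u, i, e, e', rfl, hi, hi'⟩ hnot
      have hle : h u ≤ i := by
        by_contra hlt
        exact hnot ⟨u, i, e, rfl, hi, by omega⟩
      rw [← oldDart_true, split_rot_oldDart, hG.rot_succList hi hi', oldDart_true]
      by_cases he : e' ∈ D
      · rw [← newDart_false ⟨e', he⟩, split_rot_newDart]
        rfl
      · rw [← oldDart_false_of_notMem he, split_rot_oldDart, oldDart_snd]
        by_contra hr
        refine he ?_
        rw [hD, mem_peakSplitSet]
        refine ⟨i, e, Or.inr ?_⟩
        rw [hG.tail_of_getElem? hi']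
        refine ⟨hle, hi, hi', (hG.reach_next_iff (hG.rot_succList hi hi') (hG.ne_outer hi hi')
          fun h => ?_).2 (by simpa using hr)⟩
        subst h
        exact absurd (hG.index_unique hi hi') (by omega))
  obtain ⟨π, hπ⟩ := exists_numbering _ hacyc
  refine ⟨π, hG'.isSTOrdering_of_lt π fun e => hπ _ _ (Or.inl ⟨e, rfl, rfl⟩), ?_⟩
  rintro (u | e)
  · rw [hG.succList_split_inl, isBitonic_iff]
    refine ⟨h u, fun i hi => ?_⟩
    simp only [List.length_map] at hi
    have h₁ : (G.succList u)[i]? = some (G.succList u)[i] := List.getElem?_eq_getElem _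
    have h₂ : (G.succList u)[i + 1]? = some (G.succList u)[i + 1] := List.getElem?_eq_getElem _
    have hn : ((G.split D).rot (.inl (G.succList u)[i], true)).1 =
        .inl (G.succList u)[i + 1] := by
      rw [← oldDart_true, split_rot_oldDart, hG.rot_succList h₁ h₂]
      rfl
    simp only [List.getElem_map]
    refine ⟨fun hlt => hπ _ _ (Or.inr ⟨.inl (G.succList u)[i], ⟨u, i, _, _, rfl, h₁, h₂⟩,
      Or.inl ⟨⟨u, i, _, rfl, h₁, hlt⟩, rfl, by rw [hn]⟩⟩), fun hle => hπ _ _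
      (Or.inr ⟨.inl (G.succList u)[i], ⟨u, i, _, _, rfl, h₁, h₂⟩, Or.inr ⟨?_, by rw [hn], rfl⟩⟩)⟩
    rintro ⟨u₁, i₁, e₁, he₁, hi₁, hlt⟩
    have he₁ : (G.succList u)[i] = e₁ := Sum.inl_injective he₁
    rw [← he₁] at hi₁
    obtain rfl : u = u₁ := (hG.tail_of_getElem? h₁).symm.trans (hG.tail_of_getElem? hi₁)
    obtain rfl : i = i₁ := hG.index_unique h₁ hi₁
    omega
  · rw [hG.succList_split_inr]
    exact ⟨0, by simp, by simp⟩

/-- The peaks of a bitonic ordering tell edges that have been split. -/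
theorem exists_peakSplitSet_subset {D : Finset E} (hD : G.IsSplitSet D) :
    ∃ h : V → ℕ, (∀ u, G.succList u ≠ [] → h u < (G.succList u).length) ∧
      G.peakSplitSet h ⊆ D := by
  obtain ⟨-, π, ⟨-, -, hπ⟩, hbit⟩ := hD
  have hbit' := fun u => isBitonic_iff.1 (hbit (.inl u))
  simp only [hG.succList_split_inl, List.length_map, List.getElem_map] at hbit'
  choose h hh using hbit'
  have hle : ∀ e, π ((G.split D).head (.inl e)) ≤ π (.inl (G.head e)) := by
    intro e
    by_cases he : e ∈ D
    · rw [show (G.split D).head (.inl e) = .inr ⟨e, he⟩ from dif_pos he]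
      exact (hπ (.inr ⟨e, he⟩)).le
    · rw [show (G.split D).head (.inl e) = .inl (G.head e) from dif_neg he]
  -- `IsBitonic` does not bound its peak. A peak beyond the end means that the list increases
  -- throughout, so the last position serves as well.
  refine ⟨fun u => min (h u) ((G.succList u).length - 1), fun u hu => ?_, fun e he => ?_⟩
  · have := List.length_pos_iff.2 hu
    dsimp only
    omega
  · rw [mem_peakSplitSet] at he
    -- An unsplit edge keeps its head, which the ordering places below the end of its neighbour and
    -- hence below the head of `e'`, against the path from there.
    by_contra heD
    have hhe : (G.split D).head (.inl e) = .inl (G.head e) := dif_neg heD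
    obtain ⟨i, e', ⟨hi, h₁, h₂, hr⟩ | ⟨hi, h₁, h₂, hr⟩⟩ := he <;>
    · have hlt := lt_of_reach hπ (reach_split (D := D) hr)
      have hlen := (List.getElem?_eq_some_iff.1 h₂).1
      have hb := hh (G.tail e) i hlen
      rw [(List.getElem?_eq_some_iff.1 h₁).2, (List.getElem?_eq_some_iff.1 h₂).2] at hb
      first
      | have := hb.1 (by omega)
        rw [hhe] at this
        exact absurd (this.trans_le (hle e')) hlt.not_gt
      | have := hb.2 (by omega)
        rw [hhe] at this
        exact absurd (this.trans_le (hle e')) hlt.not_gt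

end

end IsPlanarST

end EmbeddedDigraph

/-! ### The size of minimum split sets -/

namespace EmbeddedDigraph

variable {V E : Type*} {G : EmbeddedDigraph V E}

/-- There is a path from the successor at position `i + 1` to the successor at position `i`. -/
def IsBack [Fintype E] (G : EmbeddedDigraph V E) (u : V) (i : ℕ) : Prop :=
  ∃ e e', (G.succList u)[i]? = some e ∧ (G.succList u)[i + 1]? = some e' ∧
    G.Reach (G.head e') (G.head e)

/-- There is a path from the successor at position `i` to the successor at position `i + 1`. -/
def IsForth [Fintype E] (G : EmbeddedDigraph V E) (u : V) (i : ℕ) : Prop :=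
  ∃ e e', (G.succList u)[i]? = some e ∧ (G.succList u)[i + 1]? = some e' ∧
    G.Reach (G.head e) (G.head e')

theorem IsBack.lt_length [Fintype E] {u : V} {i : ℕ} (h : G.IsBack u i) :
    i + 1 < (G.succList u).length := by
  obtain ⟨e, e', -, h, -⟩ := h
  exact (List.getElem?_eq_some_iff.1 h).1

theorem IsForth.lt_length [Fintype E] {u : V} {i : ℕ} (h : G.IsForth u i) :
    i + 1 < (G.succList u).length := by
  obtain ⟨e, e', -, h, -⟩ := h
  exact (List.getElem?_eq_some_iff.1 h).1

open Classical in
theorem numBack_eq [Fintype E] (u : V) (h : ℕ) :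
    G.numBack u h = ((Finset.range h).filter (G.IsBack u)).card := by
  unfold numBack
  congr!

open Classical in
theorem numForth_eq [Fintype E] (u : V) (h : ℕ) :
    G.numForth u h = ((Finset.range h).filter (G.IsForth u)).card := by
  unfold numForth
  congr!

open Classical in
theorem numBack_succ [Fintype E] (u : V) (h : ℕ) :
    G.numBack u (h + 1) = G.numBack u h + if G.IsBack u h then 1 else 0 := by
  rw [numBack_eq, numBack_eq, Finset.range_add_one, Finset.filter_insert]
  split_ifs <;> simp

open Classical in
theorem numForth_succ [Fintype E] (u : V) (h : ℕ) :
    G.numForth u (h + 1) = G.numForth u h + if G.IsForth u h then 1 else 0 := by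
  rw [numForth_eq, numForth_eq, Finset.range_add_one, Finset.filter_insert]
  split_ifs <;> simp

theorem numBack_eq_zero [Fintype E] {u : V} (hu : G.succList u = []) (h : ℕ) :
    G.numBack u h = 0 := by
  classical
  rw [numBack_eq, Finset.card_eq_zero, Finset.filter_eq_empty_iff]
  intro i _ hi
  simpa [hu] using hi.lt_length

theorem numForth_eq_zero [Fintype E] {u : V} (hu : G.succList u = []) (h : ℕ) :
    G.numForth u h = 0 := by
  classical
  rw [numForth_eq, Finset.card_eq_zero, Finset.filter_eq_empty_iff]
  intro i _ hi
  simpa [hu] using hi.lt_length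

theorem exists_isBestPeak [Fintype E] (u : V) : ∃ h, G.IsBestPeak u h := by
  by_cases hu : G.succList u = []
  · exact ⟨0, fun h => absurd hu h, fun h' => by simp [hu]⟩
  · obtain ⟨h, hh, hmin⟩ := Finset.exists_min_image (Finset.range (G.succList u).length)
      (fun h => (G.numBack u h - G.numForth u h : ℤ))
      (Finset.nonempty_range_iff.2 (by simpa using hu))
    exact ⟨h, fun _ => Finset.mem_range.1 hh, fun h' hh' => hmin h' (Finset.mem_range.2 hh')⟩

theorem IsBestPeak.le [Fintype E] {u : V} {h h' : ℕ} (hb : G.IsBestPeak u h)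
    (hh' : G.succList u ≠ [] → h' < (G.succList u).length) :
    (G.numBack u h - G.numForth u h : ℤ) ≤ G.numBack u h' - G.numForth u h' := by
  by_cases hu : G.succList u = []
  · simp [numBack_eq_zero hu, numForth_eq_zero hu]
  · exact hb.2 h' (hh' hu)

namespace IsPlanarST

variable [Fintype V] [Fintype E]

section
variable (hG : G.IsPlanarST)
include hG

-- Backward paths before the peak select the edge at `i`, forward paths from the peak on the edge at
-- `i + 1`. These positions lie on different sides of the peak, so nothing is counted twice.
open Classical in
theorem card_peakSplitSet_at (h : V → ℕ) (u : V) :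
    ((G.peakSplitSet h).filter fun e => G.tail e = u).card + G.numForth u (h u) =
      G.numForth u (G.succList u).length + G.numBack u (h u) := by
  let B := (Finset.range (h u)).filter (G.IsBack u)
  let F := ((Finset.range (G.succList u).length).filter (G.IsForth u)).filter fun i => ¬ i < h u
  have hF : G.numForth u (h u) + F.card = G.numForth u (G.succList u).length := by
    rw [numForth_eq, numForth_eq, ← Finset.card_filter_add_card_filter_not
      (s := (Finset.range (G.succList u).length).filter (G.IsForth u)) (fun i => i < h u)]
    congr 2
    ext i
    simp only [Finset.mem_filter, Finset.mem_range]
    constructor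
    · exact fun ⟨h₁, h₂⟩ => ⟨⟨by have := h₂.lt_length; omega, h₂⟩, h₁⟩
    · exact fun ⟨⟨_, h₂⟩, h₁⟩ => ⟨h₁, h₂⟩
  have hset : ((G.peakSplitSet h).filter fun e => G.tail e = u).map Function.Embedding.some =
      B.image (fun i => (G.succList u)[i]?) ∪ F.image fun i => (G.succList u)[i + 1]? := by
    ext o
    simp only [Finset.mem_map, Finset.mem_filter, Finset.mem_union, Finset.mem_image,
      Function.Embedding.some_apply, mem_peakSplitSet, B, F, Finset.mem_range]
    constructor
    · rintro ⟨e, ⟨⟨i, e', ⟨h₁, h₂, h₃, h₄⟩ | ⟨h₁, h₂, h₃, h₄⟩⟩, rfl⟩, rfl⟩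
      · exact Or.inl ⟨i, ⟨h₁, e, e', h₂, h₃, h₄⟩, h₂⟩
      · refine Or.inr ⟨i, ⟨⟨?_, e', e, h₂, h₃, h₄⟩, not_lt.2 h₁⟩, h₃⟩
        exact (List.getElem?_eq_some_iff.1 h₂).1
    · rintro (⟨i, ⟨h₁, e, e', h₂, h₃, h₄⟩, rfl⟩ | ⟨i, ⟨⟨-, e', e, h₂, h₃, h₄⟩, h₁⟩, rfl⟩)
      · refine ⟨e, ⟨⟨i, e', Or.inl ?_⟩, hG.tail_of_getElem? h₂⟩, h₂.symm⟩
        rw [hG.tail_of_getElem? h₂]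
        exact ⟨h₁, h₂, h₃, h₄⟩
      · refine ⟨e, ⟨⟨i, e', Or.inr ?_⟩, hG.tail_of_getElem? h₃⟩, h₃.symm⟩
        rw [hG.tail_of_getElem? h₃]
        exact ⟨not_lt.1 h₁, h₂, h₃, h₄⟩
  have hcard : ((G.peakSplitSet h).filter fun e => G.tail e = u).card = B.card + F.card := by
    rw [← Finset.card_map Function.Embedding.some, hset, Finset.card_union_of_disjoint,
      Finset.card_image_of_injOn, Finset.card_image_of_injOn]
    · intro i hi j hj hij
      have hi' : G.IsForth u i := (Finset.mem_filter.1 (Finset.mem_filter.1 hi).1).2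
      obtain ⟨-, e, -, he, -⟩ := hi'
      have := hG.index_unique he (by simpa only [he] using hij.symm)
      omega
    · intro i hi j hj hij
      obtain ⟨e, -, he, -⟩ := (Finset.mem_filter.1 hi).2
      exact hG.index_unique he (by simpa only [he] using hij.symm)
    · rw [Finset.disjoint_left]
      rintro o ho ho'
      obtain ⟨i, hi, rfl⟩ := Finset.mem_image.1 ho
      obtain ⟨j, hj, hij⟩ := Finset.mem_image.1 ho'
      simp only [B, F, Finset.mem_filter, Finset.mem_range] at hi hj
      obtain ⟨e, -, he, -⟩ := hi.2
      rw [he] at hij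
      have := hG.index_unique he hij
      omega
  have hB : G.numBack u (h u) = B.card := numBack_eq _ _
  omega

theorem card_peakSplitSet (h : V → ℕ) :
    ((G.peakSplitSet h).card : ℤ) = ∑ u, ((G.numForth u (G.succList u).length : ℤ) +
      (G.numBack u (h u) - G.numForth u (h u))) := by
  classical
  rw [Finset.card_eq_sum_card_fiberwise (f := G.tail) (t := Finset.univ) (by simp), Nat.cast_sum]
  refine Finset.sum_congr rfl fun u _ => ?_
  have := hG.card_peakSplitSet_at h u
  omega

/-- Every split set contains some `peakSplitSet`, and the size of the latter is a sum whose terms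
are minimized separately. -/
theorem isMinSplitSet_peakSplitSet {h : V → ℕ} (hh : ∀ u, G.IsBestPeak u (h u)) :
    G.IsMinSplitSet (G.peakSplitSet h) := by
  refine ⟨hG.isSplitSet_peakSplitSet h, fun D hD => ?_⟩
  obtain ⟨h', hlt, hsub⟩ := hG.exists_peakSplitSet_subset hD
  refine le_trans ?_ (Finset.card_le_card hsub)
  rw [← Nat.cast_le (α := ℤ), hG.card_peakSplitSet, hG.card_peakSplitSet]
  exact Finset.sum_le_sum fun u _ => add_le_add le_rfl ((hh u).le (hlt u))

/-- By acyclicity no neighbouring pair is joined in both directions, and there is one pair fewer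
than there are successors. -/
theorem numForth_add_numBack_lt {u : V} (hu : u ≠ G.t) :
    G.numForth u (G.succList u).length + G.numBack u ((G.succList u).length - 1) <
      (G.succList u).length := by
  classical
  have hlen : (G.succList u).length ≠ 0 := fun h => hu (hG.length_succList_eq_zero.1 h)
  obtain ⟨k, hk⟩ := Nat.exists_eq_succ_of_ne_zero hlen
  have hnot : ¬ G.IsForth u k := fun h => by have := h.lt_length; omega
  rw [hk, Nat.succ_sub_one, numForth_succ, if_neg hnot, add_zero, numBack_eq, numForth_eq,
    ← Finset.card_union_of_disjoint]
  · refine Nat.lt_succ_of_le ((Finset.card_le_card ?_).trans (Finset.card_range k).le)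
    exact Finset.union_subset (Finset.filter_subset _ _) (Finset.filter_subset _ _)
  · rw [Finset.disjoint_filter]
    rintro i - ⟨e₁, e₂, h₁, h₂, h₃⟩ ⟨e₁', e₂', h₁', h₂', h₃'⟩
    obtain rfl : e₁ = e₁' := by simpa [h₁] using h₁'
    obtain rfl : e₂ = e₂' := by simpa [h₂] using h₂'
    exact hG.acyclic _ (h₃.trans h₃')

theorem sum_length_succList : ∑ u, (G.succList u).length = Fintype.card E := by
  classical
  rw [← Finset.card_univ, Finset.card_eq_sum_card_fiberwise (f := G.tail) (t := Finset.univ)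
    (by simp)]
  refine Finset.sum_congr rfl fun u _ => ?_
  rw [← List.toFinset_card_of_nodup (hG.isSuccList_succList u).nodup]
  congr 1
  ext e
  simp [hG.mem_succList]

/-! ### Face lengths and the bound for the number of edges -/

theorem eq_of_rot_eq_self {d d' : E × Bool} (h : G.rot d = d) (ho : G.origin d' = G.origin d) :
    d' = d := by
  obtain ⟨k, rfl⟩ := ((hG.rotation d d').2 ho.symm).exists_nat_pow_eq
  rw [← Equiv.Perm.iterate_eq_pow]
  exact Function.iterate_fixed h k

/-- The source angle gives two darts, and the dart after the first outgoing edge is a third. It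
could coincide with one of them only if the graph were a single edge. -/
theorem three_le_card_face (hV : 3 ≤ Fintype.card V) (f : G.Face) [DecidableEq G.Face] :
    3 ≤ (Finset.univ.filter fun d => G.face d = f).card := by
  classical
  obtain ⟨e, he, rfl⟩ := hG.exists_source_angle f
  obtain ⟨⟨e', b⟩, he'⟩ : ∃ x, x = G.rot (e, true) := ⟨_, rfl⟩
  rw [← he'] at he
  obtain rfl : b = true := he
  have ht := hG.tail_eq_of_rot he'.symm
  obtain ⟨d, hd⟩ : ∃ x, x = G.rot⁻¹ (e, false) := ⟨_, rfl⟩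
  have hdr : G.rot d = (e, false) := by rw [hd, rot_rot_inv]
  have hdo : G.origin d = G.head e := by rw [hd, hG.origin_rot_inv]; rfl
  have h₁ : d ≠ (e, true) := by
    rintro rfl
    exact hG.tail_ne_head_self e hdo
  have h₂ : d ≠ (e', false) := by
    rintro rfl
    obtain rfl := hG.tail_ne_head e' e ht hdo
    have hs : G.tail e' = G.s := by
      rw [← hG.source]
      intro e₁ he₁
      have := hG.eq_of_rot_eq_self he'.symm (d' := (e₁, false)) he₁
      simp at this
    have hh : G.head e' = G.t := by
      rw [← hG.sink]
      intro e₁ he₁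
      have := hG.eq_of_rot_eq_self hdr (d' := (e₁, true)) he₁
      simp at this
    have hall : ∀ v, v = G.s ∨ v = G.t := by
      intro v
      induction hG.reach_of_source v with
      | refl => exact Or.inl rfl
      | tail _ h ih =>
        obtain ⟨e₁, rfl, rfl⟩ := h
        rcases ih with ih | ih
        · have := hG.eq_of_rot_eq_self he'.symm (d' := (e₁, true)) (ih.trans hs.symm)
          obtain rfl : e₁ = e' := by simpa using this
          exact Or.inr hh
        · exact absurd ih (hG.tail_ne_sink e₁)
    have : Fintype.card V ≤ 2 := by
      rw [← Finset.card_univ]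
      refine (Finset.card_le_card (t := {G.s, G.t}) fun v _ => ?_).trans Finset.card_le_two
      simpa using hall v
    omega
  have hsub : ({d, (e, true), (e', false)} : Finset (E × Bool)) ⊆
      Finset.univ.filter fun d => G.face d = G.face (e, true) := by
    intro x hx
    simp only [Finset.mem_insert, Finset.mem_singleton] at hx
    rw [Finset.mem_filter]
    refine ⟨Finset.mem_univ _, ?_⟩
    rcases hx with rfl | rfl | rfl
    · exact face_of_rot hdr
    · rfl
    · exact (face_of_rot he'.symm).symm
  refine le_trans ?_ (Finset.card_le_card hsub)
  rw [Finset.card_eq_three.2 ⟨d, (e, true), (e', false), h₁, h₂, by simp, rfl⟩]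

theorem card_edges_add_six_le (hV : 3 ≤ Fintype.card V) :
    Fintype.card E + 6 ≤ 3 * Fintype.card V := by
  classical
  have h : ∑ _f : G.Face, 3 ≤ Fintype.card (E × Bool) := by
    rw [← Finset.card_univ, Finset.card_eq_sum_card_fiberwise (f := G.face) (t := Finset.univ)
      (by simp)]
    exact Finset.sum_le_sum fun f _ => hG.three_le_card_face hV f
  simp only [Finset.sum_const, Finset.card_univ, smul_eq_mul, Fintype.card_prod,
    Fintype.card_bool] at h
  have := hG.card_face
  omega

theorem source_ne_sink : G.s ≠ G.t := fun h => by
  obtain ⟨e, he, -⟩ := hG.outer_sink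
  exact hG.head_ne_source e (he.trans h.symm)

theorem two_le_card : 2 ≤ Fintype.card V := by
  have := hG.source_ne_sink
  exact Fintype.one_lt_card_iff.2 ⟨_, _, this⟩

theorem card_edges_le : Fintype.card E ≤ 3 * Fintype.card V := by
  rcases le_or_gt 3 (Fintype.card V) with h | h
  · have := hG.card_edges_add_six_le h
    omega
  · have h₁ := hG.two_le_card
    have h₂ := Fintype.card_le_of_injective _ hG.simple
    rw [Fintype.card_prod] at h₂
    have h₃ : Fintype.card V = 2 := by omega
    rw [h₃] at h₂ ⊢
    omega

/-- Taking the first and taking the last successor as peak together cost at most the number of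
neighbouring pairs, so the best peak costs at most half of it. Summation gives `2|D| ≤ |E| - |V| + 1
≤ 2|V| - 5`. -/
theorem card_le_of_isMinSplitSet {D : Finset E} (hD : G.IsMinSplitSet D)
    (hV : 3 ≤ Fintype.card V) : D.card + 3 ≤ Fintype.card V := by
  classical
  choose h hh using exists_isBestPeak (G := G)
  have h₁ := hD.2 _ (hG.isSplitSet_peakSplitSet h)
  have h₂ : 2 * ((G.peakSplitSet h).card : ℤ) + Fintype.card V ≤ Fintype.card E + 1 := by
    rw [hG.card_peakSplitSet, ← hG.sum_length_succList, Finset.mul_sum, Nat.cast_sum]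
    have hc : (Fintype.card V : ℤ) = ∑ u : V, (if u = G.t then 0 else 1) + 1 := by
      rw [← Finset.card_univ, ← Finset.card_filter_add_card_filter_not (fun u => u = G.t)]
      simp [Finset.sum_ite, add_comm, ← Fintype.card_subtype]
    rw [hc, ← add_assoc, ← Finset.sum_add_distrib]
    gcongr with u
    by_cases hu : u = G.t
    · have := List.length_eq_zero_iff.1 (hG.length_succList_eq_zero.2 hu)
      rw [numBack_eq_zero this, numForth_eq_zero this, numForth_eq_zero this, if_pos hu]
      simp
    · rw [if_neg hu]
      have hlt := hG.numForth_add_numBack_lt hu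
      have hz := (hh u).le (h' := 0) fun h => List.length_pos_iff.2 h
      have hl := (hh u).le (h' := (G.succList u).length - 1) fun h => by
        have := List.length_pos_iff.2 h
        omega
      have hz₁ : G.numBack u 0 = 0 := by simp [numBack_eq]
      have hz₂ : G.numForth u 0 = 0 := by simp [numForth_eq]
      have hf : G.numForth u (G.succList u).length =
          G.numForth u ((G.succList u).length - 1) := by
        have hlen : (G.succList u).length ≠ 0 := fun h => hu (hG.length_succList_eq_zero.1 h)
        obtain ⟨k, hk⟩ := Nat.exists_eq_succ_of_ne_zero hlen
        have hnot : ¬ G.IsForth u k := fun h => by have := h.lt_length; omega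
        rw [hk, Nat.succ_sub_one, numForth_succ, if_neg hnot, add_zero]
      omega
  have := hG.card_edges_add_six_le hV
  omega

end

end IsPlanarST

end EmbeddedDigraph

/-! ### Reasoning about programs -/

namespace RAM

/-- The state after an assignment to a register. -/
def State.setReg (σ : State) (x v : ℕ) : State := ⟨Function.update σ.reg x v, σ.arr⟩

/-- The state after a write access to an array. -/
def State.setArr (σ : State) (a i v : ℕ) : State :=
  ⟨σ.reg, Function.update σ.arr a (Function.update (σ.arr a) i v)⟩

@[simp] theorem State.setReg_reg (σ : State) (x v y : ℕ) :
    (σ.setReg x v).reg y = if y = x then v else σ.reg y := by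
  simp [setReg, Function.update_apply]

@[simp] theorem State.setReg_arr (σ : State) (x v : ℕ) : (σ.setReg x v).arr = σ.arr := rfl

@[simp] theorem State.setArr_reg (σ : State) (a i v : ℕ) : (σ.setArr a i v).reg = σ.reg := rfl

@[simp] theorem State.setArr_arr (σ : State) (a i v b j : ℕ) :
    (σ.setArr a i v).arr b j = if b = a ∧ j = i then v else σ.arr b j := by
  rcases eq_or_ne b a with rfl | h
  · simp [setArr, Function.update_apply]
  · simp [setArr, h]

/-- The program halts after at most `T` steps in a state that satisfies `Q`. -/
def Runs (W : ℕ) (p : Prog) (σ : State) (T : ℕ) (Q : State → Prop) : Prop :=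
  ∃ k σ', Exec W p σ k σ' ∧ k ≤ T ∧ Q σ'

/-- A bound for the number of steps of a program without loops. -/
def Prog.time : Prog → ℕ
  | .nop => 1
  | .assign _ e => e.cost + 1
  | .write _ i e => i.cost + e.cost + 1
  | .seq p q => p.time + q.time
  | .cond e p q => e.cost + 1 + max p.time q.time
  | .loop _ _ => 0

/-- The weakest precondition of a program without loops. -/
def wp (W : ℕ) : Prog → (State → Prop) → State → Prop
  | .nop, Q, σ => Q σ
  | .assign x e, Q, σ => e.eval σ ≤ W ∧ Q (σ.setReg x (e.eval σ))
  | .write a i e, Q, σ => i.eval σ ≤ W ∧ e.eval σ ≤ W ∧ Q (σ.setArr a (i.eval σ) (e.eval σ))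
  | .seq p q, Q, σ => wp W p (wp W q Q) σ
  | .cond e p q, Q, σ => (e.eval σ ≠ 0 → wp W p Q σ) ∧ (e.eval σ = 0 → wp W q Q σ)
  | .loop _ _, _, _ => False

variable {W : ℕ} {p q : Prog} {σ : State} {T T₁ T₂ : ℕ} {Q R : State → Prop} {e : Expr}

theorem Runs.mono (h : Runs W p σ T₁ R) (hT : T₁ ≤ T₂) (hQ : ∀ σ', R σ' → Q σ') :
    Runs W p σ T₂ Q := by
  obtain ⟨k, σ', h₁, h₂, h₃⟩ := h
  exact ⟨k, σ', h₁, h₂.trans hT, hQ _ h₃⟩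

theorem Runs.seq (h₁ : Runs W p σ T₁ R) (h₂ : ∀ σ', R σ' → Runs W q σ' T₂ Q) :
    Runs W (.seq p q) σ (T₁ + T₂) Q := by
  obtain ⟨k₁, σ₁, e₁, l₁, r₁⟩ := h₁
  obtain ⟨k₂, σ₂, e₂, l₂, r₂⟩ := h₂ σ₁ r₁
  exact ⟨k₁ + k₂, σ₂, .seq _ _ _ _ _ _ _ e₁ e₂, add_le_add l₁ l₂, r₂⟩

theorem Runs.cond (h₁ : e.eval σ ≠ 0 → Runs W p σ T Q) (h₂ : e.eval σ = 0 → Runs W q σ T Q) :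
    Runs W (.cond e p q) σ (e.cost + 1 + T) Q := by
  by_cases h : e.eval σ = 0
  · obtain ⟨k, σ', h₃, h₄, h₅⟩ := h₂ h
    exact ⟨_, σ', .cond_false _ _ _ _ _ _ h h₃, by omega, h₅⟩
  · obtain ⟨k, σ', h₃, h₄, h₅⟩ := h₁ h
    exact ⟨_, σ', .cond_true _ _ _ _ _ _ h h₃, by omega, h₅⟩

theorem Runs.of_wp (h : wp W p Q σ) : Runs W p σ p.time Q := by
  induction p generalizing Q σ with
  | nop => exact ⟨_, _, .nop σ, le_rfl, h⟩
  | assign x e => exact ⟨_, _, .assign σ x e h.1, le_rfl, h.2⟩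
  | write a i e => exact ⟨_, _, .write σ a i e h.1 h.2.1, le_rfl, h.2.2⟩
  | seq p q ihp ihq => exact Runs.seq (ihp h) fun σ' h' => ihq h'
  | cond e p q ihp ihq =>
    exact Runs.cond (fun h' => (ihp (h.1 h')).mono (le_max_left _ _) fun _ => id)
      fun h' => (ihq (h.2 h')).mono (le_max_right _ _) fun _ => id
  -- The precondition `wp` of a loop is `False`, so the value of `Prog.time` at a loop is
  -- irrelevant.
  | loop => exact h.elim

/-- A loop that runs `N` times with the invariant `I`. -/
theorem Runs.loop (I : ℕ → State → Prop) (N : ℕ) (T : ℕ → ℕ)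
    (hstep : ∀ i < N, ∀ σ, I i σ → e.eval σ ≠ 0 ∧ Runs W p σ (T i) (I (i + 1)))
    (hdone : ∀ σ, I N σ → e.eval σ = 0) (h : I 0 σ) :
    Runs W (.loop e p) σ (∑ i ∈ Finset.range N, (e.cost + 1 + T i) + (e.cost + 1)) (I N) := by
  -- Here `j` is the number of iterations that remain.
  suffices H : ∀ j ≤ N, ∀ σ, I (N - j) σ → Runs W (.loop e p) σ
      (∑ i ∈ Finset.Ico (N - j) N, (e.cost + 1 + T i) + (e.cost + 1)) (I N) by
    have := H N le_rfl σ (by simpa using h)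
    simpa using this
  intro j
  induction j with
  | zero =>
    intro _ σ hσ
    exact ⟨_, σ, .loop_done _ _ _ (hdone σ hσ), by simp, hσ⟩
  | succ j ih =>
    intro hj σ hσ
    obtain ⟨h₀, k₁, σ₁, e₁, l₁, r₁⟩ := hstep _ (by omega) σ hσ
    rw [show N - (j + 1) + 1 = N - j by omega] at r₁
    obtain ⟨k₂, σ₂, e₂, l₂, r₂⟩ := ih (by omega) σ₁ r₁
    refine ⟨_, σ₂, .loop_step _ _ _ _ _ _ _ h₀ e₁ e₂, ?_, r₂⟩
    rw [Finset.sum_eq_sum_Ico_succ_bot (by omega), show N - (j + 1) + 1 = N - j by omega]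
    omega

theorem Runs.loop_const (I : ℕ → State → Prop) (N T : ℕ)
    (hstep : ∀ i < N, ∀ σ, I i σ → e.eval σ ≠ 0 ∧ Runs W p σ T (I (i + 1)))
    (hdone : ∀ σ, I N σ → e.eval σ = 0) (h : I 0 σ) :
    Runs W (.loop e p) σ (N * (e.cost + 1 + T) + (e.cost + 1)) (I N) :=
  (Runs.loop I N (fun _ => T) hstep hdone h).mono (by simp) fun _ => id

/-! ### The algorithm -/

/-- Array `5`: the entry of the dart `(e, true)` is `e + 1`, the entry of `(e, false)` is zero. -/
def outBody : Prog :=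
  -- The shift by one lets a single entry both recognize outgoing darts and name their edge.
  .seq (.write 5 (.add (.reg 5) (.reg 5)) (.add (.reg 5) (.const 1)))
    (.assign 5 (.add (.reg 5) (.const 1)))

/-- Array `4` marks the darts `(e, false)` that follow an incoming dart, array `6` holds for each
vertex the dart that starts its successor list. -/
def turnBody : Prog :=
  .seq (.assign 6 (.read 2 (.add (.add (.reg 5) (.reg 5)) (.const 1))))
    (.seq (.cond (.read 5 (.reg 6)) (.write 6 (.read 1 (.reg 5)) (.reg 6))
        (.write 4 (.reg 6) (.const 1)))
      (.assign 5 (.add (.reg 5) (.const 1))))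

/-- Run a program for each number in register `5` that is less than the one in register `x`. -/
def forLoop (x : ℕ) (p : Prog) : Prog := .loop (.lt (.reg 5) (.reg x)) p

/-- The dart in register `6` is not the last one of a successor list. -/
def notLast : Expr :=
  -- The truncated difference of truth values means "and not". The second test is needed at the
  -- source, which has no incoming dart to end the list.
  .sub (.lt (.const 0) (.read 5 (.read 2 (.reg 6)))) (.eq (.reg 6) (.add (.reg 4) (.reg 4)))

/-- The dart in register `6` is not the first one of a successor list, and there is a path from the
previous successor to its head. -/
def forthTest : Expr :=
  .eq (.read 5 (.read 2 (.add (.reg 6) (.const 1)))) (.const 0)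

/-- Find the peak of a successor list. -/
def peakBody : Prog :=
  .seq (.assign 9 (.add (.reg 9) (.const 1)))
    (.seq (.assign 7 (.add (.reg 7) (.read 4 (.add (.reg 6) (.const 1)))))
    (.seq (.assign 6 (.read 2 (.reg 6)))
    (.seq (.assign 8 (.add (.reg 8) forthTest))
    -- Registers `7`, `8`, `9` hold `L`, `R` and the position, registers `10`, `11`, `12` the same
    -- for the best peak so far. The comparison of `L - R` is rearranged into sums because
    -- subtraction is truncated; being strict, it keeps the first minimum.
    (.cond (.lt (.add (.reg 7) (.reg 11)) (.add (.reg 10) (.reg 8)))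
      (.seq (.assign 10 (.reg 7)) (.seq (.assign 11 (.reg 8)) (.assign 12 (.reg 9))))
      .nop))))

/-- Mark the edge of the dart in register `6`. -/
def mark : Prog := .write 3 (.sub (.read 5 (.reg 6)) (.const 1)) (.const 1)

/-- Mark the edges to be split in a successor list. -/
def markBody : Prog :=
  -- Register `12` counts down to the peak. Before the peak the edge is tested before moving on;
  -- from the peak on, the edge reached by the move is tested.
  .cond (.reg 12)
    (.seq (.cond (.read 4 (.add (.reg 6) (.const 1))) mark .nop)
      (.seq (.assign 12 (.sub (.reg 12) (.const 1))) (.assign 6 (.read 2 (.reg 6)))))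
    (.seq (.assign 6 (.read 2 (.reg 6))) (.cond forthTest mark .nop))

/-- Start a pass through the successor list of the vertex in register `5`. -/
def startPass : Prog := .assign 6 (.read 6 (.reg 5))

/-- Set the registers that are used in the search for a peak to zero. -/
def resetPeak : Prog :=
  .seq (.assign 7 (.const 0)) (.seq (.assign 8 (.const 0)) (.seq (.assign 9 (.const 0))
    (.seq (.assign 10 (.const 0)) (.seq (.assign 11 (.const 0)) (.assign 12 (.const 0))))))

/-- Handle the vertex in register `5`. -/
def vertexBody : Prog :=
  .seq (.cond (.eq (.reg 5) (.reg 3)) .nop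
      (.seq (.seq startPass resetPeak)
        (.seq (.loop notLast peakBody) (.seq startPass (.loop notLast markBody)))))
    (.assign 5 (.add (.reg 5) (.const 1)))

/-- The start of the successor list of the source. -/
def startSource : Prog :=
  .seq (.write 6 (.reg 2) (.read 2 (.add (.reg 4) (.reg 4)))) (.assign 5 (.const 0))

/-- The linear-time algorithm for minimum split sets. -/
def splitProg : Prog :=
  .seq (forLoop 1 outBody) (.seq (.assign 5 (.const 0)) (.seq (forLoop 1 turnBody)
    (.seq startSource (forLoop 0 vertexBody))))

@[simp] theorem dartCode_true {m : ℕ} (e : Fin m) : dartCode (e, true) = e + e := by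
  simp [dartCode, two_mul]

@[simp] theorem dartCode_false {m : ℕ} (e : Fin m) : dartCode (e, false) = e + e + 1 := by
  simp [dartCode, two_mul]

theorem dartCode_lt {m : ℕ} (d : Fin m × Bool) : dartCode d < m + m := by
  obtain ⟨e, _ | _⟩ := d <;> simp <;> omega

variable {n m : ℕ} {G : EmbeddedDigraph (Fin n) (Fin m)}

/-- The state still contains the input. -/
structure HasInput (G : EmbeddedDigraph (Fin n) (Fin m)) (σ : State) : Prop where
  reg_zero : σ.reg 0 = n
  reg_one : σ.reg 1 = m
  reg_two : σ.reg 2 = G.s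
  reg_three : σ.reg 3 = G.t
  reg_four : σ.reg 4 = G.outer
  arr_one : ∀ e : Fin m, σ.arr 1 e = G.head e
  arr_two : ∀ d, σ.arr 2 (dartCode d) = dartCode (G.rot d)

theorem hasInput_inputState : HasInput G (inputState G) := by
  refine ⟨rfl, rfl, rfl, rfl, rfl, fun e => by simp [inputState], ?_⟩
  rintro ⟨e, _ | _⟩
  · have h : ((e : ℕ) + e + 1) / 2 = e := by omega
    have h' : ((e : ℕ) + e + 1) % 2 = 1 := by omega
    simp [inputState, h, h']
  · have h : ((e : ℕ) + e) / 2 = e := by omega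
    have h' : ((e : ℕ) + e) % 2 = 0 := by omega
    simp [inputState, h, h']

@[simp] theorem hasInput_setReg {x v : ℕ} (hx : 5 ≤ x) :
    HasInput G (σ.setReg x v) ↔ HasInput G σ := by
  constructor <;> rintro ⟨h₀, h₁, h₂, h₃, h₄, h₅, h₆⟩ <;> constructor <;>
    simp_all [show 0 ≠ x by omega, show 1 ≠ x by omega, show 2 ≠ x by omega,
      show 3 ≠ x by omega, show 4 ≠ x by omega]

@[simp] theorem hasInput_setArr {a i v : ℕ} (ha : 3 ≤ a) :
    HasInput G (σ.setArr a i v) ↔ HasInput G σ := by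
  constructor <;> rintro ⟨h₀, h₁, h₂, h₃, h₄, h₅, h₆⟩ <;> constructor <;>
    simp_all [show 1 ≠ a by omega, show 2 ≠ a by omega]

/-- Array `5` has been computed. -/
def HasOut (m : ℕ) (σ : State) : Prop :=
  (∀ e : Fin m, σ.arr 5 (e + e) = e + 1) ∧ ∀ e : Fin m, σ.arr 5 (e + e + 1) = 0

theorem runs_outLoop (hW : 2 * m ≤ W) (h : HasInput G σ) (h₅ : σ.reg 5 = 0)
    (ha : ∀ i, σ.arr 5 i = 0) (h₃ : ∀ i, σ.arr 3 i = 0) (h₄ : ∀ i, σ.arr 4 i = 0) :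
    Runs W (forLoop 1 outBody) σ (15 * m + 5) fun σ => HasInput G σ ∧ HasOut m σ ∧
      (∀ i, σ.arr 3 i = 0) ∧ ∀ i, σ.arr 4 i = 0 := by
  refine (Runs.loop_const (fun i σ => HasInput G σ ∧ σ.reg 5 = i ∧
    (∀ k, σ.arr 5 k = if k % 2 = 0 ∧ k / 2 < i then k / 2 + 1 else 0) ∧
      (∀ i, σ.arr 3 i = 0) ∧ ∀ i, σ.arr 4 i = 0) m outBody.time ?_ ?_ ?_).mono ?_ ?_
  · rintro i hi σ ⟨h, h₅, ha, h₃, h₄⟩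
    refine ⟨by simp [Expr.eval, h₅, h.reg_one, hi], Runs.of_wp ?_⟩
    simp only [outBody, wp, Expr.eval, h₅, State.setArr_reg, hasInput_setReg (le_refl 5),
      hasInput_setArr (show 3 ≤ 5 by norm_num), State.setReg_arr, State.setReg_reg, if_true,
      State.setArr_arr, h, true_and]
    refine ⟨by omega, by omega, by omega, ?_, by simpa using h₃, by simpa using h₄⟩
    intro k
    rw [ha]
    split_ifs <;> omega
  · rintro σ ⟨h, h₅, -⟩
    simp [Expr.eval, h₅, h.reg_one]
  · exact ⟨h, h₅, by simpa using ha, h₃, h₄⟩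
  · change m * 15 + 4 ≤ _
    omega
  · rintro σ ⟨h, -, ha, h₃, h₄⟩
    refine ⟨h, ⟨fun e => ?_, fun e => ?_⟩, h₃, h₄⟩
    · rw [ha, if_pos (by omega)]
      omega
    · rw [ha, if_neg (by omega)]

end RAM

/-! ### Correctness of the preprocessing -/

namespace RAM

variable {W n m : ℕ} {G : EmbeddedDigraph (Fin n) (Fin m)} {σ : State}

open EmbeddedDigraph

theorem HasOut.eq (h : HasOut m σ) (d : Fin m × Bool) :
    σ.arr 5 (dartCode d) = if d.2 then (d.1 : ℕ) + 1 else 0 := by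
  obtain ⟨e, _ | _⟩ := d
  · simpa using h.2 e
  · simpa using h.1 e

/-- The arrays `4` and `6` have been computed. -/
structure HasTurns (G : EmbeddedDigraph (Fin n) (Fin m)) (σ : State) : Prop where
  back : ∀ e : Fin m, σ.arr 4 (e + e + 1) = if (G.rot⁻¹ (e, false)).2 = false then 1 else 0
  first : ∀ e e' : Fin m, G.rot (e, false) = (e', true) → σ.arr 6 (G.head e) = e' + e'

theorem runs_turnLoop (hG : G.IsPlanarST) (hW : 2 * m ≤ W) (hn : n ≤ W) (h : HasInput G σ)
    (ho : HasOut m σ) (h₅ : σ.reg 5 = 0) (h₃ : ∀ i, σ.arr 3 i = 0) (h₄ : ∀ i, σ.arr 4 i = 0) :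
    Runs W (forLoop 1 turnBody) σ (22 * m + 5) fun σ => HasInput G σ ∧ HasOut m σ ∧
      (∀ i, σ.arr 3 i = 0) ∧ HasTurns G σ := by
  refine (Runs.loop_const (fun i σ => HasInput G σ ∧ HasOut m σ ∧ σ.reg 5 = i ∧
    (∀ i, σ.arr 3 i = 0) ∧
    (∀ e : Fin m, σ.arr 4 (e + e + 1) =
      if (G.rot⁻¹ (e, false)).2 = false ∧ ((G.rot⁻¹ (e, false)).1 : ℕ) < i then 1 else 0) ∧
    ∀ e e' : Fin m, (e : ℕ) < i → G.rot (e, false) = (e', true) →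
      σ.arr 6 (G.head e) = e' + e') m turnBody.time ?_ ?_ ?_).mono ?_ ?_
  · rintro i hi σ ⟨h, ho, h₅, h₃, h₄, h₆⟩
    refine ⟨by simp [Expr.eval, h₅, h.reg_one, hi], Runs.of_wp ?_⟩
    obtain ⟨e, rfl⟩ : ∃ e : Fin m, (e : ℕ) = i := ⟨⟨i, hi⟩, rfl⟩
    have h₂ := h.arr_two (e, false)
    have ho' := ho.eq (G.rot (e, false))
    have hlt := dartCode_lt (G.rot (e, false))
    rw [← h₂] at ho' hlt
    rw [dartCode_false] at h₂ ho' hlt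
    have hhead := (G.head e).2
    obtain ⟨⟨x, b⟩, hx⟩ : ∃ x, x = G.rot (e, false) := ⟨_, rfl⟩
    rw [← hx] at h₂ ho'
    have hinv : ∀ e' : Fin m, G.rot⁻¹ (e', false) = (e, false) ↔ (e', false) = (x, b) := by
      intro e'
      rw [Equiv.Perm.inv_eq_iff_eq, ← hx]
    -- If the next dart is incoming, its mark in array `4` is set; if it is outgoing, it starts the
    -- successor list of the head of `e`.
    cases b
    · simp only [Bool.false_eq_true, if_false] at ho'
      simp only [turnBody, wp, Expr.eval, State.setReg_reg, State.setReg_arr, State.setArr_reg, h₅,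
        reduceIte, ho', ne_eq, not_true_eq_false, false_imp_iff, true_imp_iff, true_and,
        Nat.reduceEqDiff, hasInput_setReg (show 5 ≤ 5 by norm_num), h,
        hasInput_setReg (show 5 ≤ 6 by norm_num), hasInput_setArr (show 3 ≤ 4 by norm_num),
        State.setArr_arr, false_and, if_false, HasOut]
      refine ⟨by omega, by omega, by omega, by omega, ho, h₃, ?_, ?_⟩
      · intro e'
        rw [h₂, dartCode_false, h₄]
        have := hinv e'
        by_cases hex : e' = x
        · subst hex
          rw [if_pos rfl, if_pos]
          simp [this.2 rfl]
        · rw [if_neg (by omega)]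
          have hne : ¬ ((G.rot⁻¹ (e', false)).2 = false ∧ (G.rot⁻¹ (e', false)).1 = e) := fun h' =>
            hex (by simpa using this.1 (Prod.ext h'.2 h'.1))
          congr 1
          rw [eq_iff_iff]
          refine and_congr_right fun hb => ?_
          have : ((G.rot⁻¹ (e', false)).1 : ℕ) ≠ e := fun h' => hne ⟨hb, Fin.ext h'⟩
          omega
      · intro e₁ e' hlt' he'
        refine h₆ e₁ e' (lt_of_le_of_ne (Nat.lt_succ_iff.1 hlt') fun h' => ?_) he'
        rw [Fin.ext h', ← hx] at he'
        simp at he'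
    · simp only [if_true] at ho'
      simp only [turnBody, wp, Expr.eval, State.setReg_reg, State.setReg_arr, State.setArr_reg, h₅,
        reduceIte, ho', ne_eq, Nat.add_eq_zero_iff, one_ne_zero, and_false, not_false_eq_true,
        false_imp_iff, true_imp_iff, true_and, and_true,
        Nat.reduceEqDiff, hasInput_setReg (show 5 ≤ 5 by norm_num), h,
        hasInput_setReg (show 5 ≤ 6 by norm_num), hasInput_setArr (show 3 ≤ 6 by norm_num),
        State.setArr_arr, false_and, if_false, HasOut]
      rw [h.arr_one]
      refine ⟨by omega, by omega, by omega, by omega, ho, h₃, ?_, ?_⟩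
      · intro e'
        rw [h₄]
        congr 1
        rw [eq_iff_iff]
        refine and_congr_right fun hb => ?_
        have : ((G.rot⁻¹ (e', false)).1 : ℕ) ≠ e := fun h' => by
          have := (hinv e').1 (Prod.ext (Fin.ext h') hb)
          simp at this
        omega
      · intro e₁ e' hlt' he'
        split_ifs with hh
        -- Only one turn exists at each vertex, so the new entry cannot overwrite a different one.
        · obtain rfl := hG.turn_unique (e := e₁) (e' := e) (by rw [he']) (by rw [← hx]) (Fin.ext hh)
          rw [← hx] at he'
          obtain rfl : x = e' := by simpa using he'
          rw [h₂, dartCode_true]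
        · refine h₆ e₁ e' (lt_of_le_of_ne (Nat.lt_succ_iff.1 hlt') fun h' => hh ?_) he'
          rw [Fin.ext h']
  · rintro σ ⟨h, -, h₅, -⟩
    simp [Expr.eval, h₅, h.reg_one]
  · exact ⟨h, ho, h₅, h₃, by simpa using fun e => h₄ _, by simp⟩
  · change m * 22 + 4 ≤ _
    omega
  · rintro σ ⟨h, ho, -, h₃, h₄, h₆⟩
    exact ⟨h, ho, h₃, fun e => by simpa using h₄ e, fun e e' => h₆ e e' e.2⟩

/-- Everything that is needed to walk through the successor lists has been computed. -/
structure Ready (G : EmbeddedDigraph (Fin n) (Fin m)) (σ : State) : Prop where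
  input : HasInput G σ
  out : HasOut m σ
  back : ∀ e : Fin m, σ.arr 4 (e + e + 1) = if (G.rot⁻¹ (e, false)).2 = false then 1 else 0
  first : ∀ (u : Fin n) (e : Fin m), (G.succList u)[0]? = some e → σ.arr 6 u = e + e

@[simp] theorem ready_setReg {x v : ℕ} (hx : 5 ≤ x) : Ready G (σ.setReg x v) ↔ Ready G σ := by
  constructor <;> rintro ⟨h₁, h₂, h₃, h₄⟩
  · exact ⟨(hasInput_setReg hx).1 h₁, h₂, h₃, h₄⟩
  · exact ⟨(hasInput_setReg hx).2 h₁, h₂, h₃, h₄⟩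

@[simp] theorem ready_setArr {i v : ℕ} : Ready G (σ.setArr 3 i v) ↔ Ready G σ := by
  constructor <;> rintro ⟨h₁, h₂, h₃, h₄⟩
  · exact ⟨(hasInput_setArr le_rfl).1 h₁, by simpa [HasOut] using h₂, by simpa using h₃,
      by simpa using h₄⟩
  · exact ⟨(hasInput_setArr le_rfl).2 h₁, by simpa [HasOut] using h₂, by simpa using h₃,
      by simpa using h₄⟩

/-- An edge at a later position follows its predecessor in the list, an outgoing dart different from
`G.outer`. -/
theorem first_of_rot (hG : G.IsPlanarST) {d : Fin m × Bool} {e' : Fin m}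
    (h : G.rot d = (e', true)) (hd : d.2 = false ∨ d = (G.outer, true)) :
    (G.succList (G.tail e'))[0]? = some e' := by
  obtain ⟨j, hj⟩ := List.mem_iff_getElem?.1 (hG.mem_succList.2 (rfl : G.tail e' = G.tail e'))
  rcases j with _ | j
  · exact hj
  · exfalso
    have hlt := (List.getElem?_eq_some_iff.1 hj).1
    have hj' : (G.succList (G.tail e'))[j]? = some (G.succList (G.tail e'))[j] :=
      List.getElem?_eq_getElem (by omega)
    have h₂ := hG.rot_succList hj' hj
    rw [← h] at h₂
    have h₃ := G.rot.injective h₂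
    rcases hd with hd | hd
    · rw [← h₃] at hd
      cases hd
    · rw [← h₃] at hd
      exact hG.ne_outer hj' hj (by simpa using hd)

/-- The source has no turn, so the previous loop leaves its starting dart open. -/
theorem runs_startSource (hG : G.IsPlanarST) (hW : 2 * m ≤ W) (hn : n ≤ W) (h : HasInput G σ)
    (ho : HasOut m σ) (h₃ : ∀ i, σ.arr 3 i = 0) (ht : HasTurns G σ) :
    Runs W startSource σ 8 fun σ => Ready G σ ∧ σ.reg 5 = 0 ∧ ∀ i, σ.arr 3 i = 0 := by
  refine Runs.of_wp (p := startSource) ?_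
  have h₂ := h.arr_two (G.outer, true)
  have hlt := dartCode_lt (G.rot (G.outer, true))
  rw [← h₂] at hlt
  rw [dartCode_true] at h₂ hlt
  have hs := G.s.2
  simp only [startSource, wp, Expr.eval, h.reg_two, h.reg_four, State.setReg_reg,
    State.setReg_arr, State.setArr_reg, reduceIte, State.setArr_arr, Nat.reduceEqDiff, false_and,
    if_false]
  refine ⟨by omega, by omega, by omega, ?_, trivial, h₃⟩
  rw [ready_setReg le_rfl]
  refine ⟨(hasInput_setArr (by norm_num)).2 h, by simpa [HasOut] using ho, by simpa using ht.back, ?_⟩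
  intro u e he
  rw [State.setArr_arr]
  have hte := hG.tail_of_getElem? he
  split_ifs with hu
  · have hus : u = G.s := Fin.ext hu.2
    have hb := hG.snd_of_origin_eq_source ((hG.origin_rot (G.outer, true)).trans hG.outer_source)
    have hor := (hG.origin_rot (G.outer, true)).trans hG.outer_source
    obtain ⟨⟨x, b⟩, hx⟩ : ∃ x, x = G.rot (G.outer, true) := ⟨_, rfl⟩
    rw [← hx] at hb h₂ hor
    obtain rfl : b = true := hb
    have hf := first_of_rot hG hx.symm (Or.inr rfl)
    rw [show G.tail x = u from hor.trans hus.symm, he] at hf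
    obtain rfl : e = x := by simpa using hf
    rw [h₂, dartCode_true]
  · have hus : u ≠ G.s := fun h' => hu ⟨rfl, congrArg Fin.val h'⟩
    have hut : u ≠ G.t := by
      rintro rfl
      exact hG.tail_ne_sink e hte
    obtain ⟨e₀, h₀, rfl⟩ := hG.exists_turn u hus hut
    have hor := hG.origin_rot (e₀, false)
    obtain ⟨⟨x, b⟩, hx⟩ : ∃ x, x = G.rot (e₀, false) := ⟨_, rfl⟩
    rw [← hx] at h₀ hor
    obtain rfl : b = true := h₀
    have hf := first_of_rot hG hx.symm (Or.inl rfl)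
    rw [show G.tail x = G.head e₀ from hor, he] at hf
    obtain rfl : e = x := by simpa using hf
    exact ht.first e₀ e hx.symm

section

variable {u : Fin n} {k : ℕ} {e e' : Fin m}

/-- Through `reach_prev_iff` reachability becomes a lookup in constant time. -/
theorem Ready.isBack_iff (hG : G.IsPlanarST) (hσ : Ready G σ) (h : (G.succList u)[k]? = some e)
    (h' : (G.succList u)[k + 1]? = some e') : σ.arr 4 (e + e + 1) ≠ 0 ↔ G.IsBack u k := by
  have hne : e ≠ e' := by
    rintro rfl
    exact absurd (hG.index_unique h h') (by omega)
  have := hG.reach_prev_iff (hG.rot_succList h h') (hG.ne_outer h h') hne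
  rw [hσ.back, IsBack]
  simp only [h, h', Option.some.injEq, ne_eq, ite_eq_right_iff, one_ne_zero, imp_false, not_not,
    ← this]
  constructor
  · exact fun h => ⟨e, e', rfl, rfl, h⟩
  · rintro ⟨_, _, rfl, rfl, h⟩
    exact h

theorem Ready.isForth_iff (hG : G.IsPlanarST) (hσ : Ready G σ) (h : (G.succList u)[k]? = some e)
    (h' : (G.succList u)[k + 1]? = some e') :
    σ.arr 5 (σ.arr 2 (e' + e' + 1)) = 0 ↔ G.IsForth u k := by
  have hne : e ≠ e' := by
    rintro rfl
    exact absurd (hG.index_unique h h') (by omega)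
  have := hG.reach_next_iff (hG.rot_succList h h') (hG.ne_outer h h') hne
  rw [← dartCode_false, hσ.input.arr_two, hσ.out.eq, IsForth]
  simp only [h, h', Option.some.injEq]
  constructor
  · intro h₁
    refine ⟨e, e', rfl, rfl, this.2 ?_⟩
    by_contra hb
    simp [hb] at h₁
  · rintro ⟨_, _, rfl, rfl, h₁⟩
    simp [this.1 h₁]

theorem Ready.add_back (hG : G.IsPlanarST) (hσ : Ready G σ) (h : (G.succList u)[k]? = some e)
    (h' : (G.succList u)[k + 1]? = some e') :
    G.numBack u k + σ.arr 4 (e + e + 1) = G.numBack u (k + 1) := by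
  classical
  have := hσ.isBack_iff hG h h'
  rw [numBack_succ]
  simp only [← this]
  rw [hσ.back]
  split_ifs <;> simp_all

theorem Ready.add_forth (hG : G.IsPlanarST) (hσ : Ready G σ) (h : (G.succList u)[k]? = some e)
    (h' : (G.succList u)[k + 1]? = some e') :
    (G.numForth u k + if σ.arr 5 (σ.arr 2 (e' + e' + 1)) = 0 then 1 else 0) =
      G.numForth u (k + 1) := by
  classical
  rw [numForth_succ]
  simp only [hσ.isForth_iff hG h h']

theorem Ready.rot_eq (hG : G.IsPlanarST) (hσ : Ready G σ) (h : (G.succList u)[k]? = some e)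
    (h' : (G.succList u)[k + 1]? = some e') : σ.arr 2 (e + e) = e' + e' := by
  rw [← dartCode_true, hσ.input.arr_two, hG.rot_succList h h', dartCode_true]

theorem Ready.notLast_ne_zero (hG : G.IsPlanarST) (hσ : Ready G σ)
    (h : (G.succList u)[k]? = some e) (h' : (G.succList u)[k + 1]? = some e')
    (h₆ : σ.reg 6 = e + e) : notLast.eval σ ≠ 0 := by
  have hne : (e : ℕ) ≠ G.outer := fun h₁ => hG.ne_outer h h' (Fin.ext h₁)
  simp only [notLast, Expr.eval, h₆, hσ.rot_eq hG h h', hσ.input.reg_four, hσ.out.1]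
  rw [if_pos (by omega), if_neg (by omega)]
  norm_num

theorem Ready.notLast_eq_zero (hG : G.IsPlanarST) (hσ : Ready G σ)
    (h : (G.succList u)[k]? = some e) (h' : (G.succList u)[k + 1]? = none)
    (h₆ : σ.reg 6 = e + e) : notLast.eval σ = 0 := by
  have h₂ := hσ.out.eq (G.rot (e, true))
  rw [← hσ.input.arr_two, dartCode_true] at h₂
  simp only [notLast, Expr.eval, h₆, hσ.input.reg_four, h₂]
  rcases hG.eq_last h h' with hl | rfl
  · simp [hl]
  · rw [if_pos rfl]
    split_ifs <;> rfl

end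

end RAM

/-! ### Correctness of the passes through the successor lists -/

namespace RAM

open EmbeddedDigraph

variable {W n m : ℕ} {G : EmbeddedDigraph (Fin n) (Fin m)} {σ : State} {u : Fin n} {e₀ : Fin m}

theorem numBack_le (u : Fin n) (k : ℕ) : G.numBack u k ≤ k := by
  classical
  rw [numBack_eq]
  exact (Finset.card_filter_le _ _).trans (Finset.card_range k).le

theorem numForth_le (u : Fin n) (k : ℕ) : G.numForth u k ≤ k := by
  classical
  rw [numForth_eq]
  exact (Finset.card_filter_le _ _).trans (Finset.card_range k).le

/-- The first best peak among the positions up to `k`. -/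
noncomputable def bestUpTo (G : EmbeddedDigraph (Fin n) (Fin m)) (u : Fin n) : ℕ → ℕ
  | 0 => 0
  | k + 1 => if G.numBack u (k + 1) + G.numForth u (bestUpTo G u k) <
      G.numBack u (bestUpTo G u k) + G.numForth u (k + 1) then k + 1 else bestUpTo G u k

theorem bestUpTo_le (k : ℕ) : bestUpTo G u k ≤ k := by
  induction k with
  | zero => exact le_rfl
  | succ k ih =>
    rw [bestUpTo]
    split_ifs
    · exact le_rfl
    · omega

theorem bestUpTo_min (k : ℕ) : ∀ h ≤ k, G.numBack u (bestUpTo G u k) + G.numForth u h ≤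
    G.numBack u h + G.numForth u (bestUpTo G u k) := by
  induction k with
  | zero =>
    intro h hh
    obtain rfl : h = 0 := by omega
    exact le_rfl
  | succ k ih =>
    intro h hh
    rw [bestUpTo]
    rcases Nat.lt_or_eq_of_le hh with hh | rfl
    · have := ih h (by omega)
      split_ifs <;> omega
    · split_ifs <;> omega

/-- The peak chosen by the algorithm. -/
noncomputable def peak (G : EmbeddedDigraph (Fin n) (Fin m)) (u : Fin n) : ℕ :=
  bestUpTo G u ((G.succList u).length - 1)

theorem isBestPeak_peak (u : Fin n) : G.IsBestPeak u (peak G u) := by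
  refine ⟨fun h => ?_, fun h' hh' => ?_⟩
  · have h₁ := List.length_pos_iff.2 h
    have h₂ : peak G u ≤ _ := bestUpTo_le _
    omega
  · have : G.numBack u (peak G u) + G.numForth u h' ≤ G.numBack u h' + G.numForth u (peak G u) :=
      bestUpTo_min _ h' (by omega)
    omega

theorem length_succList_le (hG : G.IsPlanarST) (u : Fin n) : (G.succList u).length ≤ m := by
  simpa using (hG.isSuccList_succList u).nodup.length_le_card

theorem runs_startPass (hW : 2 * m ≤ W) (h : Ready G σ) (h₅ : σ.reg 5 = u)
    (h₀ : (G.succList u)[0]? = some e₀) {Q : State → Prop} (hQ : Q (σ.setReg 6 (e₀ + e₀))) :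
    wp W startPass Q σ := by
  have := e₀.2
  simp only [startPass, wp, Expr.eval, h₅, h.first u e₀ h₀]
  exact ⟨by omega, hQ⟩

theorem runs_peakLoop (hG : G.IsPlanarST) (hW : 2 * m ≤ W) (A : ℕ → ℕ) (h : Ready G σ)
    (h₃ : σ.arr 3 = A) (h₅ : σ.reg 5 = u) (h₀ : (G.succList u)[0]? = some e₀)
    (h₆ : σ.reg 6 = e₀ + e₀) (h₇ : σ.reg 7 = 0) (h₈ : σ.reg 8 = 0) (h₉ : σ.reg 9 = 0)
    (h₁₀ : σ.reg 10 = 0) (h₁₁ : σ.reg 11 = 0) (h₁₂ : σ.reg 12 = 0) :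
    Runs W (.loop notLast peakBody) σ (52 * (G.succList u).length) fun σ => Ready G σ ∧
      σ.arr 3 = A ∧ σ.reg 5 = u ∧ σ.reg 12 = peak G u := by
  have hlen := length_succList_le hG u
  have hpos : 0 < (G.succList u).length := (List.getElem?_eq_some_iff.1 h₀).1
  refine (Runs.loop_const (fun k σ => Ready G σ ∧ σ.arr 3 = A ∧ σ.reg 5 = u ∧
    (∃ e, (G.succList u)[k]? = some e ∧ σ.reg 6 = e + e) ∧ σ.reg 7 = G.numBack u k ∧
    σ.reg 8 = G.numForth u k ∧ σ.reg 9 = k ∧ σ.reg 10 = G.numBack u (bestUpTo G u k) ∧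
    σ.reg 11 = G.numForth u (bestUpTo G u k) ∧ σ.reg 12 = bestUpTo G u k)
    ((G.succList u).length - 1) peakBody.time ?_ ?_ ?_).mono ?_ ?_
  · rintro k hk σ ⟨h, h₃, h₅, ⟨e, he, h₆⟩, h₇, h₈, h₉, h₁₀, h₁₁, h₁₂⟩
    have he' : (G.succList u)[k + 1]? = some (G.succList u)[k + 1] :=
      List.getElem?_eq_getElem (by omega)
    obtain ⟨e', hee⟩ : ∃ x, x = (G.succList u)[k + 1] := ⟨_, rfl⟩
    rw [← hee] at he'
    refine ⟨h.notLast_ne_zero hG he he' h₆, Runs.of_wp ?_⟩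
    have hb := h.add_back hG he he'
    have hf := h.add_forth hG he he'
    have hb' := numBack_le (G := G) u (k + 1)
    have hf' := numForth_le (G := G) u (k + 1)
    have e'2 := e'.2
    simp only [peakBody, forthTest, wp, Expr.eval, State.setReg_reg, State.setReg_arr, h₆, h₇, h₈,
      h₉, h₁₀, h₁₁, h₁₂, reduceIte, Nat.reduceEqDiff, h.rot_eq hG he he', hb, hf, h₃, h₅,
      ready_setReg (show 5 ≤ 6 by norm_num), ready_setReg (show 5 ≤ 7 by norm_num),
      ready_setReg (show 5 ≤ 8 by norm_num), ready_setReg (show 5 ≤ 9 by norm_num),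
      ready_setReg (show 5 ≤ 10 by norm_num), ready_setReg (show 5 ≤ 11 by norm_num),
      ready_setReg (show 5 ≤ 12 by norm_num), h, true_and]
    refine ⟨by omega, by omega, by omega, by omega, fun hc => ?_, fun hc => ?_⟩
    · have hc' := (ite_ne_right_iff.1 hc).1
      simp only [bestUpTo, if_pos hc', and_true]
      exact ⟨by omega, by omega, by omega, e', he', rfl⟩
    · have hc' := fun h' => one_ne_zero ((if_pos h').symm.trans hc)
      simp only [bestUpTo, if_neg hc', and_true]
      exact ⟨e', he', rfl⟩
  · rintro σ ⟨h, -, -, ⟨e, he, h₆⟩, -⟩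
    exact h.notLast_eq_zero hG he (List.getElem?_eq_none (by omega)) h₆
  · exact ⟨h, h₃, h₅, ⟨e₀, h₀, h₆⟩, by simpa [numBack_eq] using h₇, by simpa [numForth_eq] using h₈,
      h₉, by simpa [bestUpTo, numBack_eq] using h₁₀, by simpa [bestUpTo, numForth_eq] using h₁₁, h₁₂⟩
  -- The final loop test is absorbed because the list is not empty.
  · change ((G.succList u).length - 1) * 50 + 12 ≤ _
    omega
  · rintro σ ⟨h, h₃, h₅, -, -, -, -, -, -, h₁₂⟩
    exact ⟨h, h₃, h₅, h₁₂⟩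

/-- The edges marked in the first `k` steps of the walk through the successor list of `u`. -/
def Marked (G : EmbeddedDigraph (Fin n) (Fin m)) (u : Fin n) (h k : ℕ) (e : Fin m) : Prop :=
  ∃ i < k, (i < h ∧ (G.succList u)[i]? = some e ∧ G.IsBack u i) ∨
    (h ≤ i ∧ (G.succList u)[i + 1]? = some e ∧ G.IsForth u i)

theorem marked_succ {h k : ℕ} {e : Fin m} : Marked G u h (k + 1) e ↔ Marked G u h k e ∨
    ((k < h ∧ (G.succList u)[k]? = some e ∧ G.IsBack u k) ∨
      (h ≤ k ∧ (G.succList u)[k + 1]? = some e ∧ G.IsForth u k)) := by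
  constructor
  · rintro ⟨i, hi, H⟩
    rcases Nat.lt_or_eq_of_le (Nat.lt_succ_iff.1 hi) with hi | rfl
    · exact Or.inl ⟨i, hi, H⟩
    · exact Or.inr H
  · rintro (⟨i, hi, H⟩ | H)
    · exact ⟨i, by omega, H⟩
    · exact ⟨k, by omega, H⟩

theorem marked_iff (hG : G.IsPlanarST) (h : Fin n → ℕ) (e : Fin m) :
    Marked G u (h u) ((G.succList u).length - 1) e ↔ G.tail e = u ∧ e ∈ G.peakSplitSet h := by
  rw [mem_peakSplitSet]
  constructor
  · rintro ⟨i, hi, ⟨h₁, h₂, e₁, e', h₃, h₄, h₅⟩ | ⟨h₁, h₂, e', e₁, h₃, h₄, h₅⟩⟩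
    · obtain rfl : e = e₁ := by simpa [h₂] using h₃
      obtain rfl := hG.tail_of_getElem? h₂
      exact ⟨rfl, i, e', Or.inl ⟨h₁, h₂, h₄, h₅⟩⟩
    · obtain rfl : e = e₁ := by simpa [h₂] using h₄
      obtain rfl := hG.tail_of_getElem? h₂
      exact ⟨rfl, i, e', Or.inr ⟨h₁, h₃, h₂, h₅⟩⟩
  · rintro ⟨rfl, i, e', ⟨h₁, h₂, h₃, h₄⟩ | ⟨h₁, h₂, h₃, h₄⟩⟩ <;>
      have hlt := (List.getElem?_eq_some_iff.1 h₃).1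
    · exact ⟨i, by omega, Or.inl ⟨h₁, h₂, e, e', h₂, h₃, h₄⟩⟩
    · exact ⟨i, by omega, Or.inr ⟨h₁, h₃, e', e, h₂, h₃, h₄⟩⟩

theorem runs_markLoop (hG : G.IsPlanarST) (hW : 2 * m ≤ W) {A : Fin m → Prop} {p : ℕ}
    (hp : p ≤ m) (h : Ready G σ) (h₃ : ∀ e : Fin m, σ.arr 3 e = open Classical in if A e then 1 else 0)
    (h₅ : σ.reg 5 = u) (h₀ : (G.succList u)[0]? = some e₀)
    (h₆ : σ.reg 6 = e₀ + e₀) (h₁₂ : σ.reg 12 = p) :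
    Runs W (.loop notLast markBody) σ (52 * (G.succList u).length) fun σ => Ready G σ ∧
      (∀ e : Fin m, σ.arr 3 e = open Classical in
        if A e ∨ Marked G u p ((G.succList u).length - 1) e then 1 else 0) ∧ σ.reg 5 = u := by
  classical
  have hlen := length_succList_le hG u
  have hpos : 0 < (G.succList u).length := (List.getElem?_eq_some_iff.1 h₀).1
  refine (Runs.loop_const (fun k σ => Ready G σ ∧
    (∀ e : Fin m, σ.arr 3 e = if A e ∨ Marked G u p k e then 1 else 0) ∧ σ.reg 5 = u ∧
    (∃ e, (G.succList u)[k]? = some e ∧ σ.reg 6 = e + e) ∧ σ.reg 12 = p - k)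
    ((G.succList u).length - 1) markBody.time ?_ ?_ ?_).mono ?_ ?_
  · rintro k hk σ ⟨h, h₃, h₅, ⟨e, he, h₆⟩, h₁₂⟩
    have he' : (G.succList u)[k + 1]? = some (G.succList u)[k + 1] :=
      List.getElem?_eq_getElem (by omega)
    obtain ⟨e', hee⟩ : ∃ x, x = (G.succList u)[k + 1] := ⟨_, rfl⟩
    rw [← hee] at he'
    refine ⟨h.notLast_ne_zero hG he he' h₆, Runs.of_wp ?_⟩
    have hb := h.isBack_iff hG he he'
    have hf := h.isForth_iff hG he he'
    have e2 := e.2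
    have e'2 := e'.2
    have hrot := h.rot_eq hG he he'
    have hmark : ∀ x : Fin m, (∀ b, Marked G u p (k + 1) b ↔ Marked G u p k b ∨ b = x) →
        ∀ b : Fin m, (if (b : ℕ) = x then 1 else σ.arr 3 b) =
          if A b ∨ Marked G u p (k + 1) b then 1 else 0 := by
      intro x hx b
      simp only [hx, h₃, Fin.val_inj]
      by_cases hbx : b = x <;> simp [hbx]
    have hkeep : (∀ b, Marked G u p (k + 1) b ↔ Marked G u p k b) →
        ∀ b : Fin m, σ.arr 3 b = if A b ∨ Marked G u p (k + 1) b then 1 else 0 := by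
      intro hx b
      rw [hx, h₃]
    simp only [markBody, forthTest, mark, wp, Expr.eval, State.setReg_reg, State.setReg_arr,
      State.setArr_reg, State.setArr_arr, h₆, h₁₂, reduceIte, Nat.reduceEqDiff, hrot, h.out.1,
      Nat.add_sub_cancel, true_and,
      ready_setReg (show 5 ≤ 6 by norm_num), ready_setReg (show 5 ≤ 12 by norm_num), ready_setArr,
      h, h₅, false_and, if_false]
    simp only [marked_succ, he, he', Option.some.injEq, ← hf] at hmark hkeep ⊢
    refine ⟨fun hpk => ⟨fun hbk => ⟨by omega, by omega, by omega, by omega, hmark e fun b => ?_,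
      ⟨e', rfl, rfl⟩, by omega⟩, fun hbk => ⟨by omega, by omega, hkeep fun b => ?_, ⟨e', rfl, rfl⟩, by omega⟩⟩,
      fun hpk => ⟨by omega, fun hfk => ⟨by omega, by omega, hmark e' fun b => ?_, ⟨e', rfl, rfl⟩, by omega⟩,
        fun hfk => ⟨hkeep fun b => ?_, ⟨e', rfl, rfl⟩, by omega⟩⟩⟩
    · have h₁ : k < p := by omega
      have h₂ : ¬ p ≤ k := by omega
      simp [h₁, h₂, hb.1 hbk, eq_comm]
    · have h₂ : ¬ p ≤ k := by omega
      have h₃ : ¬ G.IsBack u k := fun h => hb.2 h hbk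
      simp [h₂, h₃]
    · have h₁ : ¬ k < p := by omega
      have h₂ : p ≤ k := by omega
      have h₃ := (ite_ne_right_iff.1 hfk).1
      simp [h₁, h₂, h₃, eq_comm]
    · have h₁ : ¬ k < p := by omega
      have h₃ := fun h => one_ne_zero ((if_pos h).symm.trans hfk)
      simp only [h₁, false_and, false_or, or_iff_left_iff_imp]
      exact fun h => (h₃ h.2.2).elim
  · rintro σ ⟨h, -, -, ⟨e, he, h₆⟩, -⟩
    exact h.notLast_eq_zero hG he (List.getElem?_eq_none (by omega)) h₆
  · refine ⟨h, fun e => ?_, h₅, ⟨e₀, h₀, h₆⟩, by simpa using h₁₂⟩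
    have : ¬ Marked G u p 0 e := fun ⟨i, hi, _⟩ => absurd hi (Nat.not_lt_zero i)
    simp [h₃ e, this]
  · change ((G.succList u).length - 1) * 32 + 12 ≤ _
    omega
  · rintro σ ⟨h, h₃, h₅, -⟩
    exact ⟨h, h₃, h₅⟩

theorem runs_vertexBody (hG : G.IsPlanarST) (hW : 2 * m ≤ W) (hn : n ≤ W) (h : Ready G σ)
    (h₃ : ∀ e : Fin m, σ.arr 3 e = open Classical in
      if G.tail e < u ∧ e ∈ G.peakSplitSet (peak G) then 1 else 0) (h₅ : σ.reg 5 = u) :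
    Runs W vertexBody σ (104 * (G.succList u).length + 28) fun σ => Ready G σ ∧
      (∀ e : Fin m, σ.arr 3 e = open Classical in
        if (G.tail e : ℕ) < u + 1 ∧ e ∈ G.peakSplitSet (peak G) then 1 else 0) ∧
        σ.reg 5 = u + 1 := by
  classical
  have hu := u.2
  have hlt : ∀ v : Fin n, (v : ℕ) < u + 1 ↔ v < u ∨ v = u := fun v => by
    rw [← Fin.val_inj, Fin.lt_def]
    omega
  have hcond : (Expr.eq (.reg 5) (.reg 3)).eval σ = if u = G.t then 1 else 0 := by
    simp only [Expr.eval, h₅, h.input.reg_three, Fin.val_inj]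
  refine (Runs.seq (R := fun σ => Ready G σ ∧
      (∀ e : Fin m, σ.arr 3 e =
        if (G.tail e : ℕ) < u + 1 ∧ e ∈ G.peakSplitSet (peak G) then 1 else 0) ∧ σ.reg 5 = u)
    (T₁ := 4 + (104 * (G.succList u).length + 20)) (T₂ := 4) ?_ ?_).mono (by omega) fun _ => id
  · refine (Runs.cond (T := 104 * (G.succList u).length + 20) ?_ ?_).mono le_rfl fun _ => id
    -- The sink is skipped: its successor list is empty, so array `6` holds no meaningful start for
    -- it.
    · intro hc
      rw [hcond] at hc
      have hut := (ite_ne_right_iff.1 hc).1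
      refine Runs.mono (Runs.of_wp (p := .nop) ?_) (by simp [Prog.time]) fun _ => id
      refine ⟨h, fun e => ?_, h₅⟩
      have : G.tail e ≠ u := fun h => hG.tail_ne_sink e (h.trans hut)
      simp [h₃, hlt, this]
    · intro hc
      rw [hcond] at hc
      have hut := fun h => one_ne_zero ((if_pos h).symm.trans hc)
      have hpos : 0 < (G.succList u).length :=
        Nat.pos_of_ne_zero fun h => hut (hG.length_succList_eq_zero.1 h)
      have h₀ : (G.succList u)[0]? = some (G.succList u)[0] := List.getElem?_eq_getElem hpos
      generalize (G.succList u)[0] = e₀ at h₀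
      refine (Runs.seq (T₁ := 15) (T₂ := 52 * (G.succList u).length + (3 + 52 * (G.succList u).length))
        (R := fun σ' => Ready G σ' ∧ σ'.arr 3 = σ.arr 3 ∧ σ'.reg 5 = u ∧ σ'.reg 6 = e₀ + e₀ ∧
          σ'.reg 7 = 0 ∧ σ'.reg 8 = 0 ∧ σ'.reg 9 = 0 ∧ σ'.reg 10 = 0 ∧ σ'.reg 11 = 0 ∧
          σ'.reg 12 = 0) ?_ ?_).mono (by omega) fun _ => id
      · refine Runs.of_wp (p := .seq startPass resetPeak) ?_
        refine runs_startPass hW h h₅ h₀ ?_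
        simp [resetPeak, wp, Expr.eval, h, h₅]
      · rintro σ₁ ⟨h', h₃', h₅', h₆, h₇, h₈, h₉, h₁₀, h₁₁, h₁₂⟩
        refine Runs.seq (runs_peakLoop hG hW _ h' h₃' h₅' h₀ h₆ h₇ h₈ h₉ h₁₀ h₁₁ h₁₂) ?_
        rintro σ₂ ⟨h', h₃', h₅', h₁₂⟩
        refine Runs.seq (T₁ := 3) (R := fun σ' => Ready G σ' ∧ σ'.arr 3 = σ.arr 3 ∧
          σ'.reg 5 = u ∧ σ'.reg 6 = e₀ + e₀ ∧ σ'.reg 12 = peak G u) ?_ ?_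
        · refine Runs.of_wp (p := startPass) ?_
          refine runs_startPass hW h' h₅' h₀ ?_
          simp [h', h₃', h₅', h₁₂]
        · rintro σ₃ ⟨h', h₃', h₅', h₆, h₁₂⟩
          have hle : peak G u ≤ m :=
            (bestUpTo_le _).trans ((Nat.sub_le _ _).trans (length_succList_le hG u))
          refine (runs_markLoop hG hW (A := fun e => G.tail e < u ∧ e ∈ G.peakSplitSet (peak G))
            hle h' (fun e => by rw [h₃']; convert h₃ e) h₅' h₀ h₆ h₁₂).mono le_rfl ?_
          rintro σ₄ ⟨h', h₃', h₅'⟩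
          refine ⟨h', fun e => ?_, h₅'⟩
          simp only [h₃', marked_iff hG, hlt, or_and_right]
  · rintro σ' ⟨h, h₃, h₅⟩
    refine Runs.of_wp (p := .assign 5 (.add (.reg 5) (.const 1))) ?_
    simp only [wp, Expr.eval, h₅, ready_setReg (le_refl 5), State.setReg_reg, State.setReg_arr,
      if_true]
    exact ⟨by omega, h, h₃, trivial⟩

theorem runs_vertexLoop (hG : G.IsPlanarST) (hW : 2 * m ≤ W) (hn : n ≤ W) (h : Ready G σ)
    (h₃ : ∀ i, σ.arr 3 i = 0) (h₅ : σ.reg 5 = 0) :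
    Runs W (forLoop 0 vertexBody) σ (104 * m + 32 * n + 4) fun σ =>
      IsOutput σ (G.peakSplitSet (peak G)) := by
  classical
  refine (Runs.loop (fun i σ => Ready G σ ∧
    (∀ e : Fin m, σ.arr 3 e =
      if (G.tail e : ℕ) < i ∧ e ∈ G.peakSplitSet (peak G) then 1 else 0) ∧ σ.reg 5 = i) n
    (fun i => if hi : i < n then 104 * (G.succList ⟨i, hi⟩).length + 28 else 0) ?_ ?_ ?_).mono ?_ ?_
  · rintro i hi σ ⟨h, h₃, h₅⟩
    refine ⟨by simp [Expr.eval, h₅, h.input.reg_zero, hi], ?_⟩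
    rw [dif_pos hi]
    exact runs_vertexBody (u := ⟨i, hi⟩) hG hW hn h h₃ h₅
  · rintro σ ⟨h, -, h₅⟩
    simp [Expr.eval, h₅, h.input.reg_zero]
  · exact ⟨h, fun e => by simp [h₃], h₅⟩
  -- The successor lists together have `m` entries, which makes the nested loops linear.
  · rw [Finset.sum_range]
    simp only [Fin.is_lt, dite_true, Fin.eta, Finset.sum_add_distrib, ← Finset.mul_sum,
      hG.sum_length_succList, Finset.sum_const, Finset.card_univ, Fintype.card_fin, smul_eq_mul]
    simp only [Expr.cost]
    omega
  · rintro σ ⟨-, h₃, -⟩ e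
    rw [h₃]
    simp

theorem runs_splitProg (hG : G.IsPlanarST) (hW : 2 * m ≤ W) (hn : n ≤ W) :
    Runs W splitProg (inputState G) (141 * m + 32 * n + 24) fun σ =>
      IsOutput σ (G.peakSplitSet (peak G)) := by
  refine (Runs.seq (runs_outLoop hW hasInput_inputState rfl (fun _ => rfl) (fun _ => rfl)
    fun _ => rfl) (T₂ := 2 + (22 * m + 5 + (8 + (104 * m + 32 * n + 4)))) ?_).mono (by omega)
    fun _ => id
  rintro σ ⟨h, ho, h₃, h₄⟩
  refine Runs.seq (R := fun σ => (HasInput G σ ∧ HasOut m σ ∧ (∀ i, σ.arr 3 i = 0) ∧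
    ∀ i, σ.arr 4 i = 0) ∧ σ.reg 5 = 0) ?_ ?_
  · refine Runs.of_wp (p := .assign 5 (.const 0)) ?_
    simp only [wp, Expr.eval, hasInput_setReg (le_refl 5), HasOut, State.setReg_arr,
      State.setReg_reg, if_true, and_true]
    exact ⟨Nat.zero_le _, h, ho, h₃, h₄⟩
  rintro σ ⟨⟨h, ho, h₃, h₄⟩, h₅⟩
  refine Runs.seq (runs_turnLoop hG hW hn h ho h₅ h₃ h₄) ?_
  rintro σ ⟨h, ho, h₃, ht⟩
  refine Runs.seq (runs_startSource hG hW hn h ho h₃ ht) ?_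
  rintro σ ⟨h, h₅, h₃⟩
  exact runs_vertexLoop hG hW hn h h₃ h₅

end RAM

theorem mainTheorem6 :
    (∀ (V E : Type*) [Fintype V] [Fintype E] (G : EmbeddedDigraph V E), G.IsPlanarST →
      (∃ D : Finset E, G.IsMinSplitSet D) ∧
      (∀ D : Finset E, G.IsMinSplitSet D → 3 ≤ Fintype.card V → D.card + 3 ≤ Fintype.card V) ∧
      (∀ h : V → ℕ, (∀ u, G.IsBestPeak u (h u)) →
        G.IsMinSplitSet (G.peakSplitSet h) ∧
        ((G.peakSplitSet h).card : ℤ) = ∑ u, ((G.numForth u (G.succList u).length : ℤ) +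
          (G.numBack u (h u) - G.numForth u (h u))))) ∧
    (∃ (P : RAM.Prog) (C : ℕ), ∀ (n m : ℕ) (G : EmbeddedDigraph (Fin n) (Fin m)), G.IsPlanarST →
      ∃ (k : ℕ) (σ : RAM.State) (D : Finset (Fin m)) (h : Fin n → ℕ),
        RAM.Exec (C * n) P (RAM.inputState G) k σ ∧ k ≤ C * n ∧ RAM.IsOutput σ D ∧
        G.IsMinSplitSet D ∧ (∀ u, G.IsBestPeak u (h u)) ∧ D = G.peakSplitSet h) := by
  refine ⟨fun V E _ _ G hG => ⟨?_, fun D hD hV => hG.card_le_of_isMinSplitSet hD hV,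
    fun h hh => ⟨hG.isMinSplitSet_peakSplitSet hh, hG.card_peakSplitSet h⟩⟩,
    RAM.splitProg, 500, fun n m G hG => ?_⟩
  · choose h hh using EmbeddedDigraph.exists_isBestPeak (G := G)
    exact ⟨_, hG.isMinSplitSet_peakSplitSet hh⟩
  · have hm := hG.card_edges_le
    have hn := hG.two_le_card
    rw [Fintype.card_fin] at hn hm
    rw [Fintype.card_fin] at hm
    -- Since `m ≤ 3 * n` and `2 ≤ n`, the time `141 * m + 32 * n + 24` is at most `467 * n`, and the
    -- stored numbers need only `2 * m ≤ 6 * n`.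
    obtain ⟨k, σ, h₁, h₂, h₃⟩ :=
      RAM.runs_splitProg (W := 500 * n) hG (by omega) (by omega)
    exact ⟨k, σ, _, RAM.peak G, h₁, by omega, h₃,
      hG.isMinSplitSet_peakSplitSet RAM.isBestPeak_peak, RAM.isBestPeak_peak, rfl⟩
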